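/- **Setting.** Fix integers $n,g,r\ge 0$, a positive semidefinite $n$-qubit Hamiltonian $H$, a power of two $\kappa_H\ge\|H\|$ (spectral norm), and $\beta\ge 0$; $\log$ is $\log_2$, $\rho_\beta=e^{-\beta H}/\mathrm{tr}(e^{-\beta H})$, $\|M\|_1=\mathrm{tr}\sqrt{M^\dagger M}$, and for a linear map $\mathcal R$ on operators that preserves Hermiticity $\|\mathcal R\|=\max\{\|\mathcal R(M)\|_1: M=M^\dagger,\ \|M\|_1=1\}$. A state is a positive semidefinite operator of trace one. Let $\{C_j\}_j$ be a finite set of $n$-qubit unitaries closed under adjoint, and $\mu$ a probability distribution on it with $\mu(C)=\mu(C^\dagger)$. *Phase estimation.* An $r$-bit string $b=b_1\dots b_r$ stands for the integer $\sum_j b_j2^{r-j}$ and for the energy $E(b)=\kappa_H\sum_{j} b_j2^{-j}$. Let $\mathrm{QFT}|x\rangle=2^{-r/2}\sum_y e^{2\pi i xy/2^r}|y\rangle$ on $r$ qubits and $CU=\sum_b e^{2\pi i bH/\kappa_H}\otimes|b\rangle\langle b|$. Put $\mathrm{qpe}=(I\otimes\mathrm{QFT}^\dagger)\,CU\,(I\otimes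 \mathsf{Had}^{\otimes r})$ and $\mathrm{fqpe}=(I\otimes\mathrm{QFT})\,CU^\dagger\,(I\otimes\mathsf{Had}^{\otimes r})$, where $\mathsf{Had}$ is the Hadamard gate. $\mathrm{BQPE}$ (resp. $\mathrm{FBQPE}$) applies $\mathrm{qpe}$ (resp. $\mathrm{fqpe}$) to the system and, in turn, to each of $g$ blocks of $r$ qubits. For a basis state $|E\rangle$ of such a $gr$-qubit register, $\overline E$ is the median of its $g$ energies (for even $g$, the lower of the two middle values; for $g=0$, zero), and $f_{EE'}=\min\{1,\exp(\beta\overline E-\beta\overline{E'})\}$. *One iteration.* Registers 1, 2, 3, 4 have $n,gr,gr,1$ qubits. For $\tau\in[0,1]$ let $$W=\sum_{E,E'}|EE'\rangle\langle EE'|\otimes\begin{pmatrix}\sqrt{1-\tau^2f_{EE'}}&\tau\sqrt{f_{EE'}}\\ \tau\sqrt{f_{EE'}}&-\sqrt{1-\tau^2f_{EE'}}\end{pmatrix}$$ on registers 2, 3, 4, let $\Delta_z$ project register 4 onto $|z\rangle$, and for $\mathcal C=(C,\mathrm{QPE})$ with $\mathrm{QPE}\in\{\mathrm{BQPE},\mathrm{FBQPE}\}$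 let $U_{\mathcal C}=\mathrm{QPE}_{1,3}\,C\,\mathrm{QPE}_{1,2}$. Put $O_a=\Delta_1W\Delta_0U_{\mathcal C}$, $O_b=\Delta_1W^\dagger\Delta_0W\Delta_0U_{\mathcal C}$, $O_r=U_{\mathcal C}^\dagger\Delta_0W^\dagger\Delta_0W\Delta_0U_{\mathcal C}$ and, with $|\mathbf 0\rangle=|0^{2gr+1}\rangle$, $$\mathcal E[\tau](\rho)=\sum_{\mathcal C}\tfrac12\mu(C)\sum_{s\in\{a,b,r\}}\mathrm{tr}_{2,3,4}\big(O_s(\rho\otimes|\mathbf 0\rangle\langle \mathbf 0|)O_s^\dagger\big).$$ *The generator* (it does not depend on $\tau$). Let $W^{(10)}=\sum\sqrt{f_{EE'}}\,|EE'\rangle\langle EE'|\otimes|1\rangle\langle0|$, $W^{(000)}=(W^{(10)})^\dagger W^{(10)}$, $X_{\mathcal C}=\langle \mathbf 0|U_{\mathcal C}^\dagger W^{(000)}U_{\mathcal C}|\mathbf 0\rangle$ and $$\mathcal L(\rho)=\sum_{\mathcal C}\tfrac12\mu(C)\Big(2\,\mathrm{tr}_{2,3,4}\big(W^{(10)}U_{\mathcal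 C}(\rho\otimes|\mathbf 0\rangle\langle \mathbf 0|)U_{\mathcal C}^\dagger W^{(10)\dagger}\big)-X_{\mathcal C}\rho-\rho X_{\mathcal C}\Big).$$ **Theorem.** 1. *(Expansion and error terms)* $\mathcal L$ preserves Hermiticity, and there are linear maps $\mathcal J[\tau]$, preserving Hermiticity, such that for every $\tau\in[0,1]$ the map $\mathcal E[\tau]$ is completely positive and trace preserving, $\mathcal E[\tau]=\mathcal I+\tau^2\mathcal L+\tau^4\mathcal J[\tau]$, and $\|\mathcal J[\tau]\|\le4$. 2. *(Fixed point)* If $r\ge1+\log\kappa_H+\log\beta$ (no condition when $\beta=0$) and $\|H\|\le\kappa_H(1-2^{-r})$, the largest energy that $r$ bits represent, then $$\|\mathcal L(\rho_\beta)\|_1\le 2^{2n+4-g/6}+40\,\beta\,\kappa_H\,2^{-r}.$$ 3. *(Uniqueness and relaxation)* If the jump operators $C$ with $\mu(C)>0$ generate the algebra of all $n$-qubit operators, then there is a full-rank state $\rho_{\mathcal L}$ with $\mathcal L(\rho_{\mathcal L})=0$, every operator $M$ with $\mathcal L(M)=0$ is $\mathrm{tr}(M)\,\rho_{\mathcal L}$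 (so $\rho_{\mathcal L}$ is the only fixed state), and $\lim_{t\to\infty}e^{t\mathcal L}(\rho)=\rho_{\mathcal L}$ for every state $\rho$. -/

import Mathlib

open scoped ComplexOrder

namespace QMetropolis

open scoped Matrix Kronecker

noncomputable section

/-! ### Registers, norms, states, linear maps on operators -/

/-- Computational basis labels of an `m`-qubit register. -/
abbrev Bits (m : ℕ) : Type := Fin m → Fin 2

/-- Operators on the Hilbert space with orthonormal basis `ι`. -/
abbrev Op (ι : Type) : Type := Matrix ι ι ℂ

/-- Basis labels of a register made of `g` blocks of `r` qubits. -/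
abbrev Reg (g r : ℕ) : Type := Fin g → Bits r

/-- Basis labels of the three ancillary registers (registers 2, 3 and 4). -/
abbrev Anc (g r : ℕ) : Type := Reg g r × Reg g r × Fin 2

/-- Basis labels of all four registers; register 1 holds `n` qubits. -/
abbrev Total (n g r : ℕ) : Type := Bits n × Anc g r

/-- The spectral norm (operator norm for the Euclidean norm). -/
def specNorm {ι : Type} [Fintype ι] [DecidableEq ι] (M : Op ι) : ℝ :=
  ‖Matrix.toEuclideanCLM (n := ι) (𝕜 := ℂ) M‖

/-- The trace norm `tr √(M† M)`, that is, the sum of the square roots of the eigenvalues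
of `M† M`. -/
def traceNorm {ι : Type} [Fintype ι] [DecidableEq ι] (M : Op ι) : ℝ :=
  ∑ i, √((Matrix.isHermitian_conjTranspose_mul_self M).eigenvalues i)

/-- Quantum states: positive semidefinite operators of trace one. -/
def IsState {ι : Type} [Fintype ι] (ρ : Op ι) : Prop :=
  ρ.PosSemidef ∧ ρ.trace = 1

/-- Completely positive trace preserving maps, through Kraus operators. -/
def IsCPTP {ι : Type} [Fintype ι] [DecidableEq ι] (R : Op ι →ₗ[ℂ] Op ι) : Prop :=
  ∃ (m : ℕ) (A : Fin m → Op ι),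
    (∀ M, R M = ∑ u, A u * M * (A u)ᴴ) ∧ ∑ u, (A u)ᴴ * A u = 1

/-- `R` restricts to a map from Hermitian operators to Hermitian operators. -/
def HermitianPreserving {ι : Type} (R : Op ι →ₗ[ℂ] Op ι) : Prop :=
  ∀ M : Op ι, M.IsHermitian → (R M).IsHermitian

/-- The norm of `R` induced by the trace norm on Hermitian operators,
`max {‖R M‖₁ : M Hermitian, ‖M‖₁ = 1}`, is at most `c`. -/
def SuperNormLE {ι : Type} [Fintype ι] [DecidableEq ι] (R : Op ι →ₗ[ℂ] Op ι) (c : ℝ) : Prop :=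
  ∀ M : Op ι, M.IsHermitian → traceNorm M = 1 → traceNorm (R M) ≤ c

/-- `e^{tR}(M)`, as the exponential series `∑ₖ tᵏ/k! Rᵏ(M)` (which converges for every `R`,
the space of operators being finite dimensional). -/
def expSemigroup {ι : Type} (R : Op ι →ₗ[ℂ] Op ι) (t : ℝ) (M : Op ι) : Op ι :=
  ∑' k : ℕ, ((t ^ k / (k.factorial : ℝ) : ℝ) : ℂ) • (R ^ k) M

/-- The Gibbs state `exp(-βH) / tr exp(-βH)`. -/
def gibbsState {ι : Type} [Fintype ι] [DecidableEq ι] (H : Op ι) (β : ℝ) : Op ι :=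
  (Matrix.trace (NormedSpace.exp (-(β : ℂ) • H)))⁻¹ • NormedSpace.exp (-(β : ℂ) • H)

/-! ### Phase estimation -/

/-- The integer `b_1 b_2 … b_r` (binary, most significant bit first). -/
def bitsToNat {r : ℕ} (b : Bits r) : ℕ :=
  ∑ j : Fin r, (b j : ℕ) * 2 ^ (r - 1 - (j : ℕ))

/-- The energy `E(b) = κ ∑_{j=1}^r b_j 2^{-j}`; the index `j` starts at `0` here. -/
def energy (κ : ℝ) {r : ℕ} (b : Bits r) : ℝ :=
  κ * ∑ j : Fin r, ((b j : ℕ) : ℝ) / 2 ^ ((j : ℕ) + 1)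

/-- A Hadamard gate on each of `r` qubits. -/
def hadamardLayer (r : ℕ) : Op (Bits r) :=
  Matrix.of fun x y => ∏ j : Fin r, ((1 / √2 : ℝ) : ℂ) * (-1) ^ ((x j : ℕ) * (y j : ℕ))

/-- The quantum Fourier transform `|x⟩ ↦ 2^{-r/2} ∑_y e^{2πi x y / 2^r} |y⟩`. -/
def qft (r : ℕ) : Op (Bits r) :=
  Matrix.of fun y x => ((1 / √(2 ^ r) : ℝ) : ℂ) *
    Complex.exp (2 * Real.pi * Complex.I * (bitsToNat x : ℂ) * (bitsToNat y : ℂ) / 2 ^ r)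

/-- The unitary `e^{iHt}` with `t = 2π/κ`. -/
def evolution {ι : Type} [Fintype ι] [DecidableEq ι] (H : Op ι) (κ : ℝ) : Op ι :=
  NormedSpace.exp (((2 * Real.pi / κ : ℝ) : ℂ) • Complex.I • H)

/-- `∑_b V^b ⊗ |b⟩⟨b|`, the product of the controlled powers `V^(2^k)`, each controlled by
the qubit of binary weight `2^k`. -/
def controlledPower {ι : Type} [Fintype ι] [DecidableEq ι] (r : ℕ) (V : Op ι) :
    Op (ι × Bits r) :=
  Matrix.of fun x y => if x.2 = y.2 then (V ^ bitsToNat x.2) x.1 y.1 else 0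

/-- Standard phase estimation with `r` bits of precision: Hadamard gates, controlled powers of
`e^{2πiH/κ}`, inverse Fourier transform. -/
def qpe {ι : Type} [Fintype ι] [DecidableEq ι] (H : Op ι) (κ : ℝ) (r : ℕ) : Op (ι × Bits r) :=
  ((1 : Op ι) ⊗ₖ (qft r)ᴴ) * controlledPower r (evolution H κ) * ((1 : Op ι) ⊗ₖ hadamardLayer r)

/-- Flipped phase estimation: Hadamard gates, the adjoint of the controlled powers, Fourier
transform. -/
def flippedQpe {ι : Type} [Fintype ι] [DecidableEq ι] (H : Op ι) (κ : ℝ) (r : ℕ) :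
    Op (ι × Bits r) :=
  ((1 : Op ι) ⊗ₖ qft r) * (controlledPower r (evolution H κ))ᴴ * ((1 : Op ι) ⊗ₖ hadamardLayer r)

/-- The operator `Q` acting on register 1 and on the `i`-th block of a `g`-block register. -/
def onBlock {ι : Type} {g r : ℕ} (i : Fin g) (Q : Op (ι × Bits r)) : Op (ι × Reg g r) :=
  Matrix.of fun x y =>
    if ∀ k, k ≠ i → x.2 k = y.2 k then Q (x.1, x.2 i) (y.1, y.2 i) else 0

/-- `Q` applied to register 1 and to each of the `g` blocks in turn. -/
def boost {ι : Type} [Fintype ι] [DecidableEq ι] (g : ℕ) {r : ℕ} (Q : Op (ι × Bits r)) :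
    Op (ι × Reg g r) :=
  (List.ofFn fun i : Fin g => onBlock i Q).prod

/-- Boosted phase estimation (`flip = false`) and flipped boosted phase estimation
(`flip = true`). -/
def boostedQPE {ι : Type} [Fintype ι] [DecidableEq ι] (H : Op ι) (κ : ℝ) (g r : ℕ)
    (flip : Bool) : Op (ι × Reg g r) :=
  boost g (if flip then flippedQpe H κ r else qpe H κ r)

/-- The median of `g` numbers: the entry in the middle of the sorted list, and for even `g` the
lower of the two middle entries (`0` for the empty list). -/
def median {g : ℕ} (x : Fin g → ℝ) : ℝ :=
  if h : 0 < g then x (Tuple.sort x ⟨(g - 1) / 2, by omega⟩) else 0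

/-- The median of the `g` energy estimates stored in a register. -/
def medianEnergy (κ : ℝ) {g r : ℕ} (E : Reg g r) : ℝ :=
  median fun i => energy κ (E i)

/-- The Metropolis acceptance rate. -/
def acceptRate (κ β : ℝ) {g r : ℕ} (E E' : Reg g r) : ℝ :=
  min 1 (Real.exp (β * medianEnergy κ E - β * medianEnergy κ E'))

/-! ### Operators on the four registers -/

/-- `C` on register 1. -/
def onSystem {n : ℕ} (g r : ℕ) (C : Op (Bits n)) : Op (Total n g r) :=
  C ⊗ₖ (1 : Op (Anc g r))

/-- `Q` on registers 1 and 2. -/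
def onRegs12 {n g r : ℕ} (Q : Op (Bits n × Reg g r)) : Op (Total n g r) :=
  Matrix.of fun x y => if x.2.2 = y.2.2 then Q (x.1, x.2.1) (y.1, y.2.1) else 0

/-- `Q` on registers 1 and 3. -/
def onRegs13 {n g r : ℕ} (Q : Op (Bits n × Reg g r)) : Op (Total n g r) :=
  Matrix.of fun x y =>
    if x.2.1 = y.2.1 ∧ x.2.2.2 = y.2.2.2 then Q (x.1, x.2.2.1) (y.1, y.2.2.1) else 0

/-- `∑_{E,E'} |EE'⟩⟨EE'| ⊗ B E E'` on registers 2, 3 and 4. -/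
def controlledQubit (n : ℕ) {g r : ℕ} (B : Reg g r → Reg g r → Op (Fin 2)) :
    Op (Total n g r) :=
  (1 : Op (Bits n)) ⊗ₖ (Matrix.of fun x y : Anc g r =>
    if x.1 = y.1 ∧ x.2.1 = y.2.1 then B x.1 x.2.1 x.2.2 y.2.2 else 0)

/-- The acceptance operator `W`. -/
def opW (n g r : ℕ) (κ β τ : ℝ) : Op (Total n g r) :=
  controlledQubit n fun E E' =>
    !![((√(1 - τ ^ 2 * acceptRate κ β E E') : ℝ) : ℂ), ((τ * √(acceptRate κ β E E') : ℝ) : ℂ);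
       ((τ * √(acceptRate κ β E E') : ℝ) : ℂ), ((-√(1 - τ ^ 2 * acceptRate κ β E E') : ℝ) : ℂ)]

/-- The projection of register 4 onto `|z⟩`. -/
def measProj (n g r : ℕ) (z : Fin 2) : Op (Total n g r) :=
  controlledQubit n fun _ _ => Matrix.single z z 1

/-- `U = QPE_{1,3} ∘ C ∘ QPE_{1,2}`, for the chosen version of phase estimation. -/
def opU {n : ℕ} (H : Op (Bits n)) (κ : ℝ) (g r : ℕ) (flip : Bool) (C : Op (Bits n)) :
    Op (Total n g r) :=
  onRegs13 (boostedQPE H κ g r flip) * onSystem g r C * onRegs12 (boostedQPE H κ g r flip)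

/-- The partial trace over registers 2, 3 and 4. -/
def traceAnc {n g r : ℕ} (M : Op (Total n g r)) : Op (Bits n) :=
  Matrix.of fun s s' => ∑ a : Anc g r, M (s, a) (s', a)

/-- The map `ρ ↦ tr_{2,3,4} (O [ρ ⊗ |0…0⟩⟨0…0|] O†)`. -/
def ancMap {n g r : ℕ} (O : Op (Total n g r)) : Op (Bits n) →ₗ[ℂ] Op (Bits n) where
  toFun ρ := traceAnc (O * (ρ ⊗ₖ (Matrix.single 0 0 1 : Op (Anc g r))) * Oᴴ)
  map_add' ρ σ := by
    ext s s'
    simp [traceAnc, Matrix.add_kronecker, Matrix.mul_add, Matrix.add_mul, Finset.sum_add_distrib]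
  map_smul' c ρ := by
    ext s s'
    simp [traceAnc, Matrix.smul_kronecker, Finset.mul_sum]

/-! ### One iteration of the algorithm -/

/-- Case Accept. -/
def opAcc {n : ℕ} (H : Op (Bits n)) (κ β : ℝ) (g r : ℕ) (τ : ℝ) (flip : Bool)
    (C : Op (Bits n)) : Op (Total n g r) :=
  measProj n g r 1 * opW n g r κ β τ * measProj n g r 0 * opU H κ g r flip C

/-- Case Alternate Accept. -/
def opAlt {n : ℕ} (H : Op (Bits n)) (κ β : ℝ) (g r : ℕ) (τ : ℝ) (flip : Bool)
    (C : Op (Bits n)) : Op (Total n g r) :=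
  (measProj n g r 1 * (opW n g r κ β τ)ᴴ * measProj n g r 0) *
    (measProj n g r 0 * opW n g r κ β τ * measProj n g r 0) * opU H κ g r flip C

/-- Case Reject. -/
def opRej {n : ℕ} (H : Op (Bits n)) (κ β : ℝ) (g r : ℕ) (τ : ℝ) (flip : Bool)
    (C : Op (Bits n)) : Op (Total n g r) :=
  (opU H κ g r flip C)ᴴ * (measProj n g r 0 * (opW n g r κ β τ)ᴴ * measProj n g r 0) *
    (measProj n g r 0 * opW n g r κ β τ * measProj n g r 0) * opU H κ g r flip C

/-- One iteration `𝓔[τ]` of the algorithm: the version of phase estimation is chosen uniformly,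
the jump operator `C ∈ 𝒞` with probability `μ C`, and the three cases are added up. -/
def iteration {n : ℕ} (H : Op (Bits n)) (κ β : ℝ) (g r : ℕ) (𝒞 : Finset (Op (Bits n)))
    (μ : Op (Bits n) → ℝ) (τ : ℝ) : Op (Bits n) →ₗ[ℂ] Op (Bits n) :=
  ∑ C ∈ 𝒞, ∑ flip : Bool, ((1 / 2 * μ C : ℝ) : ℂ) •
    (ancMap (opAcc H κ β g r τ flip C) + ancMap (opAlt H κ β g r τ flip C) +
      ancMap (opRej H κ β g r τ flip C))

/-! ### The generator -/

/-- `W^{(10)} = ∑ √f_{EE'} |EE'⟩⟨EE'| ⊗ |1⟩⟨0|`. -/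
def opW10 (n g r : ℕ) (κ β : ℝ) : Op (Total n g r) :=
  controlledQubit n fun E E' => Matrix.single 1 0 ((√(acceptRate κ β E E') : ℝ) : ℂ)

/-- `W^{(000)} = ∑ f_{EE'} |EE'⟩⟨EE'| ⊗ |0⟩⟨0|`. -/
def opW000 (n g r : ℕ) (κ β : ℝ) : Op (Total n g r) :=
  controlledQubit n fun E E' => Matrix.single 0 0 ((acceptRate κ β E E' : ℝ) : ℂ)

/-- `𝓜^{(a)}`, for given choices. -/
def mapMa {n : ℕ} (H : Op (Bits n)) (κ β : ℝ) (g r : ℕ) (flip : Bool) (C : Op (Bits n)) :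
    Op (Bits n) →ₗ[ℂ] Op (Bits n) :=
  ancMap (opW10 n g r κ β * opU H κ g r flip C)

/-- `⟨0…0| U† W^{(000)} U |0…0⟩`, an operator on register 1. -/
def rejBlock {n : ℕ} (H : Op (Bits n)) (κ β : ℝ) (g r : ℕ) (flip : Bool) (C : Op (Bits n)) :
    Op (Bits n) :=
  Matrix.of fun s s' =>
    ((opU H κ g r flip C)ᴴ * opW000 n g r κ β * opU H κ g r flip C) (s, 0) (s', 0)

/-- `𝓜^{(r)}`, for given choices: `ρ ↦ X ρ + ρ X` with `X = ⟨0…0| U† W^{(000)} U |0…0⟩`. -/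
def mapMr {n : ℕ} (H : Op (Bits n)) (κ β : ℝ) (g r : ℕ) (flip : Bool) (C : Op (Bits n)) :
    Op (Bits n) →ₗ[ℂ] Op (Bits n) :=
  LinearMap.mulLeft ℂ (rejBlock H κ β g r flip C) +
    LinearMap.mulRight ℂ (rejBlock H κ β g r flip C)

/-- The generator `𝓛`: the average of `2 𝓜^{(a)} - 𝓜^{(r)}` over the random choices. -/
def generator {n : ℕ} (H : Op (Bits n)) (κ β : ℝ) (g r : ℕ) (𝒞 : Finset (Op (Bits n)))
    (μ : Op (Bits n) → ℝ) : Op (Bits n) →ₗ[ℂ] Op (Bits n) :=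
  ∑ C ∈ 𝒞, ∑ flip : Bool, ((1 / 2 * μ C : ℝ) : ℂ) •
    ((2 : ℂ) • mapMa H κ β g r flip C - mapMr H κ β g r flip C)

/-- `𝒞` is a finite set of unitaries closed under adjoint, and `μ` a probability distribution
on `𝒞` that gives `C` and `C†` the same probability. -/
structure IsJumpDistribution {n : ℕ} (𝒞 : Finset (Op (Bits n))) (μ : Op (Bits n) → ℝ) :
    Prop where
  unitary : ∀ C ∈ 𝒞, C ∈ Matrix.unitaryGroup (Bits n) ℂ
  adjoint_mem : ∀ C ∈ 𝒞, Cᴴ ∈ 𝒞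
  nonneg : ∀ C ∈ 𝒞, 0 ≤ μ C
  sum_eq_one : ∑ C ∈ 𝒞, μ C = 1
  adjoint_prob : ∀ C ∈ 𝒞, μ Cᴴ = μ C

end

end QMetropolis

/-!
Let `K = jumpOp H κ g r flip C E E'` be the operator that one choice of `(C, QPE)` applies to the
system when registers 2 and 3 go from zero to `E` and `E'`. Cutting all operators into the blocks
`colBlock` out of the zero state of the ancillas turns the partial traces into sums over such `K`,
and `∑ K†K = 1` because phase estimation and `C` are unitary. In these terms the generator is a
purely dissipative Lindblad generator with jump operators `K` and rates given by the acceptance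
rates `f_{EE'}` (`generator_eq_lindblad`).

*Expansion.* The three cases of an iteration involve `τ √f`, `τ √f √(1 - τ² f)` and `1 - τ² f` on
registers 2 and 3, so the expansion in `τ` stops at order four (`sum_ancMap_op`). The coefficient of
`τ⁴` is the difference of two completely positive maps that do not increase the trace of positive
operators, since `f ≤ 1`; the Jordan decomposition of a Hermitian operator bounds it by `2`
(`superNormLE_quarticError`).

*Fixed point.* In the eigenbasis of `H` all blocks of phase estimation are diagonal
(`colBlock_boostedQPE`), and flipped phase estimation has the complex conjugate amplitudes. Hence
reversing a jump, `(C, E, E') ↦ (C†, E', E)`, together with the exchange of the two versions of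
phase estimation maps `K` to `K†`, and the anticommutator part of the generator can be written with
`K K†` and `f_{E'E}` (`generator_apply_reversed`). The two parts then cancel on the Gibbs state up
to the factors `exp (β (M E - λ))`, with `M E` the median estimate and `λ` the true energy. Outcomes
with `|M E - λ| ≤ κ / 2^r` contribute at most a multiple of `β κ / 2^r`. The others have probability
at most `2^(-g/3)` by a Chernoff bound, because one phase estimation fails with probability at most
`1 - 8/π² < 0.195`; the Cauchy-Schwarz inequality makes this an error `2^(-g/6)`. Both estimates
are `norm_gibbs_defect_le`, applied to the trace of the defect against the unitary that attains its
trace norm.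

*Uniqueness and relaxation.* For fixed `C` the sum of the `K` is `C`, as the amplitudes of an
eigenvector add up to one (`sum_jumpOp`); so the `K` generate the full matrix algebra when the `C`
do. For a Hermitian `M` in the kernel, the populations in its own eigenbasis are stationary under a
classical Markov chain, so the span of the eigenvectors with positive eigenvalue is invariant under
all `K` and is trivial or everything. Kernel elements are therefore definite, which gives existence,
full rank and uniqueness (`exists_stationary_state`). For relaxation, in the Heisenberg picture
`tr (σ X†X)` decreases at the rate `2 ∑ w tr (σ [X, K]†[X, K])`, which vanishes only for multiples
of the identity, so it is a strict Lyapunov function on the observables with `tr (X σ) = 0`.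
-/

namespace QMetropolis

open scoped Matrix Kronecker

/-! ### The trace norm of Hermitian operators -/

section TraceNorm

variable {ι : Type} [Fintype ι] [DecidableEq ι]

theorem exists_unitary_diagonal {M : Op ι} (hM : M.IsHermitian) :
    ∃ (Φ : Op ι) (m : ι → ℝ), Φᴴ * Φ = 1 ∧ Φ * Φᴴ = 1 ∧
      M = Φ * Matrix.diagonal (fun i => (m i : ℂ)) * Φᴴ := by
  refine ⟨hM.eigenvectorUnitary, hM.eigenvalues, ?_, ?_, ?_⟩
  · exact Unitary.coe_star_mul_self hM.eigenvectorUnitary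
  · exact Unitary.coe_mul_star_self hM.eigenvectorUnitary
  · exact hM.spectral_theorem

theorem traceNorm_unitary_diagonal {Φ : Op ι} (h1 : Φᴴ * Φ = 1) (m : ι → ℝ) :
    traceNorm (Φ * Matrix.diagonal (fun i => (m i : ℂ)) * Φᴴ) = ∑ i, |m i| := by
  set M := Φ * Matrix.diagonal (fun i => (m i : ℂ)) * Φᴴ with hM
  have hMM : Mᴴ * M = Φ * Matrix.diagonal (fun i => ((m i ^ 2 : ℝ) : ℂ)) * Φᴴ := by
    have : Mᴴ = M := by
      simp only [hM, Matrix.conjTranspose_mul, Matrix.conjTranspose_conjTranspose,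
        Matrix.diagonal_conjTranspose, Matrix.mul_assoc]
      congr 3
      ext i
      simp
    rw [this, hM]
    calc _ = Φ * Matrix.diagonal (fun i => (m i : ℂ)) * (Φᴴ * Φ)
          * Matrix.diagonal (fun i => (m i : ℂ)) * Φᴴ := by simp only [Matrix.mul_assoc]
      _ = _ := by
        rw [h1, Matrix.mul_one, Matrix.mul_assoc Φ, Matrix.diagonal_mul_diagonal]
        congr 3
        ext i
        push_cast
        ring
  have hherm := Matrix.isHermitian_conjTranspose_mul_self M
  have hroots : (Mᴴ * M).charpoly.roots
      = Multiset.map (fun i => ((m i ^ 2 : ℝ) : ℂ)) Finset.univ.val := by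
    rw [hMM, Matrix.charpoly_mul_comm, ← Matrix.mul_assoc, h1, Matrix.one_mul,
      Matrix.charpoly_diagonal, Polynomial.roots_prod]
    · simp only [Polynomial.roots_X_sub_C, Multiset.bind_singleton]
    · exact Finset.prod_ne_zero_iff.2 fun i _ => Polynomial.X_sub_C_ne_zero _
  rw [hherm.roots_charpoly_eq_eigenvalues] at hroots
  have h2 := congrArg (Multiset.map (fun z : ℂ => √z.re)) hroots
  rw [Multiset.map_map, Multiset.map_map] at h2
  have h3 := congrArg Multiset.sum h2
  have h4 : ∑ i, √(hherm.eigenvalues i) = ∑ i, √(m i ^ 2) := by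
    simp only [Function.comp_def, RCLike.ofReal_eq_complex_ofReal, Complex.ofReal_re] at h3
    exact h3
  rw [traceNorm, h4]
  exact Finset.sum_congr rfl fun i _ => Real.sqrt_sq_eq_abs _

/-- The sign of a Hermitian operator attains the trace norm in the duality between the trace norm
and the spectral norm. -/
theorem exists_unitary_trace_eq_traceNorm {M : Op ι} (hM : M.IsHermitian) :
    ∃ Q : Op ι, Qᴴ * Q = 1 ∧ (Q * M).trace = traceNorm M := by
  obtain ⟨Φ, m, h1, h2, rfl⟩ := exists_unitary_diagonal hM
  rw [traceNorm_unitary_diagonal h1]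
  refine ⟨Φ * Matrix.diagonal (fun i => if 0 ≤ m i then (1 : ℂ) else -1) * Φᴴ, ?_, ?_⟩
  · simp only [Matrix.conjTranspose_mul, Matrix.conjTranspose_conjTranspose,
      Matrix.diagonal_conjTranspose]
    calc _ = Φ * (Matrix.diagonal (star fun i => if 0 ≤ m i then (1 : ℂ) else -1) * (Φᴴ * Φ)
          * Matrix.diagonal (fun i => if 0 ≤ m i then (1 : ℂ) else -1)) * Φᴴ := by
          simp only [Matrix.mul_assoc]
      _ = Φ * (1 : Op ι) * Φᴴ := by
          rw [h1, Matrix.mul_one, Matrix.diagonal_mul_diagonal, ← Matrix.diagonal_one]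
          congr 3
          ext i
          by_cases h : 0 ≤ m i <;> simp [h]
      _ = 1 := by rw [Matrix.mul_one, h2]
  · have : Φ * Matrix.diagonal (fun i => if 0 ≤ m i then (1 : ℂ) else -1) * Φᴴ *
        (Φ * Matrix.diagonal (fun i => (m i : ℂ)) * Φᴴ)
        = Φ * Matrix.diagonal (fun i => ((|m i| : ℝ) : ℂ)) * Φᴴ := by
      calc _ = Φ * (Matrix.diagonal (fun i => if 0 ≤ m i then (1 : ℂ) else -1) * (Φᴴ * Φ)
          * Matrix.diagonal (fun i => (m i : ℂ))) * Φᴴ := by simp only [Matrix.mul_assoc]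
        _ = _ := by
          rw [h1, Matrix.mul_one, Matrix.diagonal_mul_diagonal]
          congr 3
          ext i
          by_cases h : 0 ≤ m i
          · simp [h, abs_of_nonneg h]
          · simp [h, abs_of_neg (not_le.1 h)]
    rw [this, Matrix.trace_mul_comm, ← Matrix.mul_assoc, h1, Matrix.one_mul, Matrix.trace_diagonal]
    push_cast
    rfl

theorem trace_unitary_conj {Φ : Op ι} (h2 : Φ * Φᴴ = 1) (M : Op ι) :
    (Φᴴ * M * Φ).trace = M.trace := by
  rw [Matrix.trace_mul_comm, ← Matrix.mul_assoc, h2, Matrix.one_mul]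

theorem traceNorm_sub_le {P N : Op ι} (hP : P.PosSemidef) (hN : N.PosSemidef) :
    traceNorm (P - N) ≤ P.trace.re + N.trace.re := by
  obtain ⟨Φ, m, h1, h2, h⟩ := exists_unitary_diagonal (hP.1.sub hN.1)
  rw [h, traceNorm_unitary_diagonal h1, ← trace_unitary_conj h2 P, ← trace_unitary_conj h2 N]
  have hd : Φᴴ * P * Φ - Φᴴ * N * Φ = Matrix.diagonal (fun i => (m i : ℂ)) := by
    rw [← Matrix.sub_mul, ← Matrix.mul_sub, h]
    calc _ = (Φᴴ * Φ) * Matrix.diagonal (fun i => (m i : ℂ)) * (Φᴴ * Φ) := by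
          simp only [Matrix.mul_assoc]
      _ = _ := by rw [h1, Matrix.one_mul, Matrix.mul_one]
  simp only [Matrix.trace, Complex.re_sum, ← Finset.sum_add_distrib]
  refine Finset.sum_le_sum fun i _ => ?_
  have hi := congrArg Complex.re (congrFun (congrFun hd i) i)
  simp only [Matrix.sub_apply, Matrix.diagonal_apply_eq, Complex.sub_re, Complex.ofReal_re] at hi
  have p := (Complex.le_def.1 ((hP.conjTranspose_mul_mul_same Φ).diag_nonneg (i := i))).1
  have q := (Complex.le_def.1 ((hN.conjTranspose_mul_mul_same Φ).diag_nonneg (i := i))).1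
  simp only [Complex.zero_re] at p q
  rw [← hi, Matrix.diag, Matrix.diag, abs_le]
  constructor <;> linarith

/-- The Jordan decomposition of a Hermitian operator. -/
theorem exists_posSemidef_sub {M : Op ι} (hM : M.IsHermitian) :
    ∃ P N : Op ι, P.PosSemidef ∧ N.PosSemidef ∧ M = P - N ∧
      P.trace.re + N.trace.re = traceNorm M := by
  obtain ⟨Φ, m, h1, h2, rfl⟩ := exists_unitary_diagonal hM
  have key : ∀ d : ι → ℝ, (∀ i, 0 ≤ d i) →
      (Φ * Matrix.diagonal (fun i => (d i : ℂ)) * Φᴴ).PosSemidef ∧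
      (Φ * Matrix.diagonal (fun i => (d i : ℂ)) * Φᴴ).trace.re = ∑ i, d i := by
    intro d hd
    constructor
    · refine Matrix.PosSemidef.mul_mul_conjTranspose_same (Matrix.PosSemidef.diagonal ?_) Φ
      intro i
      simpa using hd i
    · rw [Matrix.trace_mul_comm, ← Matrix.mul_assoc, h1, Matrix.one_mul, Matrix.trace_diagonal]
      simp
  refine ⟨_, _, (key (fun i => max (m i) 0) fun i => le_max_right _ _).1,
    (key (fun i => max (-m i) 0) fun i => le_max_right _ _).1, ?_, ?_⟩
  · rw [← Matrix.sub_mul, ← Matrix.mul_sub, Matrix.diagonal_sub]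
    congr 3
    ext i
    rw [← Complex.ofReal_sub]
    congr 1
    rcases le_total 0 (m i) with h | h
    · rw [max_eq_left h, max_eq_right (by linarith)]; ring
    · rw [max_eq_right h, max_eq_left (by linarith)]; ring
  · rw [(key _ fun i => le_max_right _ _).2, (key _ fun i => le_max_right _ _).2,
      traceNorm_unitary_diagonal h1, ← Finset.sum_add_distrib]
    refine Finset.sum_congr rfl fun i _ => ?_
    rcases le_total 0 (m i) with h | h
    · rw [max_eq_left h, max_eq_right (by linarith), abs_of_nonneg h]; ring
    · rw [max_eq_right h, max_eq_left (by linarith), abs_of_nonpos h]; ring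

end TraceNorm

/-! ### Lindblad generators and their stationary states -/

section Lindblad

variable {ι : Type} [Fintype ι] [DecidableEq ι] {υ : Type} [Fintype υ]

/-- The purely dissipative Lindblad generator
`M ↦ ∑ᵤ wᵤ (2 Kᵤ M Kᵤ† - Kᵤ†Kᵤ M - M Kᵤ†Kᵤ)` with jump operators `Kᵤ` and rates `2 wᵤ`. -/
noncomputable def lindblad (w : υ → ℝ) (K : υ → Op ι) : Op ι →ₗ[ℂ] Op ι :=
  ∑ u, (w u : ℂ) • ((2 : ℂ) • (LinearMap.mulLeft ℂ (K u) ∘ₗ LinearMap.mulRight ℂ (K u)ᴴ) -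
    LinearMap.mulLeft ℂ ((K u)ᴴ * K u) - LinearMap.mulRight ℂ ((K u)ᴴ * K u))

/-- The adjoint of `lindblad w K` for the pairing `(X, M) ↦ tr (X M)`, that is, the generator in
the Heisenberg picture. -/
noncomputable def lindbladDual (w : υ → ℝ) (K : υ → Op ι) : Op ι →ₗ[ℂ] Op ι :=
  ∑ u, (w u : ℂ) • ((2 : ℂ) • (LinearMap.mulLeft ℂ (K u)ᴴ ∘ₗ LinearMap.mulRight ℂ (K u)) -
    LinearMap.mulLeft ℂ ((K u)ᴴ * K u) - LinearMap.mulRight ℂ ((K u)ᴴ * K u))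

theorem lindblad_apply (w : υ → ℝ) (K : υ → Op ι) (M : Op ι) :
    lindblad w K M = ∑ u, (w u : ℂ) • ((2 : ℂ) • (K u * M * (K u)ᴴ) - (K u)ᴴ * K u * M
      - M * ((K u)ᴴ * K u)) := by
  simp [lindblad, LinearMap.sum_apply, Matrix.mul_assoc]

theorem lindbladDual_apply (w : υ → ℝ) (K : υ → Op ι) (X : Op ι) :
    lindbladDual w K X = ∑ u, (w u : ℂ) • ((2 : ℂ) • ((K u)ᴴ * X * K u) - (K u)ᴴ * K u * X
      - X * ((K u)ᴴ * K u)) := by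
  simp [lindbladDual, LinearMap.sum_apply, Matrix.mul_assoc]

theorem trace_mul_lindblad (w : υ → ℝ) (K : υ → Op ι) (X M : Op ι) :
    (X * lindblad w K M).trace = (lindbladDual w K X * M).trace := by
  rw [lindblad_apply, lindbladDual_apply, Matrix.mul_sum, Matrix.sum_mul, Matrix.trace_sum,
    Matrix.trace_sum]
  refine Finset.sum_congr rfl fun u _ => ?_
  have h1 : (X * (K u * M * (K u)ᴴ)).trace = ((K u)ᴴ * X * K u * M).trace := by
    rw [← Matrix.mul_assoc, Matrix.trace_mul_comm]; simp only [Matrix.mul_assoc]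
  have h2 : (X * ((K u)ᴴ * K u * M)).trace = (X * ((K u)ᴴ * K u) * M).trace := by
    simp only [Matrix.mul_assoc]
  have h3 : (X * (M * ((K u)ᴴ * K u))).trace = ((K u)ᴴ * K u * X * M).trace := by
    rw [← Matrix.mul_assoc, Matrix.trace_mul_comm]; simp only [Matrix.mul_assoc]
  simp only [Matrix.mul_smul, Matrix.smul_mul, Matrix.mul_sub, Matrix.sub_mul, Matrix.trace_smul,
    Matrix.trace_sub, h1, h2, h3]
  ring

theorem lindbladDual_one (w : υ → ℝ) (K : υ → Op ι) : lindbladDual w K 1 = 0 := by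
  rw [lindbladDual_apply]
  refine Finset.sum_eq_zero fun u _ => ?_
  rw [Matrix.mul_one, Matrix.mul_one, Matrix.one_mul, two_smul]
  simp

theorem trace_lindblad (w : υ → ℝ) (K : υ → Op ι) (M : Op ι) :
    (lindblad w K M).trace = 0 := by
  have := trace_mul_lindblad w K 1 M
  rwa [lindbladDual_one, Matrix.zero_mul, Matrix.trace_zero, Matrix.one_mul] at this

theorem lindblad_conjTranspose (w : υ → ℝ) (K : υ → Op ι) (M : Op ι) :
    lindblad w K Mᴴ = (lindblad w K M)ᴴ := by
  rw [lindblad_apply, lindblad_apply, Matrix.conjTranspose_sum]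
  refine Finset.sum_congr rfl fun u _ => ?_
  simp only [Matrix.conjTranspose_smul, Matrix.conjTranspose_sub, Matrix.conjTranspose_mul,
    Matrix.conjTranspose_conjTranspose, Matrix.mul_assoc]
  rw [sub_right_comm]
  simp

theorem lindblad_unitary_conj (w : υ → ℝ) (K : υ → Op ι) {Φ : Op ι} (h1 : Φᴴ * Φ = 1)
    (D : Op ι) :
    Φᴴ * lindblad w K (Φ * D * Φᴴ) * Φ = lindblad w (fun u => Φᴴ * K u * Φ) D := by
  have h2 : Φ * Φᴴ = 1 := mul_eq_one_comm.1 h1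
  have e1 : ∀ A : Op ι, Φᴴ * (Φ * A) = A := fun A => by
    rw [← Matrix.mul_assoc, h1, Matrix.one_mul]
  have e2 : ∀ A : Op ι, Φ * (Φᴴ * A) = A := fun A => by
    rw [← Matrix.mul_assoc, h2, Matrix.one_mul]
  rw [lindblad_apply, lindblad_apply, Matrix.mul_sum, Matrix.sum_mul]
  refine Finset.sum_congr rfl fun u _ => ?_
  simp only [Matrix.mul_smul, Matrix.smul_mul, Matrix.mul_sub, Matrix.sub_mul,
    Matrix.conjTranspose_mul, Matrix.conjTranspose_conjTranspose, Matrix.mul_assoc, e1, e2, h1,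
    Matrix.mul_one]

/-- The populations of a diagonal operator evolve under a Lindblad generator as in a classical
Markov chain with jump rates `2 wᵤ |(Kᵤ)ᵢⱼ|²`. -/
theorem lindblad_diagonal_apply (w : υ → ℝ) (K : υ → Op ι) (m : ι → ℝ) (i : ι) :
    lindblad w K (Matrix.diagonal fun i => (m i : ℂ)) i i =
      ((∑ u, w u * (2 * ∑ j, (‖K u i j‖ ^ 2 * m j - ‖K u j i‖ ^ 2 * m i)) : ℝ) : ℂ) := by
  rw [lindblad_apply, Matrix.sum_apply, Complex.ofReal_sum]
  refine Finset.sum_congr rfl fun u _ => ?_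
  have h1 : (K u * Matrix.diagonal (fun i => (m i : ℂ)) * (K u)ᴴ) i i
      = ∑ j, ((‖K u i j‖ ^ 2 * m j : ℝ) : ℂ) := by
    rw [Matrix.mul_apply]
    refine Finset.sum_congr rfl fun j _ => ?_
    rw [Matrix.mul_diagonal, Matrix.conjTranspose_apply]
    push_cast
    rw [← Complex.mul_conj', starRingEnd_apply]
    ring
  have h2 : ((K u)ᴴ * K u) i i = ∑ j, ((‖K u j i‖ ^ 2 : ℝ) : ℂ) := by
    rw [Matrix.mul_apply]
    refine Finset.sum_congr rfl fun j _ => ?_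
    rw [Matrix.conjTranspose_apply]
    push_cast
    rw [← Complex.conj_mul', starRingEnd_apply]
  simp only [Matrix.smul_apply, Matrix.sub_apply, Matrix.mul_diagonal, Matrix.diagonal_mul, h1, h2,
    smul_eq_mul, Finset.sum_sub_distrib, ← Finset.sum_mul]
  push_cast
  ring

/-- Kernel elements are definite. In an eigenbasis of a Hermitian `M` the eigenvectors with
positive eigenvalue form a set of states that the classical flow of `lindblad_diagonal_apply` can
neither leave nor enter, so they span a subspace invariant under all jump operators. -/
theorem pos_or_nonpos_of_lindblad_eq_zero {w : υ → ℝ} {K : υ → Op ι} (hw : ∀ u, 0 ≤ w u)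
    (hK : Algebra.adjoin ℂ {A | ∃ u, 0 < w u ∧ K u = A} = ⊤) {Φ : Op ι} (h1 : Φᴴ * Φ = 1)
    {m : ι → ℝ} (hM : lindblad w K (Φ * Matrix.diagonal (fun i => (m i : ℂ)) * Φᴴ) = 0) :
    (∀ i, 0 < m i) ∨ (∀ i, m i ≤ 0) := by
  classical
  have h2 : Φ * Φᴴ = 1 := mul_eq_one_comm.1 h1
  set k : υ → Op ι := fun u => Φᴴ * K u * Φ with hk
  set S : Finset ι := Finset.univ.filter fun i => 0 < m i with hS
  have hpop : ∀ i, ∑ u, w u * (2 * ∑ j, (‖k u i j‖ ^ 2 * m j - ‖k u j i‖ ^ 2 * m i)) = 0 := by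
    intro i
    have h := lindblad_unitary_conj w K h1 (Matrix.diagonal fun i => (m i : ℂ))
    rw [hM, Matrix.mul_zero, Matrix.zero_mul] at h
    have := lindblad_diagonal_apply w k m i
    rw [← h, Matrix.zero_apply] at this
    exact_mod_cast this.symm
  -- the net flow between two states of `S` cancels, so only the flow across its boundary is left
  have hflow : ∑ u, w u * (2 * ∑ i ∈ S, ∑ j ∈ Sᶜ, (‖k u i j‖ ^ 2 * m j - ‖k u j i‖ ^ 2 * m i))
      = 0 := by
    have h3 : ∑ i ∈ S, ∑ u, w u * (2 * ∑ j, (‖k u i j‖ ^ 2 * m j - ‖k u j i‖ ^ 2 * m i)) = 0 :=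
      Finset.sum_eq_zero fun i _ => hpop i
    rw [Finset.sum_comm] at h3
    rw [← h3]
    refine Finset.sum_congr rfl fun u _ => ?_
    rw [← Finset.mul_sum, ← Finset.mul_sum]
    congr 2
    have h4 : ∑ i ∈ S, ∑ j ∈ S, (‖k u i j‖ ^ 2 * m j - ‖k u j i‖ ^ 2 * m i) = 0 := by
      simp only [Finset.sum_sub_distrib]
      rw [sub_eq_zero]
      exact Finset.sum_comm
    calc _ = ∑ i ∈ S, ∑ j ∈ S, (‖k u i j‖ ^ 2 * m j - ‖k u j i‖ ^ 2 * m i)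
          + ∑ i ∈ S, ∑ j ∈ Sᶜ, (‖k u i j‖ ^ 2 * m j - ‖k u j i‖ ^ 2 * m i) := by
          rw [h4, zero_add]
      _ = _ := by
        rw [← Finset.sum_add_distrib]
        exact Finset.sum_congr rfl fun i _ => Finset.sum_add_sum_compl S _
  have hterm : ∀ u, ∀ i ∈ S, ∀ j ∈ Sᶜ, ‖k u i j‖ ^ 2 * m j - ‖k u j i‖ ^ 2 * m i ≤ 0 := by
    intro u i hi j hj
    have hi' : 0 < m i := by simpa [hS] using hi
    have hj' : m j ≤ 0 := by simpa [hS] using hj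
    have := mul_nonneg (sq_nonneg ‖k u j i‖) hi'.le
    have := mul_nonpos_of_nonneg_of_nonpos (sq_nonneg ‖k u i j‖) hj'
    linarith
  have hzero : ∀ u, 0 < w u → ∀ i ∈ S, ∀ j ∈ Sᶜ, k u j i = 0 := by
    intro u hu i hi j hj
    have h5 := (Finset.sum_eq_zero_iff_of_nonpos (fun u _ =>
      mul_nonpos_of_nonneg_of_nonpos (hw u) (mul_nonpos_of_nonneg_of_nonpos zero_le_two
        (Finset.sum_nonpos fun i hi => Finset.sum_nonpos fun j hj => hterm u i hi j hj)))).1 hflow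
          u (Finset.mem_univ u)
    have h6 : ∑ i ∈ S, ∑ j ∈ Sᶜ, (‖k u i j‖ ^ 2 * m j - ‖k u j i‖ ^ 2 * m i) = 0 := by
      rcases mul_eq_zero.1 h5 with h | h
      · exact absurd h hu.ne'
      · simpa using h
    have h7 := (Finset.sum_eq_zero_iff_of_nonpos fun i hi =>
      Finset.sum_nonpos fun j hj => hterm u i hi j hj).1 h6 i hi
    have h8 := (Finset.sum_eq_zero_iff_of_nonpos fun j hj => hterm u i hi j hj).1 h7 j hj
    have hi' : 0 < m i := by simpa [hS] using hi
    have hj' : m j ≤ 0 := by simpa [hS] using hj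
    have h9 := mul_nonneg (sq_nonneg ‖k u j i‖) hi'.le
    have h10 := mul_nonpos_of_nonneg_of_nonpos (sq_nonneg ‖k u i j‖) hj'
    have h11 : ‖k u j i‖ ^ 2 * m i = 0 := by linarith
    rcases mul_eq_zero.1 h11 with h | h
    · exact norm_eq_zero.1 (pow_eq_zero_iff two_ne_zero |>.1 h)
    · exact absurd h hi'.ne'
  have hall : ∀ A : Op ι, ∀ i ∈ S, ∀ j ∈ Sᶜ, (Φᴴ * A * Φ) j i = 0 := by
    intro A
    have hA : A ∈ Algebra.adjoin ℂ {A | ∃ u, 0 < w u ∧ K u = A} := hK ▸ Algebra.mem_top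
    induction hA using Algebra.adjoin_induction with
    | mem x hx =>
      obtain ⟨u, hu, rfl⟩ := hx
      exact hzero u hu
    | algebraMap c =>
      intro i hi j hj
      have hij : j ≠ i := fun h => Finset.mem_compl.1 hj (h ▸ hi)
      rw [Algebra.algebraMap_eq_smul_one, Matrix.mul_smul, Matrix.smul_mul, Matrix.mul_one, h1,
        Matrix.smul_apply, Matrix.one_apply_ne hij, smul_zero]
    | add x y _ _ hx hy =>
      intro i hi j hj
      rw [Matrix.mul_add, Matrix.add_mul, Matrix.add_apply, hx i hi j hj, hy i hi j hj, add_zero]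
    | mul x y _ _ hx hy =>
      intro i hi j hj
      have : Φᴴ * (x * y) * Φ = (Φᴴ * x * Φ) * (Φᴴ * y * Φ) := by
        calc _ = Φᴴ * x * 1 * y * Φ := by simp only [Matrix.mul_one, Matrix.mul_assoc]
          _ = _ := by rw [← h2]; simp only [Matrix.mul_assoc]
      rw [this, Matrix.mul_apply]
      refine Finset.sum_eq_zero fun l _ => ?_
      by_cases hl : l ∈ S
      · rw [hx l hl j hj, zero_mul]
      · rw [hy i hi l (Finset.mem_compl.2 hl), mul_zero]
  by_contra! hcon
  obtain ⟨⟨j, hj⟩, i, hi⟩ := hcon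
  have h3 := hall (Φ * Matrix.single j i 1 * Φᴴ) i (by simpa [hS] using hi) j
    (by simpa [hS] using hj)
  have h4 : Φᴴ * (Φ * Matrix.single j i 1 * Φᴴ) * Φ = Matrix.single j i 1 := by
    calc _ = (Φᴴ * Φ) * Matrix.single j i 1 * (Φᴴ * Φ) := by simp only [Matrix.mul_assoc]
      _ = _ := by rw [h1, Matrix.one_mul, Matrix.mul_one]
  rw [h4, Matrix.single_apply_same] at h3
  exact one_ne_zero h3

theorem posDef_unitary_diagonal {Φ : Op ι} (h1 : Φᴴ * Φ = 1) {m : ι → ℝ} (hm : ∀ i, 0 < m i) :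
    (Φ * Matrix.diagonal (fun i => (m i : ℂ)) * Φᴴ).PosDef := by
  refine Matrix.PosDef.mul_mul_conjTranspose_same (Matrix.PosDef.diagonal fun i => ?_) ?_
  · exact_mod_cast hm i
  · intro v v' h
    have h2 : Φ * Φᴴ = 1 := mul_eq_one_comm.1 h1
    have := congrArg (fun x => x ᵥ* Φᴴ) h
    simpa [Matrix.vecMul_vecMul, h2] using this

theorem posDef_or_neg_posDef_of_lindblad_eq_zero {w : υ → ℝ} {K : υ → Op ι} (hw : ∀ u, 0 ≤ w u)
    (hK : Algebra.adjoin ℂ {A | ∃ u, 0 < w u ∧ K u = A} = ⊤) {M : Op ι} (hM : M.IsHermitian)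
    (h0 : lindblad w K M = 0) (hne : M ≠ 0) : M.PosDef ∨ (-M).PosDef := by
  obtain ⟨Φ, m, h1, h2, rfl⟩ := exists_unitary_diagonal hM
  have hneg : -(Φ * Matrix.diagonal (fun i => (m i : ℂ)) * Φᴴ)
      = Φ * Matrix.diagonal (fun i => ((-m i : ℝ) : ℂ)) * Φᴴ := by
    rw [← Matrix.neg_mul, ← Matrix.mul_neg, Matrix.diagonal_neg]
    congr 3
    ext i
    simp
  rcases pos_or_nonpos_of_lindblad_eq_zero hw hK h1 h0 with h | h
  · exact Or.inl (posDef_unitary_diagonal h1 h)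
  have h0' : lindblad w K (Φ * Matrix.diagonal (fun i => ((-m i : ℝ) : ℂ)) * Φᴴ) = 0 := by
    rw [← hneg, map_neg, h0, neg_zero]
  rcases pos_or_nonpos_of_lindblad_eq_zero hw hK h1 h0' with h' | h'
  · exact Or.inr (hneg ▸ posDef_unitary_diagonal h1 h')
  · refine absurd ?_ hne
    have : (fun i => (m i : ℂ)) = 0 := by
      ext i
      have : m i = 0 := le_antisymm (h i) (by linarith [h' i])
      simp [this]
    rw [this]
    simp

/-- A Lindblad generator whose jump operators generate the full matrix algebra has a unique
stationary state, and that state has full rank. -/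
theorem exists_stationary_state [Nonempty ι] {w : υ → ℝ} {K : υ → Op ι} (hw : ∀ u, 0 ≤ w u)
    (hK : Algebra.adjoin ℂ {A | ∃ u, 0 < w u ∧ K u = A} = ⊤) :
    ∃ σ : Op ι, σ.PosDef ∧ σ.trace = 1 ∧ lindblad w K σ = 0 ∧
      ∀ M, lindblad w K M = 0 → M = M.trace • σ := by
  -- traces vanish on the range, so the generator is not onto and has a kernel
  have hker : ∃ M, lindblad w K M = 0 ∧ M ≠ 0 := by
    by_contra! hcon
    have hinj : Function.Injective (lindblad w K) :=
      (injective_iff_map_eq_zero _).2 hcon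
    obtain ⟨M, hM⟩ := LinearMap.injective_iff_surjective.1 hinj 1
    have := trace_lindblad w K M
    rw [hM, Matrix.trace_one] at this
    simp at this
  have hzero : ∀ M : Op ι, M.IsHermitian → lindblad w K M = 0 → M.trace = 0 → M = 0 := by
    intro M hM h0 ht
    by_contra hne
    rcases posDef_or_neg_posDef_of_lindblad_eq_zero hw hK hM h0 hne with h | h
    · exact h.trace_pos.ne' ht
    · have := h.trace_pos
      rw [Matrix.trace_neg, ht, neg_zero] at this
      exact lt_irrefl _ this
  have hpart : ∀ M : Op ι, lindblad w K M = 0 → lindblad w K (M + Mᴴ) = 0 ∧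
      lindblad w K (Complex.I • (M - Mᴴ)) = 0 ∧ (M + Mᴴ).IsHermitian ∧
      (Complex.I • (M - Mᴴ)).IsHermitian := by
    intro M hM
    refine ⟨?_, ?_, ?_, ?_⟩
    · rw [map_add, lindblad_conjTranspose, hM, Matrix.conjTranspose_zero, add_zero]
    · rw [map_smul, map_sub, lindblad_conjTranspose, hM, Matrix.conjTranspose_zero, sub_zero,
        smul_zero]
    · simp [Matrix.IsHermitian, add_comm]
    · simp only [Matrix.IsHermitian, Matrix.conjTranspose_smul, Matrix.conjTranspose_sub,
        Matrix.conjTranspose_conjTranspose]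
      rw [show star Complex.I = -Complex.I from Complex.conj_I, neg_smul, ← smul_neg, neg_sub]
  have hzero' : ∀ M : Op ι, lindblad w K M = 0 → M.trace = 0 → M = 0 := by
    intro M hM ht
    obtain ⟨a, b, c, d⟩ := hpart M hM
    have ht' : Mᴴ.trace = 0 := by rw [Matrix.trace_conjTranspose, ht, star_zero]
    have e1 := hzero _ c a (by rw [Matrix.trace_add, ht, ht', add_zero])
    have e2 := hzero _ d b (by rw [Matrix.trace_smul, Matrix.trace_sub, ht, ht', sub_zero,
      smul_zero])
    have e3 : M - Mᴴ = 0 := by simpa using e2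
    have e4 : (2 : ℂ) • M = 0 := by
      rw [two_smul]
      calc M + M = (M + Mᴴ) + (M - Mᴴ) := by abel
        _ = 0 := by rw [e1, e3, add_zero]
    simpa using e4
  obtain ⟨M, hM, hne⟩ := hker
  have htr : M.trace ≠ 0 := fun h => hne (hzero' M hM h)
  set σ := M.trace⁻¹ • M with hσ
  have hσ0 : lindblad w K σ = 0 := by rw [hσ, map_smul, hM, smul_zero]
  have hσt : σ.trace = 1 := by rw [hσ, Matrix.trace_smul, smul_eq_mul, inv_mul_cancel₀ htr]
  have hσH : σ.IsHermitian := by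
    have := hzero' (σᴴ - σ) (by
      rw [map_sub, lindblad_conjTranspose, hσ0, Matrix.conjTranspose_zero, sub_zero]) (by
      rw [Matrix.trace_sub, Matrix.trace_conjTranspose, hσt, star_one, sub_self])
    exact sub_eq_zero.1 this
  refine ⟨σ, ?_, hσt, hσ0, fun A hA => ?_⟩
  · have hne' : σ ≠ 0 := by
      intro h
      rw [h, Matrix.trace_zero] at hσt
      exact zero_ne_one hσt
    rcases posDef_or_neg_posDef_of_lindblad_eq_zero hw hK hσH hσ0 hne' with h | h
    · exact h
    · have := h.trace_pos
      rw [Matrix.trace_neg, hσt] at this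
      have := (Complex.lt_def.1 this).1
      norm_num at this
  · refine sub_eq_zero.1 (hzero' _ ?_ ?_)
    · rw [map_sub, map_smul, hA, hσ0, smul_zero, sub_zero]
    · rw [Matrix.trace_sub, Matrix.trace_smul, hσt, smul_eq_mul, mul_one, sub_self]

end Lindblad

/-! ### Relaxation to the stationary state -/

section Lyapunov

variable {V : Type*} [NormedAddCommGroup V] [NormedSpace ℂ V] [FiniteDimensional ℂ V]

theorem hasSum_exp_smul_apply (R : V →ₗ[ℂ] V) (t : ℝ) (v : V) :
    HasSum (fun k : ℕ => ((t ^ k / (k.factorial : ℝ) : ℝ) : ℂ) • (R ^ k) v)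
      (NormedSpace.exp (t • LinearMap.toContinuousLinearMap R) v) := by
  have : CompleteSpace V := FiniteDimensional.complete ℂ V
  have h := NormedSpace.exp_series_hasSum_exp' (𝕂 := ℝ) (t • LinearMap.toContinuousLinearMap R)
  have h2 := h.mapL ((ContinuousLinearMap.apply ℂ V v).restrictScalars ℝ)
  have hpow : ∀ k, ((LinearMap.toContinuousLinearMap R) ^ k) v = (R ^ k) v := by
    intro k
    induction k with
    | zero => simp
    | succ k ih =>
      rw [pow_succ', pow_succ', mul_apply_eq_comp, ih]
      rfl
  convert! h2 using 1
  ext1 k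
  have : ((ContinuousLinearMap.apply ℂ V v).restrictScalars ℝ)
      ((k.factorial : ℝ)⁻¹ • (t • LinearMap.toContinuousLinearMap R) ^ k)
      = (k.factorial : ℝ)⁻¹ • t ^ k • (R ^ k) v := by
    rw [smul_pow, map_smul, map_smul, ← hpow]
    rfl
  rw [this, smul_smul, ← Complex.coe_smul]
  congr 2
  ring

theorem hasDerivAt_exp_smul_apply (R : V →ₗ[ℂ] V) (v : V) (t : ℝ) :
    HasDerivAt (fun t : ℝ => NormedSpace.exp (t • LinearMap.toContinuousLinearMap R) v)
      (R (NormedSpace.exp (t • LinearMap.toContinuousLinearMap R) v)) t := by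
  have : CompleteSpace V := FiniteDimensional.complete ℂ V
  have h := hasDerivAt_exp_smul_const' (𝕂 := ℝ) (LinearMap.toContinuousLinearMap R) t
  exact ((ContinuousLinearMap.apply ℂ V v).restrictScalars ℝ).hasFDerivAt.comp_hasDerivAt t h

/-- A continuous, quadratically homogeneous function `q` that is positive on a closed cone bounds,
up to a constant, any other continuous, quadratically homogeneous function there. -/
theorem exists_pos_mul_le_of_homogeneous {V : Type*} [NormedAddCommGroup V] [NormedSpace ℝ V]
    [ProperSpace V] {p q : V → ℝ} (hp : Continuous p) (hq : Continuous q)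
    (hp2 : ∀ (a : ℝ) v, p (a • v) = a ^ 2 * p v) (hq2 : ∀ (a : ℝ) v, q (a • v) = a ^ 2 * q v)
    {S : Set V} (hS : IsClosed S) (hSs : ∀ (a : ℝ), ∀ v ∈ S, a • v ∈ S)
    (hpos : ∀ v ∈ S, v ≠ 0 → 0 < q v) :
    ∃ c : ℝ, 0 < c ∧ ∀ v ∈ S, c * p v ≤ q v := by
  have hcomp : IsCompact (S ∩ Metric.sphere (0 : V) 1) :=
    (isCompact_sphere 0 1).inter_left hS
  obtain ⟨c, hc, hle⟩ : ∃ c : ℝ, 0 < c ∧ ∀ v ∈ S ∩ Metric.sphere (0 : V) 1, c * p v ≤ q v := by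
    rcases (S ∩ Metric.sphere (0 : V) 1).eq_empty_or_nonempty with h | h
    · exact ⟨1, one_pos, by simp [h]⟩
    obtain ⟨x, hx, hxm⟩ := hcomp.exists_isMinOn h hq.continuousOn
    obtain ⟨y, hy, hym⟩ := hcomp.exists_isMaxOn h hp.continuousOn
    have hx0 : x ≠ 0 := by
      rintro rfl
      simpa using hx.2
    have hqx := hpos x hx.1 hx0
    have hP : 0 < |p y| + 1 := by positivity
    refine ⟨q x / (|p y| + 1), div_pos hqx hP, fun v hv => ?_⟩
    have h1 : p v ≤ |p y| + 1 := by
      have : p v ≤ p y := hym hv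
      linarith [le_abs_self (p y)]
    have h2 : q x ≤ q v := hxm hv
    calc q x / (|p y| + 1) * p v ≤ q x / (|p y| + 1) * (|p y| + 1) := by gcongr
      _ = q x := div_mul_cancel₀ _ hP.ne'
      _ ≤ q v := h2
  refine ⟨c, hc, fun v hv => ?_⟩
  rcases eq_or_ne v 0 with rfl | h0
  · have a := hp2 0 0
    have b := hq2 0 0
    simp only [smul_zero] at a b
    rw [a, b]; simp
  have hn : 0 < ‖v‖ := norm_pos_iff.2 h0
  have h1 := hle (‖v‖⁻¹ • v) ⟨hSs _ v hv, by simp [norm_smul, hn.ne']⟩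
  rw [hp2, hq2] at h1
  have h3 : 0 < ‖v‖⁻¹ ^ 2 := by positivity
  refine le_of_mul_le_mul_left ?_ h3
  linarith

/-- Lyapunov's theorem: a positive definite quadratic form that strictly decreases along the flow of
`R` on an invariant subspace forces all orbits there to decay. -/
theorem tendsto_exp_series_of_lyapunov (R : V →ₗ[ℂ] V) (B : V →ₗ[ℝ] V →ₗ[ℝ] ℝ)
    (hB : ∀ v, v ≠ 0 → 0 < B v v) (S : Submodule ℂ V) (hS : ∀ v ∈ S, R v ∈ S)
    (hdiss : ∀ v ∈ S, v ≠ 0 → B (R v) v + B v (R v) < 0) {v : V} (hv : v ∈ S) :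
    Filter.Tendsto (fun t : ℝ => ∑' k : ℕ, ((t ^ k / (k.factorial : ℝ) : ℝ) : ℂ) • (R ^ k) v)
      Filter.atTop (nhds 0) := by
  have : FiniteDimensional ℝ V := FiniteDimensional.complexToReal V
  have : ProperSpace V := FiniteDimensional.proper ℝ V
  simp only [fun t => (hasSum_exp_smul_apply R t v).tsum_eq]
  set Y : ℝ → V := fun t => NormedSpace.exp (t • LinearMap.toContinuousLinearMap R) v with hY
  have hSc : IsClosed (S : Set V) := S.closed_of_finiteDimensional
  have hYS : ∀ t, Y t ∈ S := by
    intro t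
    refine hSc.mem_of_tendsto (hasSum_exp_smul_apply R t v)
      (Filter.Eventually.of_forall fun s => Submodule.sum_mem _ fun k _ => S.smul_mem _ ?_)
    clear * - hv hS
    induction k with
    | zero => simpa using hv
    | succ k ih =>
      rw [pow_succ', Module.End.mul_apply]
      exact hS _ ih
  set Bc : V →L[ℝ] V →L[ℝ] ℝ := LinearMap.toContinuousLinearMap
    ((LinearMap.toContinuousLinearMap : (V →ₗ[ℝ] ℝ) ≃ₗ[ℝ] (V →L[ℝ] ℝ)).toLinearMap ∘ₗ B) with hBc
  have hBB : ∀ x y, Bc x y = B x y := fun x y => rfl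
  have hR : Continuous R := R.continuous_of_finiteDimensional
  have hBcont : ∀ {f g : V → V}, Continuous f → Continuous g →
      Continuous fun x => B (f x) (g x) := by
    intro f g hf hg
    simp only [← hBB]
    exact (Bc.continuous.comp hf).clm_apply hg
  have hsm : ∀ (a : ℝ) x, R (a • x) = a • R x := fun a x => by
    rw [← Complex.coe_smul, map_smul, Complex.coe_smul]
  obtain ⟨c, hc, hcD⟩ := exists_pos_mul_le_of_homogeneous (p := fun x => B x x)
    (q := fun x => -(B (R x) x + B x (R x)))
    (hBcont continuous_id continuous_id)
    ((hBcont hR continuous_id).add (hBcont continuous_id hR)).neg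
    (fun a x => by simp only [map_smul, LinearMap.smul_apply, smul_eq_mul]; ring)
    (fun a x => by simp only [hsm, map_smul, LinearMap.smul_apply, smul_eq_mul]; ring)
    hSc (fun a x hx => by rw [← Complex.coe_smul]; exact S.smul_mem _ hx)
    (fun x hx h0 => by have := hdiss x hx h0; linarith)
  obtain ⟨b, hb, hbn⟩ := exists_pos_mul_le_of_homogeneous (S := Set.univ)
    (p := fun x : V => ‖x‖ ^ 2) (q := fun x => B x x) (by fun_prop)
    (hBcont continuous_id continuous_id)
    (fun a x => by rw [norm_smul, mul_pow, Real.norm_eq_abs, sq_abs])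
    (fun a x => by simp only [map_smul, LinearMap.smul_apply, smul_eq_mul]; ring)
    isClosed_univ (fun _ _ _ => Set.mem_univ _) (fun x _ h0 => hB x h0)
  have hder : ∀ t,
      HasDerivAt (fun t => B (Y t) (Y t)) (B (R (Y t)) (Y t) + B (Y t) (R (Y t))) t := by
    intro t
    have h1 := hasDerivAt_exp_smul_apply R v t
    exact (Bc.hasFDerivAt.comp_hasDerivAt t h1).clm_apply h1
  have hanti : Antitone fun t => Real.exp (c * t) * B (Y t) (Y t) := by
    refine antitone_of_hasDerivAt_nonpos
      (f' := fun t => Real.exp (c * t) * c * B (Y t) (Y t)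
        + Real.exp (c * t) * (B (R (Y t)) (Y t) + B (Y t) (R (Y t)))) ?_ ?_
    · intro t
      have h1 : HasDerivAt (fun t => Real.exp (c * t)) (Real.exp (c * t) * c) t := by
        simpa using ((hasDerivAt_id t).const_mul c).exp
      exact h1.mul (hder t)
    · intro t
      have := mul_le_mul_of_nonneg_left (hcD _ (hYS t)) (Real.exp_pos (c * t)).le
      simp only [Pi.zero_apply]
      linarith
  have hbound : ∀ t, 0 ≤ t → ‖Y t‖ ^ 2 ≤ b⁻¹ * (B v v * Real.exp (-(c * t))) := by
    intro t ht
    have h1 := hanti ht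
    have h0 : Y 0 = v := by
      simp only [hY, zero_smul, NormedSpace.exp_zero]
      rfl
    simp only [mul_zero, Real.exp_zero, one_mul, h0] at h1
    have h2 := hbn (Y t) (Set.mem_univ _)
    have h3 : B (Y t) (Y t) ≤ B v v * Real.exp (-(c * t)) := by
      rw [Real.exp_neg, ← div_eq_mul_inv, le_div_iff₀ (Real.exp_pos _)]
      linarith
    rw [← div_eq_inv_mul, le_div_iff₀ hb]
    linarith
  have hlim : Filter.Tendsto (fun t : ℝ => b⁻¹ * (B v v * Real.exp (-(c * t))))
      Filter.atTop (nhds 0) := by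
    have h1 : Filter.Tendsto (fun t : ℝ => Real.exp (-(c * t))) Filter.atTop (nhds 0) :=
      Real.tendsto_exp_neg_atTop_nhds_zero.comp (Filter.tendsto_id.const_mul_atTop hc)
    simpa using (h1.const_mul (B v v)).const_mul b⁻¹
  have hsq : Filter.Tendsto (fun t => ‖Y t‖ ^ 2) Filter.atTop (nhds 0) :=
    squeeze_zero' (Filter.Eventually.of_forall fun t => sq_nonneg _)
      ((Filter.eventually_ge_atTop 0).mono hbound) hlim
  rw [tendsto_zero_iff_norm_tendsto_zero]
  have := hsq.sqrt
  simpa [Real.sqrt_sq (norm_nonneg _)] using this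

end Lyapunov

section Relaxation

theorem expSemigroup_of_map_eq_zero {ι : Type} {R : Op ι →ₗ[ℂ] Op ι} {M : Op ι} (h : R M = 0)
    (t : ℝ) : expSemigroup R t M = M := by
  rw [expSemigroup, tsum_eq_single 0]
  · simp
  · intro k hk
    obtain ⟨l, rfl⟩ := Nat.exists_eq_succ_of_ne_zero hk
    rw [pow_succ R, Module.End.mul_apply, h, map_zero, smul_zero]

variable {ι : Type} [Fintype ι] {υ : Type} [Fintype υ]

-- any norm will do: it only serves to sum the exponential series and to compare quadratic forms
attribute [local instance] Matrix.linftyOpNormedAddCommGroup Matrix.linftyOpNormedSpace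

theorem expSemigroup_hasSum (R : Op ι →ₗ[ℂ] Op ι) (t : ℝ) (M : Op ι) :
    HasSum (fun k : ℕ => ((t ^ k / (k.factorial : ℝ) : ℝ) : ℂ) • (R ^ k) M)
      (expSemigroup R t M) := by
  have h : Summable fun k : ℕ => ((t ^ k / (k.factorial : ℝ) : ℝ) : ℂ) • (R ^ k) M :=
    (hasSum_exp_smul_apply R t M).summable
  exact h.hasSum

theorem expSemigroup_add (R : Op ι →ₗ[ℂ] Op ι) (t : ℝ) (M N : Op ι) :
    expSemigroup R t (M + N) = expSemigroup R t M + expSemigroup R t N := by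
  refine (expSemigroup_hasSum R t (M + N)).unique ?_
  simpa only [map_add, smul_add] using
    (expSemigroup_hasSum R t M).add (expSemigroup_hasSum R t N)

theorem trace_mul_expSemigroup {R R' : Op ι →ₗ[ℂ] Op ι}
    (h : ∀ X M, (X * R M).trace = (R' X * M).trace) (t : ℝ) (X M : Op ι) :
    (X * expSemigroup R t M).trace = (expSemigroup R' t X * M).trace := by
  have hpow : ∀ (k : ℕ) (X : Op ι), (X * (R ^ k) M).trace = ((R' ^ k) X * M).trace := by
    intro k
    induction k with
    | zero => intro X; simp
    | succ k ih =>
      intro X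
      rw [pow_succ', Module.End.mul_apply, h, ih, pow_succ, Module.End.mul_apply]
  have h1 := (expSemigroup_hasSum R t M).map
    ((Matrix.traceLinearMap ι ℂ ℂ).comp (LinearMap.mulLeft ℂ X)) (by
      change Continuous fun Y : Op ι => (X * Y).trace
      fun_prop)
  have h2 := (expSemigroup_hasSum R' t X).map
    ((Matrix.traceLinearMap ι ℂ ℂ).comp (LinearMap.mulRight ℂ M)) (by
      change Continuous fun Y : Op ι => (Y * M).trace
      fun_prop)
  refine h1.unique ?_
  convert! h2 using 1
  ext k
  simp [hpow]

/-- The real part `(X, Y) ↦ Re tr (σ X†Y)` of the scalar product of observables in the state `σ`,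
as a real bilinear form. -/
noncomputable def stateForm (σ : Op ι) : Op ι →ₗ[ℝ] Op ι →ₗ[ℝ] ℝ :=
  LinearMap.mk₂ ℝ (fun X Y => (σ * (Xᴴ * Y)).trace.re)
    (fun X X' Y => by
      rw [Matrix.conjTranspose_add, Matrix.add_mul, Matrix.mul_add, Matrix.trace_add,
        Complex.add_re])
    (fun a X Y => by
      rw [Matrix.conjTranspose_smul, Matrix.smul_mul, Matrix.mul_smul, Matrix.trace_smul,
        Complex.smul_re, star_trivial])
    (fun X Y Y' => by rw [Matrix.mul_add, Matrix.mul_add, Matrix.trace_add, Complex.add_re])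
    (fun a X Y => by
      rw [Matrix.mul_smul, Matrix.mul_smul, Matrix.trace_smul, Complex.smul_re])

theorem stateForm_apply (σ X Y : Op ι) : stateForm σ X Y = (σ * (Xᴴ * Y)).trace.re := rfl

theorem stateForm_self_nonneg {σ : Op ι} (hσ : σ.PosSemidef) (X : Op ι) :
    0 ≤ stateForm σ X X := by
  have h : (σ * (Xᴴ * X)).trace = (X * σ * Xᴴ).trace := by
    rw [← Matrix.mul_assoc, Matrix.trace_mul_comm, ← Matrix.mul_assoc]
  rw [stateForm_apply, h]
  exact (Complex.le_def.1 (hσ.mul_mul_conjTranspose_same X).trace_nonneg).1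

theorem stateForm_self_pos {σ : Op ι} (hσ : σ.PosDef) {X : Op ι} (hX : X ≠ 0) :
    0 < stateForm σ X X := by
  have h : (σ * (Xᴴ * X)).trace = (X * σ * Xᴴ).trace := by
    rw [← Matrix.mul_assoc, Matrix.trace_mul_comm, ← Matrix.mul_assoc]
  have hps := hσ.posSemidef.mul_mul_conjTranspose_same X
  refine lt_of_le_of_ne (stateForm_self_nonneg hσ.posSemidef X) fun h0 => hX ?_
  have him := (Complex.le_def.1 hps.trace_nonneg).2
  have ht : (X * σ * Xᴴ).trace = 0 := by
    rw [stateForm_apply, h] at h0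
    exact Complex.ext h0.symm him.symm
  have h0' := (hps.trace_eq_zero_iff).1 ht
  ext i j
  have hrow : (star fun l => X i l) = 0 := by
    by_contra hne
    have hpos := hσ.dotProduct_mulVec_pos hne
    have : (X * σ * Xᴴ) i i = star (star fun l => X i l) ⬝ᵥ σ *ᵥ star (fun l => X i l) := by
      rw [star_star, Matrix.mul_assoc]
      rfl
    rw [← this, h0', Matrix.zero_apply] at hpos
    exact lt_irrefl _ hpos
  simpa using congrFun hrow j

variable [DecidableEq ι]

/-- The dissipation identity `L'(X†X) - L'(X)†X - X†L'(X) = 2 ∑ᵤ wᵤ [X, Kᵤ]†[X, Kᵤ]`, with `L'`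
the generator in the Heisenberg picture. -/
theorem lindbladDual_dissipation (w : υ → ℝ) (K : υ → Op ι) (X : Op ι) :
    (lindbladDual w K X)ᴴ * X + Xᴴ * lindbladDual w K X = lindbladDual w K (Xᴴ * X) -
      ∑ u, ((2 * w u : ℝ) : ℂ) • ((X * K u - K u * X)ᴴ * (X * K u - K u * X)) := by
  simp only [lindbladDual_apply, Matrix.conjTranspose_sum, Matrix.sum_mul, Matrix.mul_sum]
  rw [← Finset.sum_add_distrib, ← Finset.sum_sub_distrib]
  refine Finset.sum_congr rfl fun u _ => ?_
  have hc : star ((w u : ℂ)) = w u := Complex.conj_ofReal _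
  have h2 : star (2 : ℂ) = 2 := Complex.conj_ofNat 2
  simp only [Matrix.conjTranspose_smul, Matrix.conjTranspose_sub, Matrix.conjTranspose_mul,
    Matrix.conjTranspose_conjTranspose, Matrix.smul_mul, Matrix.mul_smul, Matrix.sub_mul,
    Matrix.mul_sub, hc, h2, Matrix.mul_assoc, Complex.ofReal_mul, Complex.ofReal_ofNat]
  module

/-- In the Heisenberg picture, observables with zero expectation in the stationary state `σ` decay:
`tr (σ X†X)` is a strict Lyapunov function, because an observable without dissipation commutes
with all jump operators and so is a multiple of the identity. -/
theorem tendsto_expSemigroup_lindbladDual {w : υ → ℝ} {K : υ → Op ι} (hw : ∀ u, 0 ≤ w u)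
    (hK : Algebra.adjoin ℂ {A | ∃ u, 0 < w u ∧ K u = A} = ⊤) {σ : Op ι} (hσ : σ.PosDef)
    (hσt : σ.trace = 1) (hσ0 : lindblad w K σ = 0) {X : Op ι} (hX : (X * σ).trace = 0) :
    Filter.Tendsto (fun t : ℝ => expSemigroup (lindbladDual w K) t X) Filter.atTop (nhds 0) := by
  have hdual : ∀ Y : Op ι, (lindbladDual w K Y * σ).trace = 0 := fun Y => by
    rw [← trace_mul_lindblad, hσ0, Matrix.mul_zero, Matrix.trace_zero]
  set S : Submodule ℂ (Op ι) :=
    LinearMap.ker ((Matrix.traceLinearMap ι ℂ ℂ).comp (LinearMap.mulRight ℂ σ)) with hS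
  have hmem : ∀ Y : Op ι, Y ∈ S ↔ (Y * σ).trace = 0 := fun Y => Iff.rfl
  refine tendsto_exp_series_of_lyapunov (lindbladDual w K) (stateForm σ)
    (fun Y hY => stateForm_self_pos hσ hY) S (fun Y _ => (hmem _).2 (hdual Y)) ?_ ((hmem X).2 hX)
  intro Y hYS hne
  have hdiss : stateForm σ (lindbladDual w K Y) Y + stateForm σ Y (lindbladDual w K Y)
      = -∑ u, 2 * w u * stateForm σ (Y * K u - K u * Y) (Y * K u - K u * Y) := by
    rw [stateForm_apply, stateForm_apply, ← Complex.add_re, ← Matrix.trace_add, ← Matrix.mul_add,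
      lindbladDual_dissipation, Matrix.mul_sub, Matrix.trace_sub, Matrix.trace_mul_comm σ, hdual,
      zero_sub, Complex.neg_re, Matrix.mul_sum, Matrix.trace_sum, Complex.re_sum]
    congr 1
    refine Finset.sum_congr rfl fun u _ => ?_
    rw [Matrix.mul_smul, Matrix.trace_smul, smul_eq_mul, Complex.re_ofReal_mul, stateForm_apply]
  have hnn : ∀ u, 0 ≤ 2 * w u * stateForm σ (Y * K u - K u * Y) (Y * K u - K u * Y) := fun u =>
    mul_nonneg (mul_nonneg zero_le_two (hw u)) (stateForm_self_nonneg hσ.posSemidef _)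
  rw [hdiss, neg_lt_zero]
  refine lt_of_le_of_ne (Finset.sum_nonneg fun u _ => hnn u) fun h0 => hne ?_
  have hcomm : ∀ u, 0 < w u → Y * K u = K u * Y := by
    intro u hu
    have h1 := (Finset.sum_eq_zero_iff_of_nonneg fun u _ => hnn u).1 h0.symm u (Finset.mem_univ u)
    by_contra hcon
    have h2 := stateForm_self_pos hσ (sub_ne_zero.2 hcon)
    have : 0 < 2 * w u * stateForm σ (Y * K u - K u * Y) (Y * K u - K u * Y) := by positivity
    exact this.ne' h1
  have hall : ∀ A : Op ι, Y * A = A * Y := by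
    intro A
    have hA : A ∈ Algebra.adjoin ℂ {A | ∃ u, 0 < w u ∧ K u = A} := hK ▸ Algebra.mem_top
    induction hA using Algebra.adjoin_induction with
    | mem x hx =>
      obtain ⟨u, hu, rfl⟩ := hx
      exact hcomm u hu
    | algebraMap c => exact (Algebra.commutes c Y).symm
    | add x y _ _ hx hy => rw [Matrix.mul_add, Matrix.add_mul, hx, hy]
    | mul x y _ _ hx hy => rw [← Matrix.mul_assoc, hx, Matrix.mul_assoc, hy, Matrix.mul_assoc]
  obtain ⟨c, rfl⟩ := Matrix.mem_range_scalar_iff_commute_single.2 fun i j _ =>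
    (hall (Matrix.single i j 1)).symm
  have hc : (Matrix.scalar ι c : Op ι) = c • (1 : Op ι) := by
    rw [Matrix.scalar_apply, Matrix.smul_one_eq_diagonal]
  have hY' := (hmem _).1 hYS
  rw [hc, Matrix.smul_mul, Matrix.one_mul, Matrix.trace_smul, hσt, smul_eq_mul, mul_one] at hY'
  rw [hY', map_zero]

/-- Relaxation of states follows from that of observables by testing against matrix units, from
which their stationary expectation is subtracted. -/
theorem tendsto_expSemigroup_lindblad {w : υ → ℝ} {K : υ → Op ι} (hw : ∀ u, 0 ≤ w u)
    (hK : Algebra.adjoin ℂ {A | ∃ u, 0 < w u ∧ K u = A} = ⊤) {σ : Op ι} (hσ : σ.PosDef)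
    (hσt : σ.trace = 1) (hσ0 : lindblad w K σ = 0) {ρ : Op ι} (hρ : ρ.trace = 1) :
    Filter.Tendsto (fun t : ℝ => expSemigroup (lindblad w K) t ρ) Filter.atTop (nhds σ) := by
  refine tendsto_pi_nhds.2 fun i => tendsto_pi_nhds.2 fun j => ?_
  change Filter.Tendsto (fun t : ℝ => expSemigroup (lindblad w K) t ρ i j) _ (nhds (σ i j))
  set X : Op ι := Matrix.single j i 1 with hX
  have hent : ∀ M : Op ι, M i j = (X * M).trace := fun M => by
    rw [hX, Matrix.trace_single_mul, one_smul]
  set X' : Op ι := X - (X * σ).trace • (1 : Op ι) with hX'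
  have h0 : (X' * σ).trace = 0 := by
    rw [hX', Matrix.sub_mul, Matrix.smul_mul, Matrix.one_mul, Matrix.trace_sub, Matrix.trace_smul,
      hσt, smul_eq_mul, mul_one, sub_self]
  have hlim := tendsto_expSemigroup_lindbladDual hw hK hσ hσt hσ0 h0
  have hcont : Continuous fun Z : Op ι => (Z * ρ).trace := by fun_prop
  have h1 := (hcont.tendsto 0).comp hlim
  simp only [Matrix.zero_mul, Matrix.trace_zero] at h1
  have h2 := h1.add_const (X * σ).trace
  rw [zero_add, ← hent σ] at h2
  refine h2.congr fun t => ?_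
  rw [hent (expSemigroup _ t ρ), trace_mul_expSemigroup (trace_mul_lindblad w K),
    Function.comp_apply]
  have h3 : X = X' + (X * σ).trace • (1 : Op ι) := by rw [hX', sub_add_cancel]
  have h4 : lindbladDual w K ((X * σ).trace • (1 : Op ι)) = 0 := by
    rw [map_smul, lindbladDual_one, smul_zero]
  conv_rhs => rw [h3, expSemigroup_add, expSemigroup_of_map_eq_zero h4, Matrix.add_mul,
    Matrix.trace_add, Matrix.smul_mul, Matrix.one_mul, Matrix.trace_smul, hρ]
  rw [hent σ, smul_eq_mul, mul_one]

end Relaxation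

/-! ### Unitarity of the circuits -/

section Bits

variable {r : ℕ}

/-- `finFunctionFinEquiv` puts the least significant digit first, hence the reversal. -/
theorem bitsToNat_eq (b : Bits r) :
    bitsToNat b =
      (finFunctionFinEquiv (Equiv.arrowCongr Fin.revPerm (Equiv.refl (Fin 2)) b) : ℕ) := by
  rw [bitsToNat, finFunctionFinEquiv_apply, ← Equiv.sum_comp Fin.revPerm]
  refine Finset.sum_congr rfl fun j _ => ?_
  have : r - 1 - ((Fin.revPerm j : Fin r) : ℕ) = j := by
    rw [Fin.revPerm_apply, Fin.val_rev]; omega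
  rw [this]
  rfl

theorem bitsToNat_injective : Function.Injective (bitsToNat (r := r)) := by
  intro b b' h
  rw [bitsToNat_eq, bitsToNat_eq] at h
  exact (Equiv.arrowCongr Fin.revPerm (Equiv.refl (Fin 2))).injective
    (finFunctionFinEquiv.injective (Fin.ext h))

theorem bitsToNat_lt (b : Bits r) : bitsToNat b < 2 ^ r := by
  rw [bitsToNat_eq]
  exact Fin.is_lt _

theorem sum_bitsToNat {α : Type*} [AddCommMonoid α] (F : ℕ → α) :
    ∑ b : Bits r, F (bitsToNat b) = ∑ x ∈ Finset.range (2 ^ r), F x := by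
  rw [← Fin.sum_univ_eq_sum_range, ← Equiv.sum_comp ((Equiv.arrowCongr Fin.revPerm
    (Equiv.refl (Fin 2))).trans finFunctionFinEquiv)]
  simp only [bitsToNat_eq]
  rfl

theorem exists_bitsToNat_eq {x : ℕ} (hx : x < 2 ^ r) : ∃ b : Bits r, bitsToNat b = x := by
  refine ⟨(Equiv.arrowCongr Fin.revPerm (Equiv.refl (Fin 2))).symm
    (finFunctionFinEquiv.symm ⟨x, hx⟩), ?_⟩
  rw [bitsToNat_eq, Equiv.apply_symm_apply, Equiv.apply_symm_apply]

theorem energy_eq (κ : ℝ) (b : Bits r) : energy κ b = κ * (bitsToNat b / 2 ^ r) := by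
  rw [energy, bitsToNat]
  congr 1
  push_cast
  rw [Finset.sum_div]
  refine Finset.sum_congr rfl fun j _ => ?_
  have hj : (2 : ℝ) ^ r = 2 ^ (r - 1 - (j : ℕ)) * 2 ^ ((j : ℕ) + 1) := by
    rw [← pow_add]; congr 1; omega
  rw [hj]
  field_simp

end Bits

section Unitarity

variable {ι : Type} [Fintype ι] [DecidableEq ι]

theorem isometry_mul {A B : Op ι} (hA : Aᴴ * A = 1) (hB : Bᴴ * B = 1) :
    (A * B)ᴴ * (A * B) = 1 := by
  rw [Matrix.conjTranspose_mul, Matrix.mul_assoc, ← Matrix.mul_assoc Aᴴ, hA, Matrix.one_mul, hB]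

theorem isometry_conjTranspose {A : Op ι} (hA : Aᴴ * A = 1) : (Aᴴ)ᴴ * Aᴴ = 1 := by
  rw [Matrix.conjTranspose_conjTranspose]
  exact mul_eq_one_comm.1 hA

theorem isometry_kronecker_submatrix {α β : Type} [Fintype α] [DecidableEq α] [Fintype β]
    [DecidableEq β] (e : ι ≃ α × β) {Q : Op α} {R : Op β} (hQ : Qᴴ * Q = 1) (hR : Rᴴ * R = 1) :
    ((Q ⊗ₖ R).submatrix e e)ᴴ * (Q ⊗ₖ R).submatrix e e = 1 := by
  rw [Matrix.conjTranspose_submatrix, Matrix.submatrix_mul_equiv, Matrix.conjTranspose_kronecker,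
    ← Matrix.mul_kronecker_mul, hQ, hR, Matrix.one_kronecker_one, Matrix.submatrix_one_equiv]

theorem isometry_kronecker {β : Type} [Fintype β] [DecidableEq β] {Q : Op ι} {R : Op β}
    (hQ : Qᴴ * Q = 1) (hR : Rᴴ * R = 1) : (Q ⊗ₖ R)ᴴ * (Q ⊗ₖ R) = 1 :=
  isometry_kronecker_submatrix (Equiv.refl _) hQ hR

theorem isometry_one : (1 : Op ι)ᴴ * 1 = 1 := by
  rw [Matrix.conjTranspose_one, Matrix.mul_one]

theorem isometry_hadamardLayer (r : ℕ) : (hadamardLayer r)ᴴ * hadamardLayer r = 1 := by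
  ext x z
  rw [Matrix.mul_apply]
  simp only [Matrix.conjTranspose_apply, hadamardLayer, Matrix.of_apply, star_prod,
    ← Finset.prod_mul_distrib]
  rw [← Fintype.prod_sum (κ := fun _ : Fin r => Fin 2) (fun j b =>
    star (((1 / √2 : ℝ) : ℂ) * (-1) ^ ((b : ℕ) * (x j : ℕ))) *
      (((1 / √2 : ℝ) : ℂ) * (-1) ^ ((b : ℕ) * (z j : ℕ))))]
  have h2 : ((1 / √2 : ℝ) : ℂ) * ((1 / √2 : ℝ) : ℂ) = 1 / 2 := by
    rw [← Complex.ofReal_mul, div_mul_div_comm, Real.mul_self_sqrt zero_le_two]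
    norm_num
  have h3 : star ((1 / √2 : ℝ) : ℂ) = ((1 / √2 : ℝ) : ℂ) := Complex.conj_ofReal _
  have key : ∀ a c : Fin 2, ∑ b : Fin 2, star (((1 / √2 : ℝ) : ℂ) * (-1) ^ ((b : ℕ) * (a : ℕ))) *
      (((1 / √2 : ℝ) : ℂ) * (-1) ^ ((b : ℕ) * (c : ℕ))) = if a = c then 1 else 0 := by
    intro a c
    have hs : star (-1 : ℂ) = -1 := by simp
    have : ∀ b : Fin 2, star (((1 / √2 : ℝ) : ℂ) * (-1) ^ ((b : ℕ) * (a : ℕ))) *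
      (((1 / √2 : ℝ) : ℂ) * (-1) ^ ((b : ℕ) * (c : ℕ)))
      = 1 / 2 * ((-1) ^ ((b : ℕ) * (a : ℕ)) * (-1) ^ ((b : ℕ) * (c : ℕ))) := by
      intro b
      rw [star_mul', h3, star_pow, hs, ← h2]
      ring
    simp only [this, Fin.sum_univ_two]
    fin_cases a <;> fin_cases c <;> norm_num
  simp only [key, Matrix.one_apply]
  by_cases h : x = z
  · simp [h]
  · obtain ⟨j, hj⟩ := Function.ne_iff.1 h
    rw [if_neg h]
    exact Finset.prod_eq_zero (Finset.mem_univ j) (if_neg hj)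

theorem geom_sum_exp_eq_zero {M : ℕ} {d : ℤ} (hd : ¬ (M : ℤ) ∣ d) :
    ∑ y ∈ Finset.range M, Complex.exp (2 * Real.pi * Complex.I * d / M) ^ y = 0 := by
  rcases eq_or_ne M 0 with rfl | hM
  · simp
  have hMC : (M : ℂ) ≠ 0 := by exact_mod_cast hM
  have hne : Complex.exp (2 * Real.pi * Complex.I * d / M) ≠ 1 := by
    rw [Ne, Complex.exp_eq_one_iff]
    rintro ⟨k, hk⟩
    apply hd
    refine ⟨k, ?_⟩
    have h0 : (2 * Real.pi * Complex.I : ℂ) ≠ 0 := Complex.two_pi_I_ne_zero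
    rw [div_eq_iff hMC] at hk
    have : (2 * Real.pi * Complex.I : ℂ) * d = (2 * Real.pi * Complex.I) * (M * k) := by
      rw [hk]; ring
    exact_mod_cast mul_left_cancel₀ h0 this
  have h1 : Complex.exp (2 * Real.pi * Complex.I * d / M) ^ M = 1 := by
    rw [← Complex.exp_nat_mul, Complex.exp_eq_one_iff]
    exact ⟨d, by field_simp⟩
  have := geom_sum_mul (Complex.exp (2 * Real.pi * Complex.I * d / M)) M
  rw [h1, sub_self] at this
  exact (mul_eq_zero.1 this).resolve_right (sub_ne_zero.2 hne)

theorem isometry_qft (r : ℕ) : (qft r)ᴴ * qft r = 1 := by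
  ext x z
  rw [Matrix.mul_apply]
  have hterm : ∀ y : Bits r, (qft r)ᴴ x y * qft r y z = 1 / 2 ^ r *
      Complex.exp (2 * Real.pi * Complex.I * (((bitsToNat z : ℤ) - bitsToNat x : ℤ) : ℂ)
        / ((2 ^ r : ℕ) : ℂ)) ^ bitsToNat y := by
    intro y
    simp only [Matrix.conjTranspose_apply, qft, Matrix.of_apply]
    have h2 : ((1 / √(2 ^ r) : ℝ) : ℂ) * ((1 / √(2 ^ r) : ℝ) : ℂ) = 1 / 2 ^ r := by
      rw [← Complex.ofReal_mul, div_mul_div_comm, Real.mul_self_sqrt (by positivity)]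
      push_cast
      norm_num
    rw [star_mul', show star ((1 / √(2 ^ r) : ℝ) : ℂ) = ((1 / √(2 ^ r) : ℝ) : ℂ) from
      Complex.conj_ofReal _, mul_mul_mul_comm, h2, show star (Complex.exp _) = _ from
      (Complex.exp_conj _).symm, ← Complex.exp_add, ← Complex.exp_nat_mul]
    congr 2
    simp only [map_div₀, map_mul, Complex.conj_I, Complex.conj_ofReal, map_natCast, map_pow,
      Complex.conj_ofNat]
    push_cast
    ring
  simp only [hterm, ← Finset.mul_sum]
  rw [sum_bitsToNat (fun y => Complex.exp (2 * Real.pi * Complex.I *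
    (((bitsToNat z : ℤ) - bitsToNat x : ℤ) : ℂ) / ((2 ^ r : ℕ) : ℂ)) ^ y)]
  by_cases h : x = z
  · subst h
    simp
  · rw [geom_sum_exp_eq_zero, mul_zero, Matrix.one_apply_ne h]
    intro hdvd
    have h1 := bitsToNat_lt x
    have h2 := bitsToNat_lt z
    have h3 := Int.eq_zero_of_abs_lt_dvd hdvd (by rw [abs_lt]; constructor <;> omega)
    exact h (bitsToNat_injective (by omega))

theorem isometry_evolution {H : Op ι} (hH : H.IsHermitian) (κ : ℝ) :
    (evolution H κ)ᴴ * evolution H κ = 1 := by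
  have h1 : (((2 * Real.pi / κ : ℝ) : ℂ) • Complex.I • H)ᴴ
      = -(((2 * Real.pi / κ : ℝ) : ℂ) • Complex.I • H) := by
    rw [Matrix.conjTranspose_smul, Matrix.conjTranspose_smul, hH,
      show star Complex.I = -Complex.I from Complex.conj_I,
      show star (((2 * Real.pi / κ : ℝ) : ℂ)) = _ from Complex.conj_ofReal _, neg_smul, smul_neg]
  rw [evolution, ← Matrix.exp_conjTranspose, h1, ← Matrix.exp_add_of_commute]
  · rw [neg_add_cancel, NormedSpace.exp_zero]
  · exact (Commute.refl _).neg_left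

theorem isometry_pow {V : Op ι} (hV : Vᴴ * V = 1) (k : ℕ) : (V ^ k)ᴴ * V ^ k = 1 := by
  induction k with
  | zero => simp
  | succ k ih => rw [pow_succ]; exact isometry_mul ih hV

theorem isometry_controlledPower (r : ℕ) {V : Op ι} (hV : Vᴴ * V = 1) :
    (controlledPower r V)ᴴ * controlledPower r V = 1 := by
  ext ⟨s, b⟩ ⟨s', b'⟩
  rw [Matrix.mul_apply, Fintype.sum_prod_type]
  simp only [Matrix.conjTranspose_apply, controlledPower, Matrix.of_apply, apply_ite star,
    star_zero, ite_mul, zero_mul, mul_ite, mul_zero]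
  by_cases h : b = b'
  · subst h
    have := congrFun (congrFun (isometry_pow hV (bitsToNat b)) s) s'
    rw [Matrix.mul_apply] at this
    simpa [Matrix.one_apply, Matrix.conjTranspose_apply] using this
  · have h' : ¬b' = b := fun e => h e.symm
    rw [Matrix.one_apply_ne (by simp [h])]
    simp [h']

theorem isometry_qpe {H : Op ι} (hH : H.IsHermitian) (κ : ℝ) (r : ℕ) :
    (qpe H κ r)ᴴ * qpe H κ r = 1 :=
  isometry_mul (isometry_mul
    (isometry_kronecker isometry_one (isometry_conjTranspose (isometry_qft r)))
    (isometry_controlledPower r (isometry_evolution hH κ)))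
    (isometry_kronecker isometry_one (isometry_hadamardLayer r))

theorem isometry_flippedQpe {H : Op ι} (hH : H.IsHermitian) (κ : ℝ) (r : ℕ) :
    (flippedQpe H κ r)ᴴ * flippedQpe H κ r = 1 :=
  isometry_mul (isometry_mul (isometry_kronecker isometry_one (isometry_qft r))
    (isometry_conjTranspose (isometry_controlledPower r (isometry_evolution hH κ))))
    (isometry_kronecker isometry_one (isometry_hadamardLayer r))

theorem isometry_onBlock {g r : ℕ} (i : Fin g) {Q : Op (ι × Bits r)} (hQ : Qᴴ * Q = 1) :
    (onBlock i Q)ᴴ * onBlock i Q = 1 := by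
  have h : onBlock i Q = (Q ⊗ₖ (1 : Op ({k : Fin g // k ≠ i} → Bits r))).submatrix
      (((Equiv.refl ι).prodCongr (Equiv.funSplitAt i (Bits r))).trans (Equiv.prodAssoc _ _ _).symm)
      (((Equiv.refl ι).prodCongr (Equiv.funSplitAt i (Bits r))).trans
        (Equiv.prodAssoc _ _ _).symm) := by
    ext ⟨s, E⟩ ⟨s', E'⟩
    simp [onBlock, Matrix.one_apply, funext_iff, Equiv.funSplitAt]
  rw [h]
  exact isometry_kronecker_submatrix _ hQ isometry_one

theorem isometry_list_prod {l : List (Op ι)} (hl : ∀ A ∈ l, Aᴴ * A = 1) :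
    (l.prod)ᴴ * l.prod = 1 := by
  induction l with
  | nil => simp
  | cons A l ih =>
    rw [List.prod_cons]
    exact isometry_mul (hl A (by simp)) (ih fun B hB => hl B (by simp [hB]))

theorem isometry_boostedQPE {H : Op ι} (hH : H.IsHermitian) (κ : ℝ) (g r : ℕ) (flip : Bool) :
    (boostedQPE H κ g r flip)ᴴ * boostedQPE H κ g r flip = 1 := by
  refine isometry_list_prod fun A hA => ?_
  obtain ⟨i, rfl⟩ := (List.mem_ofFn' _ _).1 hA
  refine isometry_onBlock i ?_
  cases flip
  · exact isometry_qpe hH κ r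
  · exact isometry_flippedQpe hH κ r

theorem isometry_opU {n : ℕ} {H : Op (Bits n)} (hH : H.IsHermitian) (κ : ℝ) (g r : ℕ)
    (flip : Bool) {C : Op (Bits n)} (hC : Cᴴ * C = 1) :
    (opU H κ g r flip C)ᴴ * opU H κ g r flip C = 1 := by
  have hQ := isometry_boostedQPE hH κ g r flip
  set Q := boostedQPE H κ g r flip
  have h12 : (onRegs12 Q : Op (Total n g r)) = (Q ⊗ₖ (1 : Op (Reg g r × Fin 2))).submatrix
      (Equiv.prodAssoc _ _ _).symm (Equiv.prodAssoc _ _ _).symm := by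
    ext ⟨s, E, E', z⟩ ⟨s', F, F', z'⟩
    simp [onRegs12, Matrix.one_apply]
  let e : Total n g r ≃ (Bits n × Reg g r) × (Reg g r × Fin 2) :=
    ⟨fun x => ((x.1, x.2.2.1), (x.2.1, x.2.2.2)), fun x => (x.1.1, (x.2.1, x.1.2, x.2.2)),
      fun _ => rfl, fun _ => rfl⟩
  have h13 : (onRegs13 Q : Op (Total n g r)) = (Q ⊗ₖ (1 : Op (Reg g r × Fin 2))).submatrix e e := by
    ext ⟨s, E, E', z⟩ ⟨s', F, F', z'⟩
    simp [onRegs13, Matrix.one_apply, e]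
  refine isometry_mul (isometry_mul ?_ (isometry_kronecker hC isometry_one)) ?_
  · rw [h13]; exact isometry_kronecker_submatrix _ hQ isometry_one
  · rw [h12]; exact isometry_kronecker_submatrix _ hQ isometry_one

end Unitarity

/-! ### The Kraus blocks of one iteration, and the Lindblad form of the generator -/

section Blocks

/-- The block `⟨a|O|0⟩` of an operator on `ι` and a register with basis labels `α`: an operator on
`ι`. -/
def colBlock {ι α : Type} [Zero α] (O : Op (ι × α)) (a : α) : Op ι :=
  Matrix.of fun s s' => O (s, a) (s', 0)

theorem colBlock_apply {ι α : Type} [Zero α] (O : Op (ι × α)) (a : α) (s s' : ι) :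
    colBlock O a s s' = O (s, a) (s', 0) := rfl

theorem colBlock_one {ι α : Type} [Zero α] [DecidableEq ι] [DecidableEq α] (a : α) :
    colBlock (1 : Op (ι × α)) a = if a = 0 then 1 else 0 := by
  ext s s'
  rw [colBlock_apply]
  by_cases h : a = 0
  · simp [h, Matrix.one_apply]
  · simp [h]

variable {ι α : Type} [Fintype ι] [Fintype α] [Zero α]

theorem sum_colBlock_conjTranspose_mul (O P : Op (ι × α)) :
    ∑ a, (colBlock O a)ᴴ * colBlock P a = colBlock (Oᴴ * P) 0 := by
  ext s s'
  rw [Matrix.sum_apply, colBlock_apply, Matrix.mul_apply, Fintype.sum_prod_type_right]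
  exact Finset.sum_congr rfl fun a _ => Matrix.mul_apply

variable {n g r : ℕ}

theorem ancMap_apply (O : Op (Total n g r)) (ρ : Op (Bits n)) :
    ancMap O ρ = ∑ a, colBlock O a * ρ * (colBlock O a)ᴴ := by
  ext s s'
  change ∑ a : Anc g r, (O * (ρ ⊗ₖ (Matrix.single 0 0 1 : Op (Anc g r))) * Oᴴ) (s, a) (s', a) = _
  rw [Matrix.sum_apply]
  refine Finset.sum_congr rfl fun a _ => ?_
  have h1 : ∀ (x : Bits n) (b : Anc g r), (O * (ρ ⊗ₖ (Matrix.single 0 0 1 : Op (Anc g r))))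
      (s, a) (x, b) = if b = 0 then (colBlock O a * ρ) s x else 0 := by
    intro x b
    rw [Matrix.mul_apply, Fintype.sum_prod_type]
    simp only [Matrix.kroneckerMap_apply, Matrix.single_apply, ite_and, mul_ite, mul_one, mul_zero,
      Finset.sum_ite_eq, Finset.mem_univ, if_true]
    by_cases hb : b = 0
    · simp only [hb, if_true]
      rfl
    · have hb' : ¬0 = b := fun h => hb h.symm
      simp [hb, hb']
  rw [Matrix.mul_apply, Fintype.sum_prod_type, Matrix.mul_apply]
  refine Finset.sum_congr rfl fun x _ => ?_
  simp only [h1, ite_mul, zero_mul, Finset.sum_ite_eq', Finset.mem_univ, if_true]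
  rfl

theorem controlledQubit_mul (B B' : Reg g r → Reg g r → Op (Fin 2)) :
    controlledQubit n B * controlledQubit n B' =
      controlledQubit n fun E E' => B E E' * B' E E' := by
  rw [controlledQubit, controlledQubit, controlledQubit, ← Matrix.mul_kronecker_mul, Matrix.one_mul]
  congr 1
  ext ⟨E, E', z⟩ ⟨F, F', z'⟩
  rw [Matrix.mul_apply, Fintype.sum_prod_type]
  simp only [Fintype.sum_prod_type, Matrix.of_apply, ite_and, ite_mul, zero_mul, mul_ite, mul_zero]
  by_cases h : E = F
  · by_cases h' : E' = F'
    · subst h h'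
      simp [Matrix.mul_apply]
    · simp [h, h']
  · simp [h]

theorem controlledQubit_conjTranspose (B : Reg g r → Reg g r → Op (Fin 2)) :
    (controlledQubit n B)ᴴ = controlledQubit n fun E E' => (B E E')ᴴ := by
  rw [controlledQubit, controlledQubit, Matrix.conjTranspose_kronecker, Matrix.conjTranspose_one]
  congr 1
  ext ⟨E, E', z⟩ ⟨F, F', z'⟩
  rw [Matrix.conjTranspose_apply, Matrix.of_apply, Matrix.of_apply]
  by_cases h : E = F
  · by_cases h' : E' = F'
    · subst h h'
      simp
    · have : ¬F' = E' := fun e => h' e.symm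
      simp [h', this]
  · have : ¬F = E := fun e => h e.symm
    simp [h, this]

theorem colBlock_controlledQubit_mul (B : Reg g r → Reg g r → Op (Fin 2)) (O : Op (Total n g r))
    (E E' : Reg g r) (z : Fin 2) :
    colBlock (controlledQubit n B * O) (E, E', z)
      = ∑ z', B E E' z z' • colBlock O (E, E', z') := by
  ext s s'
  rw [colBlock_apply, Matrix.mul_apply, Fintype.sum_prod_type, Matrix.sum_apply]
  simp only [Fintype.sum_prod_type, controlledQubit, Matrix.kroneckerMap_apply, Matrix.of_apply,
    Matrix.one_apply, ite_and, ite_mul, zero_mul, mul_ite, mul_zero, one_mul]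
  simp [Finset.sum_ite_eq, colBlock_apply]

theorem colBlock_onSystem_mul (C : Op (Bits n)) (O : Op (Total n g r)) (a : Anc g r) :
    colBlock (onSystem g r C * O) a = C * colBlock O a := by
  ext s s'
  rw [colBlock_apply, Matrix.mul_apply, Fintype.sum_prod_type, Matrix.mul_apply]
  refine Finset.sum_congr rfl fun x _ => ?_
  simp [onSystem, Matrix.one_apply, colBlock_apply]

theorem colBlock_onRegs12 (Q : Op (Bits n × Reg g r)) (E E' : Reg g r) (z : Fin 2) :
    colBlock (onRegs12 Q : Op (Total n g r)) (E, E', z)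
      = if E' = 0 ∧ z = 0 then colBlock Q E else 0 := by
  ext s s'
  by_cases h : E' = 0 ∧ z = 0
  · obtain ⟨rfl, rfl⟩ := h
    simp [colBlock_apply, onRegs12]
  · rw [if_neg h, colBlock_apply]
    simp only [onRegs12, Matrix.of_apply, Matrix.zero_apply]
    exact if_neg fun h' => h ⟨congrArg Prod.fst h', congrArg Prod.snd h'⟩

theorem colBlock_onRegs13_mul (Q : Op (Bits n × Reg g r)) {O : Op (Total n g r)}
    (hO : ∀ E E' z, E' ≠ 0 → colBlock O (E, E', z) = 0) (E E' : Reg g r) (z : Fin 2) :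
    colBlock (onRegs13 Q * O) (E, E', z) = colBlock Q E' * colBlock O (E, 0, z) := by
  ext s s'
  rw [colBlock_apply, Matrix.mul_apply, Fintype.sum_prod_type, Matrix.mul_apply]
  refine Finset.sum_congr rfl fun x _ => ?_
  have h0 : ∀ F F' w, F' ≠ 0 → O (x, F, F', w) (s', 0) = 0 := fun F F' w h =>
    congrFun (congrFun (hO F F' w h) x) s'
  rw [Finset.sum_eq_single (E, 0, z)]
  · simp [onRegs13, colBlock_apply]
  · rintro ⟨F, F', w⟩ - hne
    by_cases hF' : F' = 0
    · have : ¬(E = F ∧ z = w) := by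
        rintro ⟨rfl, rfl⟩
        exact hne (by rw [hF'])
      simp only [onRegs13, Matrix.of_apply, if_neg this, zero_mul]
    · rw [h0 F F' w hF', mul_zero]
  · intro h
    exact absurd (Finset.mem_univ _) h

theorem colBlock_onBlock_mul {i : Fin g} (Q : Op (ι × Bits r)) {O : Op (ι × Reg g r)}
    (hO : ∀ E, E i ≠ 0 → colBlock O E = 0) (E : Reg g r) :
    colBlock (onBlock i Q * O) E = colBlock Q (E i) * colBlock O (Function.update E i 0) := by
  ext s s'
  rw [colBlock_apply, Matrix.mul_apply, Fintype.sum_prod_type, Matrix.mul_apply]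
  refine Finset.sum_congr rfl fun x _ => ?_
  rw [Finset.sum_eq_single (Function.update E i 0)]
  · have : ∀ k, k ≠ i → E k = Function.update E i 0 k := fun k hk => by
      rw [Function.update_of_ne hk]
    simp only [onBlock, Matrix.of_apply, if_pos this, Function.update_self]
    rfl
  · intro F _ hne
    by_cases hF : F i = 0
    · have : ¬∀ k, k ≠ i → E k = F k := by
        intro h
        apply hne
        ext1 k
        by_cases hk : k = i
        · rw [hk, Function.update_self, hF]
        · rw [Function.update_of_ne hk, h k hk]
      simp only [onBlock, Matrix.of_apply, if_neg this, zero_mul]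
    · have : O (x, F) (s', 0) = 0 := congrFun (congrFun (hO F hF) x) s'
      rw [this, mul_zero]
  · intro h
    exact absurd (Finset.mem_univ _) h

variable [DecidableEq ι]

theorem colBlock_onBlock_list_prod (Q : Op (ι × Bits r)) {l : List (Fin g)} (hl : l.Nodup)
    (E : Reg g r) : colBlock (l.map fun i => onBlock i Q).prod E
      = if ∀ k, k ∉ l → E k = 0 then (l.map fun i => colBlock Q (E i)).prod else 0 := by
  induction l generalizing E with
  | nil =>
    rw [List.map_nil, List.prod_nil, colBlock_one]
    simp [funext_iff]
  | cons i l ih =>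
    obtain ⟨hi, hl⟩ := List.nodup_cons.1 hl
    rw [List.map_cons, List.prod_cons, colBlock_onBlock_mul, ih hl]
    · have hmap : (l.map fun j => colBlock Q (Function.update E i 0 j))
          = l.map fun j => colBlock Q (E j) := by
        refine List.map_congr_left fun j hj => ?_
        rw [Function.update_of_ne]
        rintro rfl
        exact hi hj
      rw [hmap, List.map_cons, List.prod_cons]
      have hiff : (∀ k, k ∉ l → Function.update E i 0 k = 0) ↔ ∀ k, k ∉ i :: l → E k = 0 := by
        constructor
        · intro h k hk
          simp only [List.mem_cons, not_or] at hk
          simpa [Function.update_of_ne hk.1] using h k hk.2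
        · intro h k hk
          by_cases hki : k = i
          · rw [hki, Function.update_self]
          · rw [Function.update_of_ne hki]
            exact h k (by simp [hki, hk])
      simp only [hiff, mul_ite, mul_zero]
    · intro F hF
      rw [ih hl, if_neg]
      exact fun h => hF (h i hi)

theorem colBlock_boost (Q : Op (ι × Bits r)) (E : Reg g r) :
    colBlock (boost g Q) E = (List.ofFn fun i => colBlock Q (E i)).prod := by
  rw [boost, List.ofFn_eq_map, colBlock_onBlock_list_prod Q (List.nodup_finRange g), if_pos,
    List.ofFn_eq_map]
  intro k hk
  exact absurd (List.mem_finRange k) hk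

end Blocks

section Expansion

variable {n g r : ℕ}

/-- The operator `⟨EE'|QPE_{1,3} C QPE_{1,2}|00⟩` on the system. -/
noncomputable def jumpOp (H : Op (Bits n)) (κ : ℝ) (g r : ℕ) (flip : Bool) (C : Op (Bits n))
    (E E' : Reg g r) : Op (Bits n) :=
  colBlock (boostedQPE H κ g r flip) E' * C * colBlock (boostedQPE H κ g r flip) E

theorem colBlock_opU (H : Op (Bits n)) (κ : ℝ) (flip : Bool) (C : Op (Bits n))
    (E E' : Reg g r) (z : Fin 2) :
    colBlock (opU H κ g r flip C) (E, E', z) = if z = 0 then jumpOp H κ g r flip C E E' else 0 := by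
  rw [opU, Matrix.mul_assoc, colBlock_onRegs13_mul]
  · rw [colBlock_onSystem_mul, colBlock_onRegs12]
    by_cases hz : z = 0
    · simp [hz, jumpOp, Matrix.mul_assoc]
    · simp [hz]
  · intro E E' z hE'
    rw [colBlock_onSystem_mul, colBlock_onRegs12, if_neg fun h => hE' h.1, Matrix.mul_zero]

theorem sum_anc {β : Type*} [AddCommMonoid β] (F : Anc g r → β) :
    ∑ a, F a = ∑ E : Reg g r, ∑ E' : Reg g r, (F (E, E', 0) + F (E, E', 1)) := by
  simp only [Fintype.sum_prod_type, Fin.sum_univ_two]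

variable {H : Op (Bits n)} (κ β : ℝ)

theorem sum_jumpOp_conjTranspose_mul_self (hH : H.IsHermitian) (flip : Bool)
    {C : Op (Bits n)} (hC : Cᴴ * C = 1) :
    ∑ E, ∑ E', (jumpOp H κ g r flip C E E')ᴴ * jumpOp H κ g r flip C E E' = 1 := by
  have h := sum_colBlock_conjTranspose_mul (opU H κ g r flip C) (opU H κ g r flip C)
  rw [isometry_opU hH κ g r flip hC, colBlock_one, if_pos rfl, sum_anc] at h
  simpa [colBlock_opU] using h

theorem acceptRate_pos (E E' : Reg g r) : 0 < acceptRate κ β E E' :=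
  lt_min one_pos (Real.exp_pos _)

theorem acceptRate_le_one (E E' : Reg g r) : acceptRate κ β E E' ≤ 1 := min_le_left _ _

theorem ancMap_controlledQubit_single (flip : Bool) (C : Op (Bits n)) (d : Reg g r → Reg g r → ℝ)
    (ρ : Op (Bits n)) :
    ancMap (controlledQubit n (fun E E' => Matrix.single 1 0 ((d E E' : ℝ) : ℂ))
      * opU H κ g r flip C) ρ = ∑ E, ∑ E', ((d E E' ^ 2 : ℝ) : ℂ) •
        (jumpOp H κ g r flip C E E' * ρ * (jumpOp H κ g r flip C E E')ᴴ) := by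
  rw [ancMap_apply, sum_anc]
  refine Finset.sum_congr rfl fun E _ => Finset.sum_congr rfl fun E' _ => ?_
  simp only [colBlock_controlledQubit_mul, Fin.sum_univ_two, colBlock_opU]
  simp only [Matrix.single_apply, if_true]
  simp only [zero_ne_one, one_ne_zero, and_false, false_and, if_false, zero_smul, smul_zero,
    add_zero, Matrix.zero_mul, zero_add, and_self, if_true]
  rw [Matrix.conjTranspose_smul, Matrix.smul_mul, Matrix.smul_mul, Matrix.mul_smul, smul_smul,
    show star ((d E E' : ℝ) : ℂ) = _ from Complex.conj_ofReal _]
  congr 1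
  push_cast
  ring

theorem rejBlock_eq (flip : Bool) (C : Op (Bits n)) :
    rejBlock H κ β g r flip C = ∑ E, ∑ E', ((acceptRate κ β E E' : ℝ) : ℂ) •
      ((jumpOp H κ g r flip C E E')ᴴ * jumpOp H κ g r flip C E E') := by
  have h : rejBlock H κ β g r flip C = colBlock ((opU H κ g r flip C)ᴴ *
      (opW000 n g r κ β * opU H κ g r flip C)) 0 := by
    rw [← Matrix.mul_assoc]; rfl
  rw [h, ← sum_colBlock_conjTranspose_mul, sum_anc]
  refine Finset.sum_congr rfl fun E _ => Finset.sum_congr rfl fun E' _ => ?_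
  simp [opW000, colBlock_controlledQubit_mul, colBlock_opU, Matrix.single_apply]

/-- The generator is the Lindblad generator with the jump operators `jumpOp`. -/
theorem generator_eq_lindblad (𝒞 : Finset (Op (Bits n))) (μ : Op (Bits n) → ℝ) :
    generator H κ β g r 𝒞 μ = lindblad
      (fun u : 𝒞 × Bool × Reg g r × Reg g r => 1 / 2 * μ u.1 * acceptRate κ β u.2.2.1 u.2.2.2)
      (fun u => jumpOp H κ g r u.2.1 u.1 u.2.2.1 u.2.2.2) := by
  ext1 ρ
  rw [lindblad_apply, Fintype.sum_prod_type, generator, LinearMap.sum_apply,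
    ← Finset.sum_coe_sort 𝒞]
  refine Finset.sum_congr rfl fun C _ => ?_
  rw [Fintype.sum_prod_type, LinearMap.sum_apply]
  refine Finset.sum_congr rfl fun flip _ => ?_
  rw [Fintype.sum_prod_type, LinearMap.smul_apply, LinearMap.sub_apply, LinearMap.smul_apply, mapMa,
    opW10, ancMap_controlledQubit_single, mapMr, LinearMap.add_apply, LinearMap.mulLeft_apply,
    LinearMap.mulRight_apply, rejBlock_eq]
  simp only [Matrix.sum_mul, Matrix.mul_sum, Finset.smul_sum, ← Finset.sum_add_distrib,
    ← Finset.sum_sub_distrib]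
  refine Finset.sum_congr rfl fun E _ => Finset.sum_congr rfl fun E' _ => ?_
  rw [Real.sq_sqrt (acceptRate_pos κ β E E').le, Matrix.smul_mul, Matrix.mul_smul]
  push_cast
  module

end Expansion

/-! ### Expansion of one iteration in powers of `τ` -/

section ErrorTerms

variable {n g r : ℕ}

theorem colBlock_mul_congr {ι α : Type} [Fintype ι] [Fintype α] [Zero α] (A : Op (ι × α))
    {O P : Op (ι × α)} (h : ∀ a, colBlock O a = colBlock P a) (a : α) :
    colBlock (A * O) a = colBlock (A * P) a := by
  ext s s'
  rw [colBlock_apply, colBlock_apply, Matrix.mul_apply, Matrix.mul_apply]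
  refine Finset.sum_congr rfl fun x _ => ?_
  have : O x (s', 0) = P x (s', 0) := congrFun (congrFun (h x.2) x.1) s'
  rw [this]

theorem sum_colBlock_isometry_mul {ι α : Type} [Fintype ι] [DecidableEq ι] [Fintype α]
    [DecidableEq α] [Zero α] {V : Op (ι × α)} (hV : Vᴴ * V = 1) (O : Op (ι × α)) :
    ∑ a, (colBlock (V * O) a)ᴴ * colBlock (V * O) a = ∑ a, (colBlock O a)ᴴ * colBlock O a := by
  rw [sum_colBlock_conjTranspose_mul, sum_colBlock_conjTranspose_mul, Matrix.conjTranspose_mul,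
    Matrix.mul_assoc, ← Matrix.mul_assoc Vᴴ, hV, Matrix.one_mul]

theorem isHermitian_ancMap (O : Op (Total n g r)) {M : Op (Bits n)} (hM : M.IsHermitian) :
    (ancMap O M).IsHermitian := by
  rw [ancMap_apply, Matrix.IsHermitian, Matrix.conjTranspose_sum]
  refine Finset.sum_congr rfl fun a _ => ?_
  rw [Matrix.conjTranspose_mul, Matrix.conjTranspose_mul, Matrix.conjTranspose_conjTranspose, hM,
    Matrix.mul_assoc]

theorem posSemidef_ancMap (O : Op (Total n g r)) {M : Op (Bits n)} (hM : M.PosSemidef) :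
    (ancMap O M).PosSemidef := by
  rw [ancMap_apply]
  exact Matrix.posSemidef_sum _ fun a _ => hM.mul_mul_conjTranspose_same _

theorem trace_ancMap (O : Op (Total n g r)) (M : Op (Bits n)) :
    (ancMap O M).trace = ((∑ a, (colBlock O a)ᴴ * colBlock O a) * M).trace := by
  rw [ancMap_apply, Matrix.trace_sum, Matrix.sum_mul, Matrix.trace_sum]
  refine Finset.sum_congr rfl fun a _ => ?_
  rw [Matrix.trace_mul_comm, Matrix.mul_assoc]

variable {H : Op (Bits n)} (κ β τ : ℝ) (flip : Bool) (C : Op (Bits n))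

theorem sum_colBlock_controlledQubit_single (d : Reg g r → Reg g r → ℝ) (z : Fin 2) :
    ∑ a, (colBlock (controlledQubit n (fun E E' => Matrix.single z 0 ((d E E' : ℝ) : ℂ))
        * opU H κ g r flip C) a)ᴴ * colBlock (controlledQubit n
          (fun E E' => Matrix.single z 0 ((d E E' : ℝ) : ℂ)) * opU H κ g r flip C) a
      = ∑ E, ∑ E', ((d E E' ^ 2 : ℝ) : ℂ) •
        ((jumpOp H κ g r flip C E E')ᴴ * jumpOp H κ g r flip C E E') := by
  rw [sum_anc]
  refine Finset.sum_congr rfl fun E _ => Finset.sum_congr rfl fun E' _ => ?_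
  have hd : star ((d E E' : ℝ) : ℂ) = (d E E' : ℝ) := Complex.conj_ofReal _
  simp only [colBlock_controlledQubit_mul, Fin.sum_univ_two, colBlock_opU]
  fin_cases z <;> simp [smul_smul, pow_two, -Complex.coe_smul]

theorem opAcc_eq : opAcc H κ β g r τ flip C = controlledQubit n (fun E E' =>
    Matrix.single 1 0 (((τ * √(acceptRate κ β E E') : ℝ)) : ℂ)) * opU H κ g r flip C := by
  rw [opAcc, measProj, measProj, opW, controlledQubit_mul, controlledQubit_mul]
  congr 2
  ext E E' z z'
  fin_cases z <;> fin_cases z' <;> simp [Matrix.mul_apply, Matrix.single_apply]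

theorem opAlt_eq : opAlt H κ β g r τ flip C = controlledQubit n (fun E E' =>
    Matrix.single 1 0 (((τ * √(acceptRate κ β E E') * √(1 - τ ^ 2 * acceptRate κ β E E') : ℝ)) : ℂ))
      * opU H κ g r flip C := by
  rw [opAlt, measProj, measProj, opW, controlledQubit_conjTranspose]
  simp only [controlledQubit_mul]
  congr 2
  ext E E' z z'
  fin_cases z <;> fin_cases z' <;> simp [Matrix.mul_apply, Matrix.single_apply]

variable {τ}

theorem one_sub_sq_mul_acceptRate_nonneg (hτ0 : 0 ≤ τ) (hτ1 : τ ≤ 1) (E E' : Reg g r) :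
    0 ≤ 1 - τ ^ 2 * acceptRate κ β E E' := by
  have h1 := acceptRate_le_one κ β E E'
  have h2 := (acceptRate_pos κ β E E').le
  have h3 : τ ^ 2 ≤ 1 := pow_le_one₀ hτ0 hτ1
  nlinarith

theorem opRej_eq (hτ0 : 0 ≤ τ) (hτ1 : τ ≤ 1) : opRej H κ β g r τ flip C =
    (opU H κ g r flip C)ᴴ * (controlledQubit n (fun E E' =>
      Matrix.single 0 0 (((1 - τ ^ 2 * acceptRate κ β E E' : ℝ)) : ℂ)) * opU H κ g r flip C) := by
  rw [opRej, measProj, opW, controlledQubit_conjTranspose, Matrix.mul_assoc, Matrix.mul_assoc]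
  simp only [controlledQubit_mul, ← Matrix.mul_assoc]
  congr 3
  ext E E' z z'
  have h := Real.mul_self_sqrt (one_sub_sq_mul_acceptRate_nonneg κ β hτ0 hτ1 E E')
  have h' := congrArg (fun x : ℝ => (x : ℂ)) h
  push_cast at h'
  fin_cases z <;> fin_cases z' <;> simp [Matrix.mul_apply, Matrix.single_apply, h']

theorem colBlock_opRej (hH : H.IsHermitian) (hC : Cᴴ * C = 1) (hτ0 : 0 ≤ τ) (hτ1 : τ ≤ 1)
    (a : Anc g r) : colBlock (opRej H κ β g r τ flip C) a = (if a = 0 then 1 else 0) -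
      ((τ ^ 2 : ℝ) : ℂ) • colBlock ((opU H κ g r flip C)ᴴ * opW000 n g r κ β *
        opU H κ g r flip C) a := by
  have h : ∀ b, colBlock (controlledQubit n (fun E E' =>
      Matrix.single 0 0 (((1 - τ ^ 2 * acceptRate κ β E E' : ℝ)) : ℂ)) * opU H κ g r flip C) b
      = colBlock (opU H κ g r flip C - ((τ ^ 2 : ℝ) : ℂ) • (opW000 n g r κ β *
        opU H κ g r flip C)) b := by
    rintro ⟨E, E', z⟩
    have hlin : ∀ (c : ℂ) (O P : Op (Total n g r)) (b : Anc g r),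
        colBlock (O - c • P) b = colBlock O b - c • colBlock P b := fun _ _ _ _ => rfl
    rw [hlin, opW000, colBlock_controlledQubit_mul, colBlock_controlledQubit_mul]
    simp only [Fin.sum_univ_two, colBlock_opU]
    fin_cases z
    · simp [sub_smul, smul_smul, -Complex.coe_smul]
    · simp
  rw [opRej_eq κ β flip C hτ0 hτ1, colBlock_mul_congr _ h, Matrix.mul_sub,
    isometry_opU hH κ g r flip hC, Matrix.mul_smul, ← Matrix.mul_assoc, ← colBlock_one]
  rfl

theorem isHermitian_rejBlock : (rejBlock H κ β g r flip C).IsHermitian := by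
  rw [rejBlock_eq, Matrix.IsHermitian]
  simp only [Matrix.conjTranspose_sum, Matrix.conjTranspose_smul, Matrix.conjTranspose_mul,
    Matrix.conjTranspose_conjTranspose]
  refine Finset.sum_congr rfl fun E _ => Finset.sum_congr rfl fun E' _ => ?_
  rw [show star ((acceptRate κ β E E' : ℝ) : ℂ) = _ from Complex.conj_ofReal _]

theorem ancMap_opRej (hH : H.IsHermitian) (hC : Cᴴ * C = 1) (hτ0 : 0 ≤ τ) (hτ1 : τ ≤ 1) :
    ancMap (opRej H κ β g r τ flip C) = LinearMap.id
      - ((τ ^ 2 : ℝ) : ℂ) • mapMr H κ β g r flip C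
      + ((τ ^ 4 : ℝ) : ℂ) • ancMap ((opU H κ g r flip C)ᴴ * opW000 n g r κ β *
        opU H κ g r flip C) := by
  ext1 ρ
  set Y := (opU H κ g r flip C)ᴴ * opW000 n g r κ β * opU H κ g r flip C with hY
  have hX : colBlock Y 0 = rejBlock H κ β g r flip C := rfl
  have hc : star ((τ ^ 2 : ℝ) : ℂ) = ((τ ^ 2 : ℝ) : ℂ) := Complex.conj_ofReal _
  have hterm : ∀ a : Anc g r, colBlock (opRej H κ β g r τ flip C) a * ρ *
      (colBlock (opRej H κ β g r τ flip C) a)ᴴ = (if a = 0 then ρ - ((τ ^ 2 : ℝ) : ℂ) •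
        (colBlock Y a * ρ + ρ * (colBlock Y a)ᴴ) else 0)
        + ((τ ^ 4 : ℝ) : ℂ) • (colBlock Y a * ρ * (colBlock Y a)ᴴ) := by
    intro a
    have h4 : ((τ ^ 4 : ℝ) : ℂ) = ((τ ^ 2 : ℝ) : ℂ) * ((τ ^ 2 : ℝ) : ℂ) := by
      push_cast; ring
    rw [colBlock_opRej κ β flip C hH hC hτ0 hτ1, h4]
    split_ifs with ha
    · simp only [Matrix.conjTranspose_sub, Matrix.conjTranspose_smul, Matrix.conjTranspose_one, hc,
        Matrix.sub_mul, Matrix.mul_sub, Matrix.smul_mul, Matrix.mul_smul, Matrix.one_mul,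
        Matrix.mul_one, ← hY]
      module
    · simp only [Matrix.conjTranspose_sub, Matrix.conjTranspose_smul, Matrix.conjTranspose_zero, hc,
        Matrix.sub_mul, Matrix.mul_sub, Matrix.smul_mul, Matrix.mul_smul, Matrix.zero_mul,
        Matrix.mul_zero, ← hY]
      module
  rw [ancMap_apply]
  simp only [hterm, Finset.sum_add_distrib, Finset.sum_ite_eq', Finset.mem_univ, if_true,
    ← Finset.smul_sum]
  rw [hX, isHermitian_rejBlock, ← ancMap_apply]
  rfl

theorem ancMap_opAcc : ancMap (opAcc H κ β g r τ flip C) =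
    ((τ ^ 2 : ℝ) : ℂ) • mapMa H κ β g r flip C := by
  ext1 ρ
  rw [opAcc_eq, ancMap_controlledQubit_single, LinearMap.smul_apply, mapMa, opW10,
    ancMap_controlledQubit_single]
  simp only [Finset.smul_sum, smul_smul, mul_pow]
  push_cast
  rfl

theorem ancMap_opAlt (hτ0 : 0 ≤ τ) (hτ1 : τ ≤ 1) : ancMap (opAlt H κ β g r τ flip C) =
    ((τ ^ 2 : ℝ) : ℂ) • mapMa H κ β g r flip C - ((τ ^ 4 : ℝ) : ℂ) • ancMap (controlledQubit n
      (fun E E' => Matrix.single 1 0 ((acceptRate κ β E E' : ℝ) : ℂ)) * opU H κ g r flip C) := by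
  ext1 ρ
  rw [opAlt_eq, ancMap_controlledQubit_single, LinearMap.sub_apply, LinearMap.smul_apply,
    LinearMap.smul_apply, mapMa, opW10, ancMap_controlledQubit_single,
    ancMap_controlledQubit_single]
  simp only [Finset.smul_sum, smul_smul, ← Finset.sum_sub_distrib, ← sub_smul]
  refine Finset.sum_congr rfl fun E _ => Finset.sum_congr rfl fun E' _ => ?_
  rw [mul_pow, mul_pow, Real.sq_sqrt (acceptRate_pos κ β E E').le,
    Real.sq_sqrt (one_sub_sq_mul_acceptRate_nonneg κ β hτ0 hτ1 E E')]
  congr 1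
  push_cast
  ring

/-- The coefficient of `τ⁴` in one iteration, for given random choices: the second order part of the
case Reject, minus the reduction of the case Alternate Accept by the factor `1 - τ² f`. -/
noncomputable def quarticTerm (H : Op (Bits n)) (κ β : ℝ) (g r : ℕ) (flip : Bool)
    (C : Op (Bits n)) : Op (Bits n) →ₗ[ℂ] Op (Bits n) :=
  ancMap ((opU H κ g r flip C)ᴴ * opW000 n g r κ β * opU H κ g r flip C) -
    ancMap (controlledQubit n (fun E E' => Matrix.single 1 0 ((acceptRate κ β E E' : ℝ) : ℂ)) *
      opU H κ g r flip C)

theorem sum_ancMap_op (hH : H.IsHermitian) (hC : Cᴴ * C = 1) (hτ0 : 0 ≤ τ) (hτ1 : τ ≤ 1) :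
    ancMap (opAcc H κ β g r τ flip C) + ancMap (opAlt H κ β g r τ flip C) +
      ancMap (opRej H κ β g r τ flip C) = LinearMap.id + ((τ ^ 2 : ℝ) : ℂ) •
        ((2 : ℂ) • mapMa H κ β g r flip C - mapMr H κ β g r flip C) +
        ((τ ^ 4 : ℝ) : ℂ) • quarticTerm H κ β g r flip C := by
  rw [ancMap_opAcc, ancMap_opAlt κ β flip C hτ0 hτ1, ancMap_opRej κ β flip C hH hC hτ0 hτ1,
    quarticTerm]
  module

theorem sum_colBlock_op (hH : H.IsHermitian) (hC : Cᴴ * C = 1) (hτ0 : 0 ≤ τ) (hτ1 : τ ≤ 1) :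
    (∑ a, (colBlock (opAcc H κ β g r τ flip C) a)ᴴ * colBlock (opAcc H κ β g r τ flip C) a) +
    (∑ a, (colBlock (opAlt H κ β g r τ flip C) a)ᴴ * colBlock (opAlt H κ β g r τ flip C) a) +
    (∑ a, (colBlock (opRej H κ β g r τ flip C) a)ᴴ * colBlock (opRej H κ β g r τ flip C) a)
      = 1 := by
  rw [opRej_eq κ β flip C hτ0 hτ1,
    sum_colBlock_isometry_mul (isometry_conjTranspose (isometry_opU hH κ g r flip hC)),
    opAcc_eq, opAlt_eq, sum_colBlock_controlledQubit_single, sum_colBlock_controlledQubit_single,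
    sum_colBlock_controlledQubit_single, ← sum_jumpOp_conjTranspose_mul_self κ hH flip hC]
  simp only [← Finset.sum_add_distrib, ← add_smul]
  refine Finset.sum_congr rfl fun E _ => Finset.sum_congr rfl fun E' _ => ?_
  rw [mul_pow, mul_pow, mul_pow, Real.sq_sqrt (acceptRate_pos κ β E E').le,
    Real.sq_sqrt (one_sub_sq_mul_acceptRate_nonneg κ β hτ0 hτ1 E E')]
  conv_rhs => rw [← one_smul ℂ (_ * _)]
  congr 1
  push_cast
  ring

/-- As `f ≤ 1`, weighting the outcomes by `f²` does not increase the trace. -/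
theorem re_trace_acceptRate_sq_le (hH : H.IsHermitian) (hC : Cᴴ * C = 1) {P : Op (Bits n)}
    (hP : P.PosSemidef) :
    ((∑ E : Reg g r, ∑ E' : Reg g r, ((acceptRate κ β E E' ^ 2 : ℝ) : ℂ) •
      ((jumpOp H κ g r flip C E E')ᴴ * jumpOp H κ g r flip C E E')) * P).trace.re
      ≤ P.trace.re := by
  have h1 := sum_jumpOp_conjTranspose_mul_self (g := g) (r := r) κ hH flip hC
  conv_rhs => rw [← Matrix.one_mul P, ← h1]
  simp only [Matrix.sum_mul, Matrix.trace_sum, Complex.re_sum, Matrix.smul_mul, Matrix.trace_smul,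
    smul_eq_mul, Complex.re_ofReal_mul]
  refine Finset.sum_le_sum fun E _ => Finset.sum_le_sum fun E' _ => ?_
  have h2 : 0 ≤ ((jumpOp H κ g r flip C E E')ᴴ * jumpOp H κ g r flip C E E' * P).trace.re := by
    rw [Matrix.mul_assoc, Matrix.trace_mul_comm]
    exact (Complex.le_def.1 (hP.mul_mul_conjTranspose_same _).trace_nonneg).1
  have h3 : acceptRate κ β E E' ^ 2 ≤ 1 :=
    pow_le_one₀ (acceptRate_pos κ β E E').le (acceptRate_le_one κ β E E')
  exact mul_le_of_le_one_left h2 h3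

theorem isCPTP_of_kraus {ι υ : Type} [Fintype ι] [DecidableEq ι] [Fintype υ]
    {R : Op ι →ₗ[ℂ] Op ι} (A : υ → Op ι) (h1 : ∀ M, R M = ∑ u, A u * M * (A u)ᴴ)
    (h2 : ∑ u, (A u)ᴴ * A u = 1) : IsCPTP R := by
  refine ⟨Fintype.card υ, fun k => A ((Fintype.equivFin υ).symm k), fun M => ?_, ?_⟩
  · rw [h1, ← Equiv.sum_comp (Fintype.equivFin υ).symm]
  · rw [← h2, ← Equiv.sum_comp (Fintype.equivFin υ).symm (fun u => (A u)ᴴ * A u)]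

variable {𝒞 : Finset (Op (Bits n))} {μ : Op (Bits n) → ℝ}

theorem IsJumpDistribution.isometry (h : IsJumpDistribution 𝒞 μ) {C : Op (Bits n)} (hC : C ∈ 𝒞) :
    Cᴴ * C = 1 :=
  Matrix.mem_unitaryGroup_iff'.1 (h.unitary C hC)

theorem IsJumpDistribution.sum_weights (h : IsJumpDistribution 𝒞 μ) :
    ∑ C ∈ 𝒞, ∑ _flip : Bool, (1 / 2 * μ C) = 1 := by
  refine Eq.trans (Finset.sum_congr rfl fun C _ => ?_) h.sum_eq_one
  rw [Fintype.sum_bool]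
  ring

theorem isCPTP_iteration (hH : H.IsHermitian) (h𝒞 : IsJumpDistribution 𝒞 μ) (hτ0 : 0 ≤ τ)
    (hτ1 : τ ≤ 1) : IsCPTP (iteration H κ β g r 𝒞 μ τ) := by
  set O : Op (Bits n) → Bool → Fin 3 → Op (Total n g r) := fun C flip =>
    ![opAcc H κ β g r τ flip C, opAlt H κ β g r τ flip C, opRej H κ β g r τ flip C]
  have hO0 : ∀ C flip, O C flip 0 = opAcc H κ β g r τ flip C := fun _ _ => rfl
  have hO1 : ∀ C flip, O C flip 1 = opAlt H κ β g r τ flip C := fun _ _ => rfl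
  have hO2 : ∀ C flip, O C flip 2 = opRej H κ β g r τ flip C := fun _ _ => rfl
  clear_value O
  have hsq : ∀ C ∈ 𝒞, (((√(1 / 2 * μ C) : ℝ) : ℂ) * ((√(1 / 2 * μ C) : ℝ) : ℂ))
      = ((1 / 2 * μ C : ℝ) : ℂ) := fun C hC => by
    rw [← Complex.ofReal_mul, Real.mul_self_sqrt (mul_nonneg (by norm_num) (h𝒞.nonneg C hC))]
  have hst : ∀ x : ℝ, star (x : ℂ) = x := fun x => Complex.conj_ofReal x
  refine isCPTP_of_kraus (υ := 𝒞 × Bool × Fin 3 × Anc g r)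
    (fun u => ((√(1 / 2 * μ u.1) : ℝ) : ℂ) • colBlock (O u.1 u.2.1 u.2.2.1) u.2.2.2) ?_ ?_
  · intro M
    rw [Fintype.sum_prod_type, iteration, LinearMap.sum_apply, ← Finset.sum_coe_sort 𝒞]
    refine Finset.sum_congr rfl fun C _ => ?_
    rw [Fintype.sum_prod_type, LinearMap.sum_apply]
    refine Finset.sum_congr rfl fun flip _ => ?_
    simp only [Matrix.conjTranspose_smul, Matrix.smul_mul, Matrix.mul_smul, smul_smul, hst,
      hsq C C.2, ← Finset.smul_sum]
    rw [LinearMap.smul_apply]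
    congr 1
    rw [Fintype.sum_prod_type, Fin.sum_univ_three]
    simp only [LinearMap.add_apply, ancMap_apply, hO0, hO1, hO2]
  · rw [Fintype.sum_prod_type]
    have h1 : ∀ C : 𝒞, ∑ x : Bool × Fin 3 × Anc g r,
        (((√(1 / 2 * μ C) : ℝ) : ℂ) • colBlock (O C x.1 x.2.1) x.2.2)ᴴ *
          (((√(1 / 2 * μ C) : ℝ) : ℂ) • colBlock (O C x.1 x.2.1) x.2.2)
        = ((∑ _flip : Bool, (1 / 2 * μ C) : ℝ) : ℂ) • (1 : Op (Bits n)) := by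
      intro C
      rw [Fintype.sum_prod_type, Complex.ofReal_sum, Finset.sum_smul]
      refine Finset.sum_congr rfl fun flip _ => ?_
      simp only [Matrix.conjTranspose_smul, Matrix.smul_mul, Matrix.mul_smul, smul_smul, hst,
        hsq C C.2, ← Finset.smul_sum]
      congr 1
      rw [Fintype.sum_prod_type, Fin.sum_univ_three]
      simp only [hO0, hO1, hO2]
      have hC : (C : Op (Bits n))ᴴ * (C : Op (Bits n)) = 1 := h𝒞.isometry C.2
      exact sum_colBlock_op κ β flip (C : Op (Bits n)) hH hC hτ0 hτ1
    refine (Finset.sum_congr rfl fun C _ => h1 C).trans ?_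
    have h2 : ∑ C : 𝒞, ∑ _flip : Bool, (1 / 2 * μ C) = 1 :=
      (Finset.sum_coe_sort 𝒞 (fun C => ∑ _flip : Bool, (1 / 2 * μ C))).trans h𝒞.sum_weights
    rw [← Finset.sum_smul, ← Complex.ofReal_sum, h2, Complex.ofReal_one, one_smul]

/-- The coefficient of `τ⁴` in one iteration. It does not depend on `τ`. -/
noncomputable def quarticError (H : Op (Bits n)) (κ β : ℝ) (g r : ℕ) (𝒞 : Finset (Op (Bits n)))
    (μ : Op (Bits n) → ℝ) : Op (Bits n) →ₗ[ℂ] Op (Bits n) :=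
  ∑ C ∈ 𝒞, ∑ flip : Bool, ((1 / 2 * μ C : ℝ) : ℂ) • quarticTerm H κ β g r flip C

theorem iteration_eq (hH : H.IsHermitian) (h𝒞 : IsJumpDistribution 𝒞 μ) (hτ0 : 0 ≤ τ)
    (hτ1 : τ ≤ 1) : iteration H κ β g r 𝒞 μ τ = LinearMap.id +
      ((τ ^ 2 : ℝ) : ℂ) • generator H κ β g r 𝒞 μ +
      ((τ ^ 4 : ℝ) : ℂ) • quarticError H κ β g r 𝒞 μ := by
  have hid : (LinearMap.id : Op (Bits n) →ₗ[ℂ] Op (Bits n))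
      = ∑ C ∈ 𝒞, ∑ _flip : Bool, ((1 / 2 * μ C : ℝ) : ℂ) • LinearMap.id := by
    simp only [← Finset.sum_smul, ← Complex.ofReal_sum]
    rw [h𝒞.sum_weights, Complex.ofReal_one, one_smul]
  rw [iteration, generator, quarticError]
  conv_rhs => rw [hid]
  simp only [Finset.smul_sum, ← Finset.sum_add_distrib]
  refine Finset.sum_congr rfl fun C hC => Finset.sum_congr rfl fun flip _ => ?_
  rw [sum_ancMap_op κ β flip C hH (h𝒞.isometry hC) hτ0 hτ1]
  module

theorem hermitianPreserving_quarticError :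
    HermitianPreserving (quarticError H κ β g r 𝒞 μ) := by
  intro M hM
  simp only [quarticError, LinearMap.sum_apply, Matrix.IsHermitian, Matrix.conjTranspose_sum]
  refine Finset.sum_congr rfl fun C _ => Finset.sum_congr rfl fun flip _ => ?_
  rw [LinearMap.smul_apply, Matrix.conjTranspose_smul,
    show star ((1 / 2 * μ C : ℝ) : ℂ) = _ from Complex.conj_ofReal _, quarticTerm,
    LinearMap.sub_apply, Matrix.conjTranspose_sub, isHermitian_ancMap _ hM, isHermitian_ancMap _ hM]

theorem superNormLE_quarticError (hH : H.IsHermitian) (h𝒞 : IsJumpDistribution 𝒞 μ) :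
    SuperNormLE (quarticError H κ β g r 𝒞 μ) 2 := by
  intro M hM hM1
  obtain ⟨P, N, hP, hN, rfl, htr⟩ := exists_posSemidef_sub hM
  rw [hM1] at htr
  set A : Op (Bits n) → Bool → Op (Bits n) →ₗ[ℂ] Op (Bits n) := fun C flip =>
    ancMap ((opU H κ g r flip C)ᴴ * opW000 n g r κ β * opU H κ g r flip C) with hA
  set B : Op (Bits n) → Bool → Op (Bits n) →ₗ[ℂ] Op (Bits n) := fun C flip =>
    ancMap (controlledQubit n (fun E E' => Matrix.single 1 0 ((acceptRate κ β E E' : ℝ) : ℂ)) *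
      opU H κ g r flip C) with hB
  have hAtr : ∀ C ∈ 𝒞, ∀ flip, ∀ X : Op (Bits n), X.PosSemidef →
      (A C flip X).trace.re ≤ X.trace.re := by
    intro C hC flip X hX
    rw [hA, trace_ancMap]
    simp only [Matrix.mul_assoc]
    rw [sum_colBlock_isometry_mul (isometry_conjTranspose
      (isometry_opU hH κ g r flip (h𝒞.isometry hC))), opW000, sum_colBlock_controlledQubit_single]
    exact re_trace_acceptRate_sq_le κ β flip C hH (h𝒞.isometry hC) hX
  have hBtr : ∀ C ∈ 𝒞, ∀ flip, ∀ X : Op (Bits n), X.PosSemidef →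
      (B C flip X).trace.re ≤ X.trace.re := by
    intro C hC flip X hX
    rw [hB, trace_ancMap, sum_colBlock_controlledQubit_single]
    exact re_trace_acceptRate_sq_le κ β flip C hH (h𝒞.isometry hC) hX
  -- the positive part of the error pairs `A` on one half of the Jordan decomposition with `B` on
  -- the other
  have key : ∀ X Y : Op (Bits n), X.PosSemidef → Y.PosSemidef →
      (∑ C ∈ 𝒞, ∑ flip : Bool, ((1 / 2 * μ C : ℝ) : ℂ) • (A C flip X + B C flip Y)).PosSemidef ∧
      (∑ C ∈ 𝒞, ∑ flip : Bool, ((1 / 2 * μ C : ℝ) : ℂ) • (A C flip X + B C flip Y)).trace.re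
        ≤ X.trace.re + Y.trace.re := by
    intro X Y hX hY
    constructor
    · refine Matrix.posSemidef_sum _ fun C hC => Matrix.posSemidef_sum _ fun flip _ => ?_
      refine ((posSemidef_ancMap _ hX).add (posSemidef_ancMap _ hY)).smul ?_
      have := h𝒞.nonneg C hC
      exact_mod_cast (by positivity : (0 : ℝ) ≤ 1 / 2 * μ C)
    · simp only [Matrix.trace_sum, Complex.re_sum, Matrix.trace_smul, smul_eq_mul,
        Complex.re_ofReal_mul]
      calc _ ≤ ∑ C ∈ 𝒞, ∑ _flip : Bool, 1 / 2 * μ C * (X.trace.re + Y.trace.re) := by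
            refine Finset.sum_le_sum fun C hC => Finset.sum_le_sum fun flip _ => ?_
            rw [Matrix.trace_add, Complex.add_re]
            exact mul_le_mul_of_nonneg_left (add_le_add (hAtr C hC flip X hX) (hBtr C hC flip Y hY))
              (mul_nonneg (by norm_num) (h𝒞.nonneg C hC))
        _ = X.trace.re + Y.trace.re := by
            have hs := congrArg (fun x => x * (X.trace.re + Y.trace.re)) h𝒞.sum_weights
            simpa only [Finset.sum_mul, one_mul] using hs
  have hsplit : quarticError H κ β g r 𝒞 μ (P - N)
      = ∑ C ∈ 𝒞, ∑ flip : Bool, ((1 / 2 * μ C : ℝ) : ℂ) • (A C flip P + B C flip N)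
      - ∑ C ∈ 𝒞, ∑ flip : Bool, ((1 / 2 * μ C : ℝ) : ℂ) • (A C flip N + B C flip P) := by
    simp only [quarticError, quarticTerm, LinearMap.sum_apply, ← Finset.sum_sub_distrib]
    refine Finset.sum_congr rfl fun C _ => Finset.sum_congr rfl fun flip _ => ?_
    rw [LinearMap.smul_apply, LinearMap.sub_apply, map_sub, map_sub]
    simp only [hA, hB]
    module
  rw [hsplit]
  have h1 := key P N hP hN
  have h2 := key N P hN hP
  have h3 := traceNorm_sub_le h1.1 h2.1
  linarith [h1.2, h2.2]

end ErrorTerms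

/-! ### The median of the estimates, and the amplitudes of phase estimation -/

section MedianTail

/-- If the median is off by more than `η`, so are at least half of the entries. -/
theorem le_two_mul_card_of_median {g : ℕ} (x : Fin g → ℝ) {c η : ℝ}
    (h : η < |median x - c|) : g ≤ 2 * (Finset.univ.filter fun i => η < |x i - c|).card := by
  rcases Nat.eq_zero_or_pos g with rfl | hg
  · simp
  set k : Fin g := ⟨(g - 1) / 2, by omega⟩ with hk
  have hmed : median x = x (Tuple.sort x k) := by rw [median, dif_pos hg]
  have hmono := Tuple.monotone_sort x
  rw [hmed] at h
  rcases lt_abs.1 h with h | h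
  · have hsub : (Finset.Ici k).map (Tuple.sort x).toEmbedding ⊆
        Finset.univ.filter fun i => η < |x i - c| := by
      intro i hi
      obtain ⟨j, hj, rfl⟩ := Finset.mem_map.1 hi
      have : x (Tuple.sort x k) ≤ x (Tuple.sort x j) := hmono (Finset.mem_Ici.1 hj)
      refine Finset.mem_filter.2 ⟨Finset.mem_univ _, lt_abs.2 (Or.inl ?_)⟩
      change η < x (Tuple.sort x j) - c
      linarith
    have := Finset.card_le_card hsub
    rw [Finset.card_map, Fin.card_Ici] at this
    simp only [hk] at this
    omega
  · have hsub : (Finset.Iic k).map (Tuple.sort x).toEmbedding ⊆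
        Finset.univ.filter fun i => η < |x i - c| := by
      intro i hi
      obtain ⟨j, hj, rfl⟩ := Finset.mem_map.1 hi
      have : x (Tuple.sort x j) ≤ x (Tuple.sort x k) := hmono (Finset.mem_Iic.1 hj)
      refine Finset.mem_filter.2 ⟨Finset.mem_univ _, lt_abs.2 (Or.inr ?_)⟩
      change η < -(x (Tuple.sort x j) - c)
      linarith
    have := Finset.card_le_card hsub
    rw [Finset.card_map, Fin.card_Iic] at this
    simp only [hk] at this
    omega

/-- A Chernoff bound: if each of `g` independent trials fails with probability at most `0.195`, then
at least half of them fail with probability at most `2^(-g/3)`. -/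
theorem sum_prod_le_of_half_fail {α : Type} [Fintype α] {w : α → ℝ} (hw : ∀ b, 0 ≤ w b)
    (hw1 : ∑ b, w b = 1) {p : α → Prop} [DecidablePred p]
    (hp : ∑ b, (if p b then w b else 0) ≤ 0.195) (g : ℕ) :
    ∑ E : Fin g → α, (if g ≤ 2 * (Finset.univ.filter fun i => p (E i)).card
      then ∏ i, w (E i) else 0) ≤ (2 : ℝ) ^ (-(g : ℝ) / 3) := by
  -- each failure is weighted by `2` and each success by `1 / 2`; these weights multiply to at least
  -- one when at least half of the trials fail
  have hle : ∀ E : Fin g → α, (if g ≤ 2 * (Finset.univ.filter fun i => p (E i)).card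
      then ∏ i, w (E i) else 0) ≤ ∏ i, (w (E i) * (if p (E i) then 2 else 1 / 2)) := by
    intro E
    have hpos : 0 ≤ ∏ i, w (E i) := Finset.prod_nonneg fun i _ => hw _
    have hprod : ∏ i, (if p (E i) then (2 : ℝ) else 1 / 2)
        = 4 ^ (Finset.univ.filter fun i => p (E i)).card / 2 ^ g := by
      have h1 : ∀ i : Fin g, (if p (E i) then (2 : ℝ) else 1 / 2)
          = (if p (E i) then 4 else 1) * (1 / 2) := by
        intro i; split_ifs <;> norm_num
      simp only [h1, Finset.prod_mul_distrib, Finset.prod_ite, Finset.prod_const, one_pow, mul_one,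
        Finset.card_univ, Fintype.card_fin]
      rw [one_div, inv_pow, div_eq_mul_inv]
    rw [Finset.prod_mul_distrib, hprod]
    split_ifs with h
    · refine le_mul_of_one_le_right hpos ?_
      rw [one_le_div (by positivity)]
      calc (2 : ℝ) ^ g ≤ 2 ^ (2 * (Finset.univ.filter fun i => p (E i)).card) :=
            pow_le_pow_right₀ one_le_two h
        _ = _ := by rw [pow_mul]; norm_num
    · exact mul_nonneg hpos (by positivity)
  calc _ ≤ ∑ E : Fin g → α, ∏ i, (w (E i) * (if p (E i) then 2 else 1 / 2)) :=
        Finset.sum_le_sum fun E _ => hle E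
    _ = (∑ b, w b * (if p b then 2 else 1 / 2)) ^ g := by
        rw [← Fintype.prod_sum (fun (_ : Fin g) b => w b * (if p b then 2 else 1 / 2)),
          Finset.prod_const, Finset.card_univ, Fintype.card_fin]
    _ ≤ ((2 : ℝ) ^ (-(1 : ℝ) / 3)) ^ g := by
        have h1 : ∑ b, w b * (if p b then (2 : ℝ) else 1 / 2)
            = 1 / 2 * ∑ b, w b + 3 / 2 * ∑ b, (if p b then w b else 0) := by
          rw [Finset.mul_sum, Finset.mul_sum, ← Finset.sum_add_distrib]
          refine Finset.sum_congr rfl fun b _ => ?_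
          split_ifs <;> ring
        have h2 : ∑ b, w b * (if p b then (2 : ℝ) else 1 / 2) ≤ 0.7925 := by
          rw [h1, hw1]; linarith
        have h3 : (0.7925 : ℝ) ≤ 2 ^ (-(1 : ℝ) / 3) := by
          have h4 : ((2 : ℝ) ^ (-(1 : ℝ) / 3)) ^ 3 = 1 / 2 := by
            rw [← Real.rpow_natCast, ← Real.rpow_mul zero_le_two]
            norm_num
          have h5 : (0.7925 : ℝ) ^ 3 ≤ ((2 : ℝ) ^ (-(1 : ℝ) / 3)) ^ 3 := by
            rw [h4]; norm_num
          exact le_of_pow_le_pow_left₀ three_ne_zero (by positivity) h5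
        exact pow_le_pow_left₀ (Finset.sum_nonneg fun b _ => mul_nonneg (hw b)
          (by split_ifs <;> norm_num)) (h2.trans h3) g
    _ = _ := by
        rw [← Real.rpow_natCast, ← Real.rpow_mul zero_le_two]
        congr 1
        ring

end MedianTail

section Amplitudes

/-- The amplitude of the outcome `b` when phase estimation with `r` bits is applied to an
eigenvector of phase `t`. -/
noncomputable def amp (r : ℕ) (t : ℝ) (b : Bits r) : ℂ :=
  ∑ x ∈ Finset.range (2 ^ r),
    1 / 2 ^ r * Complex.exp (2 * Real.pi * Complex.I * x * (t - bitsToNat b / 2 ^ r))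

theorem amp_of_eq {r : ℕ} {t : ℝ} {b : Bits r} (h : t = bitsToNat b / 2 ^ r) : amp r t b = 1 := by
  have h' : (t : ℂ) - bitsToNat b / 2 ^ r = 0 := by
    rw [h]; push_cast; ring
  simp [amp, h']

/-- The distance of the outcome `b` to the phase controls the amplitude from below. -/
theorem sin_sq_le_norm_amp_sq {r : ℕ} {t : ℝ} {b : Bits r} :
    Real.sin (Real.pi * (t * 2 ^ r - bitsToNat b)) ^ 2 ≤
      ‖amp r t b‖ ^ 2 * (Real.pi * (t * 2 ^ r - bitsToNat b)) ^ 2 := by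
  set d : ℝ := t * 2 ^ r - bitsToNat b with hd
  have hM : (0 : ℝ) < 2 ^ r := by positivity
  have hMC : (2 : ℂ) ^ r ≠ 0 := by positivity
  set z : ℂ := Complex.exp (Complex.I * ((2 * Real.pi * d / 2 ^ r : ℝ) : ℂ)) with hz
  have hamp : amp r t b = 1 / 2 ^ r * ∑ x ∈ Finset.range (2 ^ r), z ^ x := by
    rw [amp, Finset.mul_sum]
    refine Finset.sum_congr rfl fun x _ => ?_
    rw [hz, ← Complex.exp_nat_mul]
    congr 2
    rw [hd]
    push_cast
    field_simp
  have hgeom : amp r t b * (z - 1) * 2 ^ r = z ^ (2 ^ r) - 1 := by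
    rw [hamp, ← geom_sum_mul z (2 ^ r)]
    field_simp
  have hzM : z ^ (2 ^ r) = Complex.exp (Complex.I * ((2 * Real.pi * d : ℝ) : ℂ)) := by
    rw [hz, ← Complex.exp_nat_mul]
    congr 1
    push_cast
    field_simp
  have h1 : ‖z ^ (2 ^ r) - 1‖ = 2 * |Real.sin (Real.pi * d)| := by
    rw [hzM, Complex.norm_exp_I_mul_ofReal_sub_one, norm_mul, Real.norm_eq_abs, Real.norm_eq_abs,
      abs_two]
    congr 3
    ring
  have h2 : ‖z - 1‖ ≤ |2 * Real.pi * d / 2 ^ r| := Real.norm_exp_I_mul_ofReal_sub_one_le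
  have h3 : 2 * |Real.sin (Real.pi * d)| = ‖amp r t b‖ * ‖z - 1‖ * 2 ^ r := by
    rw [← h1, ← hgeom, norm_mul, norm_mul, norm_pow, Complex.norm_ofNat]
  have h4 : |2 * Real.pi * d / 2 ^ r| * 2 ^ r = 2 * |Real.pi * d| := by
    rw [abs_div, abs_of_pos hM, div_mul_cancel₀ _ hM.ne', mul_assoc, abs_mul, abs_two]
  have h5 : |Real.sin (Real.pi * d)| ≤ ‖amp r t b‖ * |Real.pi * d| := by
    have : ‖amp r t b‖ * ‖z - 1‖ * 2 ^ r ≤ ‖amp r t b‖ * |2 * Real.pi * d / 2 ^ r| * 2 ^ r := by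
      gcongr
    rw [mul_assoc _ |_|, h4] at this
    linarith
  calc _ = |Real.sin (Real.pi * d)| ^ 2 := (sq_abs _).symm
    _ ≤ (‖amp r t b‖ * |Real.pi * d|) ^ 2 := by gcongr
    _ = _ := by rw [mul_pow, sq_abs]

/-- The two sides agree at `w = 0` and at `w = 1`, so the estimate is done by expansion at these
points. -/
theorem one_sub_sq_sq_le_cos {w : ℝ} (h0 : 0 ≤ w) (h1 : w ≤ 1) :
    (1 - w ^ 2) ^ 2 ≤ Real.cos (Real.pi * w / 2) ^ 2 * (1 + w ^ 2) := by
  have hpi := Real.pi_gt_d4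
  have hpi' := Real.pi_lt_d4
  have hpi2 : Real.pi ^ 2 ≤ 9.87 := by nlinarith
  rcases le_total w 0.6 with h | h
  · have hc := Real.one_sub_sq_div_two_le_cos (x := Real.pi * w / 2)
    have hv : w ^ 2 ≤ 0.36 := by nlinarith
    have hv0 : 0 ≤ w ^ 2 := sq_nonneg w
    have h2 : 1 - 1.234 * w ^ 2 ≤ Real.cos (Real.pi * w / 2) := by nlinarith
    have h3 : (1 - 1.234 * w ^ 2) ^ 2 ≤ Real.cos (Real.pi * w / 2) ^ 2 :=
      pow_le_pow_left₀ (by linarith) h2 2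
    refine le_trans ?_ (mul_le_mul_of_nonneg_right h3 (by positivity))
    generalize w ^ 2 = v at hv hv0
    have : 0 ≤ v * (0.532 - 1.946 * v + 1.52 * v ^ 2) := by
      refine mul_nonneg hv0 ?_
      nlinarith
    nlinarith [pow_nonneg hv0 3, pow_nonneg hv0 2]
  · set s := 1 - w with hs
    have hs0 : 0 ≤ s := by linarith
    have hs1 : s ≤ 0.4 := by linarith
    have hcos : Real.cos (Real.pi * w / 2) = Real.sin (Real.pi * s / 2) := by
      rw [← Real.cos_pi_div_two_sub]
      congr 1
      rw [hs]; ring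
    have hsin : 1.57 * s * (1 - 0.412 * s ^ 2) ≤ Real.sin (Real.pi * s / 2) := by
      rcases hs0.eq_or_lt with h0 | hpos
      · rw [← h0]; simp
      have h2 := (Real.sin_gt_sub_cube (x := Real.pi * s / 2) (by positivity)).le
      have h3 : Real.pi * s / 2 - (Real.pi * s / 2) ^ 3 / 6
          = (Real.pi / 2) * s * (1 - Real.pi ^ 2 / 24 * s ^ 2) := by ring
      rw [h3] at h2
      refine le_trans ?_ h2
      have h4 : 1 - 0.412 * s ^ 2 ≤ 1 - Real.pi ^ 2 / 24 * s ^ 2 := by nlinarith [sq_nonneg s]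
      have h5 : 0 ≤ 1 - 0.412 * s ^ 2 := by nlinarith
      exact mul_le_mul (by nlinarith) h4 h5 (by positivity)
    have h6 : 0.934 ≤ 1 - 0.412 * s ^ 2 := by nlinarith
    have h7 : 1.466 * s ≤ Real.sin (Real.pi * s / 2) := by nlinarith
    have h8 : (1.466 * s) ^ 2 ≤ Real.sin (Real.pi * s / 2) ^ 2 :=
      pow_le_pow_left₀ (by positivity) h7 2
    rw [hcos]
    refine le_trans ?_ (mul_le_mul_of_nonneg_right h8 (by positivity))
    have hw : w = 1 - s := by rw [hs]; ring
    rw [hw]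
    have h9 : (1 - (1 - s) ^ 2) ^ 2 = s ^ 2 * (2 - s) ^ 2 := by ring
    have h10 : (1.466 * s) ^ 2 * (1 + (1 - s) ^ 2) = s ^ 2 * (1.466 ^ 2 * (2 - 2 * s + s ^ 2)) := by
      ring
    rw [h9, h10]
    refine mul_le_mul_of_nonneg_left ?_ (sq_nonneg s)
    nlinarith [sq_nonneg s]

/-- For a phase at distances `θ` and `1 - θ` from the two nearest grid points, the right-hand side
is `π²` times the limiting probability (for many bits) that phase estimation returns one of
the two. -/
theorem eight_le_sin_sq {θ : ℝ} (h0 : 0 < θ) (h1 : θ < 1) :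
    8 ≤ Real.sin (Real.pi * θ) ^ 2 * (1 / θ ^ 2 + 1 / (1 - θ) ^ 2) := by
  set w := |2 * θ - 1| with hw
  have hw0 : 0 ≤ w := abs_nonneg _
  have hw1 : w ≤ 1 := by rw [hw, abs_le]; constructor <;> linarith
  have hcos : Real.cos (Real.pi * w / 2) = Real.sin (Real.pi * θ) := by
    have h2 : Real.cos (Real.pi * w / 2) = Real.cos (Real.pi * (2 * θ - 1) / 2) := by
      rw [← Real.cos_abs (Real.pi * (2 * θ - 1) / 2), abs_div, abs_mul, abs_of_pos Real.pi_pos,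
        abs_two]
    rw [h2, ← Real.cos_sub_pi_div_two]
    congr 1
    ring
  have hmain := one_sub_sq_sq_le_cos hw0 hw1
  rw [hcos, hw, sq_abs] at hmain
  have hθ' : 0 < 1 - θ := by linarith
  have h3 : Real.sin (Real.pi * θ) ^ 2 * (1 / θ ^ 2 + 1 / (1 - θ) ^ 2)
      = Real.sin (Real.pi * θ) ^ 2 * (θ ^ 2 + (1 - θ) ^ 2) / (θ ^ 2 * (1 - θ) ^ 2) := by
    field_simp
    ring
  rw [h3, le_div_iff₀ (by positivity)]
  nlinarith [hmain]

/-- Phase estimation returns a neighbouring grid point with probability at least `8/π² > 0.805`. The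
bound on `t` ensures that the upper neighbour is represented by `r` bits. -/
theorem sum_norm_amp_sq_near {r : ℕ} {t : ℝ} (h0 : 0 ≤ t) (h1 : t ≤ 1 - 1 / 2 ^ r) :
    0.805 ≤ ∑ b : Bits r, (if |t * 2 ^ r - bitsToNat b| ≤ 1 then ‖amp r t b‖ ^ 2 else 0) := by
  have hM : (0 : ℝ) < 2 ^ r := by positivity
  set s := t * 2 ^ r with hs
  have hs0 : 0 ≤ s := by positivity
  have hs1 : s ≤ 2 ^ r - 1 := by
    calc s ≤ (1 - 1 / 2 ^ r) * 2 ^ r := mul_le_mul_of_nonneg_right h1 hM.le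
      _ = _ := by field_simp
  set k := ⌊s⌋₊ with hk
  have hk1 : (k : ℝ) ≤ s := Nat.floor_le hs0
  have hk2 : s < k + 1 := Nat.lt_floor_add_one s
  have hnn : ∀ b ∈ (Finset.univ : Finset (Bits r)),
      0 ≤ if |s - bitsToNat b| ≤ 1 then ‖amp r t b‖ ^ 2 else 0 := by
    intro b _; split_ifs <;> positivity
  have hkM : k < 2 ^ r := by
    have : (k : ℝ) < 2 ^ r := by linarith
    exact_mod_cast this
  obtain ⟨b, hb⟩ := exists_bitsToNat_eq hkM
  rcases hk1.eq_or_lt with heq | hlt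
  · have h2 : amp r t b = 1 := amp_of_eq (by rw [hb, heq, hs]; field_simp)
    refine le_trans ?_ (Finset.single_le_sum hnn (Finset.mem_univ b))
    rw [hb, heq, sub_self, abs_zero, if_pos zero_le_one, h2]
    norm_num
  · have hkM' : k + 1 < 2 ^ r := by
      have h3 : (k : ℝ) + 1 < 2 ^ r := by linarith
      exact_mod_cast h3
    obtain ⟨b', hb'⟩ := exists_bitsToNat_eq hkM'
    have hne : b ≠ b' := by
      rintro rfl
      omega
    set θ := s - k with hθ
    have hθ0 : 0 < θ := by linarith
    have hθ1 : θ < 1 := by linarith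
    have e1 : s - bitsToNat b = θ := by rw [hb]
    have e2 : s - bitsToNat b' = θ - 1 := by rw [hb', hθ]; push_cast; ring
    refine le_trans ?_ (Finset.add_le_sum hnn (Finset.mem_univ b) (Finset.mem_univ b') hne)
    have a1 : |θ| ≤ 1 := by rw [abs_le]; constructor <;> linarith
    have a2 : |θ - 1| ≤ 1 := by rw [abs_le]; constructor <;> linarith
    rw [e1, e2, if_pos a1, if_pos a2]
    have f1 := sin_sq_le_norm_amp_sq (t := t) (b := b)
    have f2 := sin_sq_le_norm_amp_sq (t := t) (b := b')
    rw [← hs, e1] at f1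
    rw [← hs, e2] at f2
    have hsin : Real.sin (Real.pi * (θ - 1)) ^ 2 = Real.sin (Real.pi * θ) ^ 2 := by
      rw [mul_sub, mul_one, Real.sin_sub_pi, neg_sq]
    rw [hsin] at f2
    have hpi := Real.pi_pos
    have hpi2 : Real.pi ^ 2 ≤ 9.87 := by nlinarith [Real.pi_lt_d4, Real.pi_gt_d4]
    have hθ' : 0 < 1 - θ := by linarith
    have g1 : Real.sin (Real.pi * θ) ^ 2 * (1 / θ ^ 2) ≤ ‖amp r t b‖ ^ 2 * Real.pi ^ 2 := by
      rw [mul_one_div, div_le_iff₀ (by positivity)]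
      linarith
    have g2 : Real.sin (Real.pi * θ) ^ 2 * (1 / (1 - θ) ^ 2) ≤ ‖amp r t b'‖ ^ 2 * Real.pi ^ 2 := by
      rw [mul_one_div, div_le_iff₀ (by positivity)]
      linarith
    have h8 := eight_le_sin_sq hθ0 hθ1
    have h9 : 8 ≤ (‖amp r t b‖ ^ 2 + ‖amp r t b'‖ ^ 2) * 9.87 := by
      calc (8 : ℝ) ≤ _ := h8
        _ ≤ (‖amp r t b‖ ^ 2 + ‖amp r t b'‖ ^ 2) * Real.pi ^ 2 := by linarith
        _ ≤ _ := by gcongr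
    linarith

/-- The amplitudes are the discrete Fourier transform of a sequence of phases, and their sum is its
entry at zero. -/
theorem sum_amp (r : ℕ) (t : ℝ) : ∑ b, amp r t b = 1 := by
  have hM : (2 : ℂ) ^ r ≠ 0 := by positivity
  simp only [amp]
  rw [Finset.sum_comm]
  have h : ∀ x ∈ Finset.range (2 ^ r), ∑ b : Bits r,
      1 / 2 ^ r * Complex.exp (2 * Real.pi * Complex.I * x * (t - bitsToNat b / 2 ^ r))
      = if x = 0 then 1 else 0 := by
    intro x hx
    have h1 : ∀ b : Bits r,
        1 / 2 ^ r * Complex.exp (2 * Real.pi * Complex.I * x * (t - bitsToNat b / 2 ^ r))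
        = 1 / 2 ^ r * Complex.exp (2 * Real.pi * Complex.I * x * t) *
          Complex.exp (2 * Real.pi * Complex.I * ((-x : ℤ) : ℂ) / ((2 ^ r : ℕ) : ℂ))
            ^ bitsToNat b := by
      intro b
      rw [← Complex.exp_nat_mul, mul_assoc (1 / 2 ^ r : ℂ), ← Complex.exp_add]
      congr 2
      push_cast
      field_simp
      ring
    simp only [h1, ← Finset.mul_sum]
    rw [sum_bitsToNat (fun y =>
      Complex.exp (2 * Real.pi * Complex.I * ((-x : ℤ) : ℂ) / ((2 ^ r : ℕ) : ℂ)) ^ y)]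
    split_ifs with h0
    · subst h0
      simp
    · rw [geom_sum_exp_eq_zero, mul_zero]
      intro hdvd
      have h3 := Int.eq_zero_of_abs_lt_dvd hdvd (by
        rw [abs_neg, Nat.abs_cast]
        exact_mod_cast Finset.mem_range.1 hx)
      omega
  rw [Finset.sum_congr rfl h, Finset.sum_ite_eq', if_pos (by simp)]

end Amplitudes

/-! ### Phase estimation in the energy eigenbasis -/

section Eigenbasis

variable {ι : Type} [Fintype ι] [DecidableEq ι]

/-- The operator with eigenvalues `d` in the orthonormal basis formed by the columns of `Φ`. -/
noncomputable def conjDiag (Φ : Op ι) (d : ι → ℂ) : Op ι := Φ * Matrix.diagonal d * Φᴴ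

theorem conjDiag_conjTranspose (Φ : Op ι) (d : ι → ℂ) :
    (conjDiag Φ d)ᴴ = conjDiag Φ (star d) := by
  simp only [conjDiag, Matrix.conjTranspose_mul, Matrix.conjTranspose_conjTranspose,
    Matrix.diagonal_conjTranspose, Matrix.mul_assoc]

theorem conjDiag_smul (Φ : Op ι) (c : ℂ) (d : ι → ℂ) :
    c • conjDiag Φ d = conjDiag Φ (c • d) := by
  rw [conjDiag, conjDiag, Matrix.diagonal_smul, Matrix.mul_smul, Matrix.smul_mul]

theorem conjDiag_sum {γ : Type*} (Φ : Op ι) (s : Finset γ) (d : γ → ι → ℂ) :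
    ∑ x ∈ s, conjDiag Φ (d x) = conjDiag Φ (∑ x ∈ s, d x) := by
  classical
  induction s using Finset.induction_on with
  | empty => simp [conjDiag]
  | insert a s ha ih =>
    rw [Finset.sum_insert ha, Finset.sum_insert ha, ih, conjDiag, conjDiag, conjDiag,
      ← Matrix.add_mul, ← Matrix.mul_add, Matrix.diagonal_add]
    rfl

variable {Φ : Op ι}

theorem conjDiag_one (h1 : Φᴴ * Φ = 1) : conjDiag Φ 1 = 1 := by
  rw [conjDiag, show (Matrix.diagonal 1 : Op ι) = 1 from Matrix.diagonal_one, Matrix.mul_one,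
    mul_eq_one_comm.1 h1]

theorem conjDiag_mul (h1 : Φᴴ * Φ = 1) (d d' : ι → ℂ) :
    conjDiag Φ d * conjDiag Φ d' = conjDiag Φ (d * d') := by
  calc _ = Φ * Matrix.diagonal d * (Φᴴ * Φ) * Matrix.diagonal d' * Φᴴ := by
        simp only [conjDiag, Matrix.mul_assoc]
    _ = _ := by
      rw [h1, Matrix.mul_one, Matrix.mul_assoc Φ, Matrix.diagonal_mul_diagonal]
      rfl

theorem conjDiag_pow (h1 : Φᴴ * Φ = 1) (d : ι → ℂ) (k : ℕ) :
    conjDiag Φ d ^ k = conjDiag Φ (d ^ k) := by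
  induction k with
  | zero => rw [pow_zero, pow_zero, conjDiag_one h1]
  | succ k ih => rw [pow_succ, pow_succ, ih, conjDiag_mul h1]

theorem conjDiag_list_prod (h1 : Φᴴ * Φ = 1) (l : List (ι → ℂ)) :
    (l.map (conjDiag Φ)).prod = conjDiag Φ l.prod := by
  induction l with
  | nil => rw [List.map_nil, List.prod_nil, List.prod_nil, conjDiag_one h1]
  | cons d l ih => rw [List.map_cons, List.prod_cons, List.prod_cons, ih, conjDiag_mul h1]

theorem conjDiag_injective (h1 : Φᴴ * Φ = 1) : Function.Injective (conjDiag Φ) := by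
  intro d d' h
  have h2 : ∀ e : ι → ℂ, Φᴴ * conjDiag Φ e * Φ = Matrix.diagonal e := fun e => by
    calc _ = (Φᴴ * Φ) * Matrix.diagonal e * (Φᴴ * Φ) := by simp only [conjDiag, Matrix.mul_assoc]
      _ = _ := by rw [h1, Matrix.one_mul, Matrix.mul_one]
  exact Matrix.diagonal_injective (by rw [← h2, ← h2, h])

theorem trace_conjDiag (h1 : Φᴴ * Φ = 1) (d : ι → ℂ) : (conjDiag Φ d).trace = ∑ i, d i := by
  rw [conjDiag, Matrix.trace_mul_comm, ← Matrix.mul_assoc, h1, Matrix.one_mul,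
    Matrix.trace_diagonal]

theorem exp_conjDiag (h1 : Φᴴ * Φ = 1) (d : ι → ℂ) :
    NormedSpace.exp (conjDiag Φ d) = conjDiag Φ fun i => Complex.exp (d i) := by
  have hinv : Φ⁻¹ = Φᴴ := Matrix.inv_eq_left_inv h1
  have hu : IsUnit Φ := IsUnit.of_mul_eq_one _ (mul_eq_one_comm.1 h1)
  rw [conjDiag, ← hinv, Matrix.exp_conj _ _ hu, Matrix.exp_diagonal, hinv, conjDiag]
  congr 3
  ext i
  rw [Pi.coe_exp, Complex.exp_eq_exp_ℂ]

/-- The operator applied to the system when the Hadamard and Fourier layers surround an operator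
that is block diagonal in the register. -/
theorem colBlock_kronecker_mul_mul {r : ℕ} (A B : Op (Bits r)) (T : Op (ι × Bits r))
    (V : Bits r → Op ι) (hT : ∀ x y, T x y = if x.2 = y.2 then V x.2 x.1 y.1 else 0)
    (b : Bits r) : colBlock (((1 : Op ι) ⊗ₖ A) * T * ((1 : Op ι) ⊗ₖ B)) b
      = ∑ x, (A b x * B x 0) • V x := by
  ext s s'
  have h2 : ∀ y : ι × Bits r, (((1 : Op ι) ⊗ₖ A) * T) (s, b) y = A b y.2 * V y.2 s y.1 := by
    intro y
    rw [Matrix.mul_apply, Fintype.sum_prod_type]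
    simp only [Matrix.kroneckerMap_apply, Matrix.one_apply, hT, ite_mul, one_mul, zero_mul, mul_ite,
      mul_zero]
    simp
  rw [colBlock_apply, Matrix.mul_apply, Fintype.sum_prod_type, Matrix.sum_apply, Finset.sum_comm]
  refine Finset.sum_congr rfl fun x _ => ?_
  simp only [h2, Matrix.kroneckerMap_apply, Matrix.one_apply, Matrix.smul_apply, smul_eq_mul,
    ite_mul, one_mul, zero_mul, mul_ite, mul_zero, Finset.sum_ite_eq', Finset.mem_univ, if_true]
  ring

theorem evolution_conjDiag (h1 : Φᴴ * Φ = 1) (lam : ι → ℝ) (κ : ℝ) (x : ℕ) :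
    evolution (conjDiag Φ fun i => (lam i : ℂ)) κ ^ x
      = conjDiag Φ fun i => Complex.exp (2 * Real.pi * Complex.I * x * (lam i / κ : ℝ)) := by
  rw [evolution, conjDiag_smul, conjDiag_smul, exp_conjDiag h1, conjDiag_pow h1]
  congr 1
  ext i
  rw [Pi.pow_apply, ← Complex.exp_nat_mul]
  congr 1
  simp only [Pi.smul_apply, smul_eq_mul]
  push_cast
  ring

theorem hadamardLayer_apply_zero {r : ℕ} (x : Bits r) :
    hadamardLayer r x 0 = ((1 / √(2 ^ r) : ℝ) : ℂ) := by
  have h : √((2 : ℝ) ^ r) = √2 ^ r := by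
    rw [Real.sqrt_eq_iff_mul_self_eq (by positivity) (by positivity), ← mul_pow,
      Real.mul_self_sqrt zero_le_two]
  simp [hadamardLayer, h]

theorem inv_sqrt_mul_inv_sqrt (r : ℕ) :
    ((1 / √(2 ^ r) : ℝ) : ℂ) * ((1 / √(2 ^ r) : ℝ) : ℂ) = 1 / 2 ^ r := by
  rw [← Complex.ofReal_mul, div_mul_div_comm, Real.mul_self_sqrt (by positivity)]
  push_cast
  norm_num

theorem colBlock_qpe (h1 : Φᴴ * Φ = 1) (lam : ι → ℝ) (κ : ℝ) {r : ℕ} (b : Bits r) :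
    colBlock (qpe (conjDiag Φ fun i => (lam i : ℂ)) κ r) b
      = conjDiag Φ fun i => amp r (lam i / κ) b := by
  rw [qpe, colBlock_kronecker_mul_mul _ _ _
    (fun x => evolution (conjDiag Φ fun i => (lam i : ℂ)) κ ^ bitsToNat x)
    (by intro x y; rw [controlledPower, Matrix.of_apply])]
  simp only [evolution_conjDiag h1, conjDiag_smul, conjDiag_sum]
  congr 1
  ext i
  rw [Finset.sum_apply, amp, ← sum_bitsToNat]
  refine Finset.sum_congr rfl fun x _ => ?_
  rw [Pi.smul_apply, smul_eq_mul, hadamardLayer_apply_zero, Matrix.conjTranspose_apply, qft,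
    Matrix.of_apply, star_mul', show star ((1 / √(2 ^ r) : ℝ) : ℂ) = ((1 / √(2 ^ r) : ℝ) : ℂ) from
      Complex.conj_ofReal _, mul_right_comm (((1 / √(2 ^ r) : ℝ) : ℂ)), inv_sqrt_mul_inv_sqrt,
    mul_assoc, show star (Complex.exp _) = _ from (Complex.exp_conj _).symm, ← Complex.exp_add]
  congr 2
  simp only [map_div₀, map_mul, Complex.conj_I, Complex.conj_ofReal, map_natCast, map_pow,
    Complex.conj_ofNat]
  ring

theorem colBlock_flippedQpe (h1 : Φᴴ * Φ = 1) (lam : ι → ℝ) (κ : ℝ) {r : ℕ} (b : Bits r) :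
    colBlock (flippedQpe (conjDiag Φ fun i => (lam i : ℂ)) κ r) b
      = conjDiag Φ fun i => star (amp r (lam i / κ) b) := by
  rw [flippedQpe, colBlock_kronecker_mul_mul _ _ _
    (fun x => (evolution (conjDiag Φ fun i => (lam i : ℂ)) κ ^ bitsToNat x)ᴴ)]
  · simp only [evolution_conjDiag h1, conjDiag_conjTranspose, conjDiag_smul, conjDiag_sum]
    congr 1
    ext i
    rw [Finset.sum_apply, amp, star_sum, ← sum_bitsToNat fun x => star (1 / 2 ^ r *
      Complex.exp (2 * Real.pi * Complex.I * x * ((lam i / κ : ℝ) - bitsToNat b / 2 ^ r)))]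
    refine Finset.sum_congr rfl fun x _ => ?_
    have h2 : star (1 / 2 ^ r : ℂ) = 1 / 2 ^ r := by simp
    rw [Pi.smul_apply, smul_eq_mul, hadamardLayer_apply_zero, qft, Matrix.of_apply, star_mul', h2,
      mul_right_comm (((1 / √(2 ^ r) : ℝ) : ℂ)), inv_sqrt_mul_inv_sqrt, mul_assoc, Pi.star_apply,
      show ∀ z, star (Complex.exp z) = _ from fun z => (Complex.exp_conj z).symm,
      show ∀ z, star (Complex.exp z) = _ from fun z => (Complex.exp_conj z).symm, ← Complex.exp_add]
    congr 2
    simp only [map_div₀, map_mul, Complex.conj_I, Complex.conj_ofReal, map_natCast, map_pow,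
      Complex.conj_ofNat, map_sub]
    ring
  · intro x y
    rw [Matrix.conjTranspose_apply, controlledPower, Matrix.of_apply]
    by_cases h : x.2 = y.2
    · rw [if_pos h, if_pos h.symm, Matrix.conjTranspose_apply, h]
    · rw [if_neg h, if_neg fun e => h e.symm, star_zero]

theorem sum_norm_amp_sq_eigenvalue (h1 : Φᴴ * Φ = 1) (lam : ι → ℝ) (κ : ℝ) (r : ℕ) (i : ι) :
    ∑ b, ‖amp r (lam i / κ) b‖ ^ 2 = 1 := by
  have hherm : (conjDiag Φ fun i => (lam i : ℂ)).IsHermitian := by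
    rw [Matrix.IsHermitian, conjDiag_conjTranspose]
    congr 1
    ext i
    exact Complex.conj_ofReal _
  have h := sum_colBlock_conjTranspose_mul (qpe (conjDiag Φ fun i => (lam i : ℂ)) κ r)
    (qpe (conjDiag Φ fun i => (lam i : ℂ)) κ r)
  rw [isometry_qpe hherm κ r, colBlock_one, if_pos rfl] at h
  simp only [colBlock_qpe h1, conjDiag_conjTranspose, conjDiag_mul h1, conjDiag_sum] at h
  rw [← conjDiag_one h1] at h
  have h2 := congrFun (conjDiag_injective h1 h) i
  simp only [Finset.sum_apply, Pi.mul_apply, Pi.star_apply, Pi.one_apply] at h2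
  have h3 : ∀ b : Bits r, star (amp r (lam i / κ) b) * amp r (lam i / κ) b
      = ((‖amp r (lam i / κ) b‖ ^ 2 : ℝ) : ℂ) := fun b => by
    rw [Complex.ofReal_pow, ← Complex.conj_mul']
    rfl
  simp only [h3] at h2
  exact_mod_cast h2

/-- The outcome probabilities of phase estimation add up to one: this is its unitarity for a
one-dimensional Hamiltonian. -/
theorem sum_norm_amp_sq (r : ℕ) (t : ℝ) : ∑ b, ‖amp r t b‖ ^ 2 = 1 := by
  have h := sum_norm_amp_sq_eigenvalue (Φ := (1 : Op (Fin 1))) isometry_one (fun _ => t) 1 r 0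
  rwa [div_one] at h

/-- The amplitude of a `g`-block outcome of boosted phase estimation on an eigenvector of
energy `e`. -/
noncomputable def regAmp {g r : ℕ} (κ : ℝ) (flip : Bool) (e : ℝ) (E : Reg g r) : ℂ :=
  ∏ i, if flip then star (amp r (e / κ) (E i)) else amp r (e / κ) (E i)

theorem colBlock_boostedQPE (h1 : Φᴴ * Φ = 1) (lam : ι → ℝ) (κ : ℝ) {g r : ℕ} (flip : Bool)
    (E : Reg g r) : colBlock (boostedQPE (conjDiag Φ fun i => (lam i : ℂ)) κ g r flip) E
      = conjDiag Φ fun i => regAmp κ flip (lam i) E := by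
  have h2 : ∀ b : Bits r, colBlock (if flip then flippedQpe (conjDiag Φ fun i => (lam i : ℂ)) κ r
      else qpe (conjDiag Φ fun i => (lam i : ℂ)) κ r) b
      = conjDiag Φ fun i => if flip then star (amp r (lam i / κ) b) else amp r (lam i / κ) b := by
    intro b
    cases flip
    · exact colBlock_qpe h1 lam κ b
    · exact colBlock_flippedQpe h1 lam κ b
  rw [boostedQPE, colBlock_boost]
  simp only [h2]
  have h3 := conjDiag_list_prod h1 (List.ofFn fun k : Fin g => fun i =>
    if flip then star (amp r (lam i / κ) (E k)) else amp r (lam i / κ) (E k))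
  rw [List.map_ofFn] at h3
  refine h3.trans ?_
  congr 1
  ext i
  rw [List.prod_ofFn, Finset.prod_apply]
  rfl

theorem regAmp_not {g r : ℕ} (κ : ℝ) (flip : Bool) (e : ℝ) (E : Reg g r) :
    regAmp κ (!flip) e E = star (regAmp κ flip e E) := by
  cases flip <;> simp [regAmp]

theorem norm_regAmp_sq {g r : ℕ} (κ : ℝ) (flip : Bool) (e : ℝ) (E : Reg g r) :
    ‖regAmp κ flip e E‖ ^ 2 = ∏ i, ‖amp r (e / κ) (E i)‖ ^ 2 := by
  rw [regAmp, norm_prod, ← Finset.prod_pow]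
  refine Finset.prod_congr rfl fun i _ => ?_
  cases flip <;> simp

theorem sum_norm_regAmp_sq {g r : ℕ} (κ : ℝ) (flip : Bool) (e : ℝ) :
    ∑ E : Reg g r, ‖regAmp κ flip e E‖ ^ 2 = 1 := by
  simp only [norm_regAmp_sq]
  rw [← Fintype.prod_sum (fun (_ : Fin g) b => ‖amp r (e / κ) b‖ ^ 2)]
  simp [sum_norm_amp_sq]

theorem sum_regAmp {g r : ℕ} (κ : ℝ) (flip : Bool) (e : ℝ) :
    ∑ E : Reg g r, regAmp κ flip e E = 1 := by
  simp only [regAmp]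
  rw [← Fintype.prod_sum (fun (_ : Fin g) b =>
    if flip then star (amp r (e / κ) b) else amp r (e / κ) b)]
  cases flip
  · simp [sum_amp]
  · have h2 : ∑ b, star (amp r (e / κ) b) = 1 := by
      rw [← star_sum, sum_amp, star_one]
    simp only [if_true, h2, Finset.prod_const_one]

/-- The median of the estimates is further than one grid step from the energy with probability at
most `2^(-g/3)`. -/
theorem sum_norm_regAmp_sq_far {g r : ℕ} {κ : ℝ} (hκ : 0 < κ) (flip : Bool) {e : ℝ} (h0 : 0 ≤ e)
    (h2 : e ≤ κ * (1 - 1 / 2 ^ r)) :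
    ∑ E : Reg g r, (if κ / 2 ^ r < |medianEnergy κ E - e| then ‖regAmp κ flip e E‖ ^ 2 else 0)
      ≤ (2 : ℝ) ^ (-(g : ℝ) / 3) := by
  set p : Bits r → Prop := fun b => κ / 2 ^ r < |energy κ b - e| with hp
  have hM : (0 : ℝ) < 2 ^ r := by positivity
  have hpiff : ∀ b, p b ↔ ¬|e / κ * 2 ^ r - bitsToNat b| ≤ 1 := by
    intro b
    have h3 : energy κ b - e = -(κ / 2 ^ r * (e / κ * 2 ^ r - bitsToNat b)) := by
      rw [energy_eq]; field_simp; ring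
    have hk : 0 < κ / 2 ^ r := by positivity
    change κ / 2 ^ r < |energy κ b - e| ↔ _
    rw [not_le, h3, abs_neg, abs_mul, abs_of_pos hk, lt_mul_iff_one_lt_right hk]
  classical
  have hfail : ∑ b, (if p b then ‖amp r (e / κ) b‖ ^ 2 else 0) ≤ 0.195 := by
    have h3 := sum_norm_amp_sq_near (r := r) (t := e / κ) (by positivity) (by
      rw [div_le_iff₀ hκ]; linarith)
    have h4 := sum_norm_amp_sq r (e / κ)
    have h5 : ∑ b, (if p b then ‖amp r (e / κ) b‖ ^ 2 else 0)
        + ∑ b : Bits r, (if |e / κ * 2 ^ r - bitsToNat b| ≤ 1 then ‖amp r (e / κ) b‖ ^ 2 else 0)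
        = ∑ b, ‖amp r (e / κ) b‖ ^ 2 := by
      rw [← Finset.sum_add_distrib]
      refine Finset.sum_congr rfl fun b _ => ?_
      by_cases h : |e / κ * 2 ^ r - bitsToNat b| ≤ 1
      · rw [if_neg (fun h' => (hpiff b).1 h' h), if_pos h, zero_add]
      · rw [if_pos ((hpiff b).2 h), if_neg h, add_zero]
    linarith
  refine le_trans (Finset.sum_le_sum fun E _ => ?_)
    (sum_prod_le_of_half_fail (fun b => sq_nonneg ‖amp r (e / κ) b‖) (sum_norm_amp_sq r (e / κ))
      hfail g)
  rw [norm_regAmp_sq]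
  have hnn : 0 ≤ ∏ i, ‖amp r (e / κ) (E i)‖ ^ 2 := Finset.prod_nonneg fun i _ => sq_nonneg _
  split_ifs with h3 h4
  · exact le_rfl
  · exact absurd (le_two_mul_card_of_median _ h3) h4
  · exact hnn
  · exact le_rfl

end Eigenbasis

/-! ### Approximate detailed balance -/

section DetailedBalance

variable {J R : Type} [Fintype R]

theorem sum_mul_le_of_sq {α : Type*} {s : Finset α} {x y : α → ℝ} {δ : ℝ} (hδ : 0 ≤ δ)
    (hx : ∑ i ∈ s, x i ^ 2 ≤ δ ^ 2) (hy : ∑ i ∈ s, y i ^ 2 ≤ 1) : ∑ i ∈ s, x i * y i ≤ δ := by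
  have h := Finset.sum_mul_sq_le_sq_mul_sq s x y
  have h2 : (∑ i ∈ s, x i * y i) ^ 2 ≤ δ ^ 2 := by
    refine h.trans ?_
    calc _ ≤ δ ^ 2 * 1 := mul_le_mul hx hy (Finset.sum_nonneg fun i _ => sq_nonneg _) (sq_nonneg _)
      _ = δ ^ 2 := mul_one _
  exact (abs_le_of_sq_le_sq' h2 hδ).2

theorem sum_norm_sq_mulVec [Fintype J] [DecidableEq J] {q : Op J} (hq : qᴴ * q = 1) (w : J → ℂ) :
    ∑ b, ‖∑ a, q b a * w a‖ ^ 2 = ∑ a, ‖w a‖ ^ 2 := by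
  have h1 : ∀ v : J → ℂ, ((∑ b, ‖v b‖ ^ 2 : ℝ) : ℂ) = star v ⬝ᵥ v := fun v => by
    rw [dotProduct]
    push_cast
    refine Finset.sum_congr rfl fun b _ => ?_
    rw [← Complex.conj_mul']
    rfl
  have h2 : star (q *ᵥ w) ⬝ᵥ (q *ᵥ w) = star w ⬝ᵥ w := by
    rw [Matrix.star_mulVec, ← Matrix.dotProduct_mulVec, Matrix.mulVec_mulVec, hq, Matrix.one_mulVec]
  rw [← h1, ← h1] at h2
  exact_mod_cast h2

theorem norm_unitary_form_le [Fintype J] [DecidableEq J] {q : Op J} (hq : qᴴ * q = 1)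
    {w z y : J → ℂ} {s t : ℝ} (hs : 0 ≤ s) (ht : 0 ≤ t) (hw : ∀ a, ‖w a‖ ≤ s * ‖y a‖)
    (hz : ∀ a, ‖z a‖ ≤ t * ‖y a‖) :
    ‖∑ a, ∑ b, q b a * w a * star (z b)‖ ≤ s * t * ∑ a, ‖y a‖ ^ 2 := by
  have hS : 0 ≤ ∑ a, ‖y a‖ ^ 2 := Finset.sum_nonneg fun a _ => sq_nonneg _
  have hsq : ∀ {v : J → ℂ} {c : ℝ}, (∀ a, ‖v a‖ ≤ c * ‖y a‖) →
      ∑ a, ‖v a‖ ^ 2 ≤ c ^ 2 * ∑ a, ‖y a‖ ^ 2 := by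
    intro v c hv
    rw [Finset.mul_sum]
    refine Finset.sum_le_sum fun a _ => ?_
    rw [← mul_pow]
    exact pow_le_pow_left₀ (norm_nonneg _) (hv a) 2
  rw [Finset.sum_comm]
  calc _ ≤ ∑ b, ‖∑ a, q b a * w a‖ * ‖z b‖ := by
        refine (norm_sum_le _ _).trans (Finset.sum_le_sum fun b _ => ?_)
        rw [← Finset.sum_mul, norm_mul, norm_star]
    _ ≤ s * t * ∑ a, ‖y a‖ ^ 2 := by
        refine abs_le_of_sq_le_sq' ?_ (by positivity) |>.2
        refine (Finset.sum_mul_sq_le_sq_mul_sq _ _ _).trans ?_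
        rw [sum_norm_sq_mulVec hq]
        calc _ ≤ (s ^ 2 * ∑ a, ‖y a‖ ^ 2) * (t ^ 2 * ∑ a, ‖y a‖ ^ 2) :=
              mul_le_mul (hsq hw) (hsq hz) (Finset.sum_nonneg fun a _ => sq_nonneg _)
                (by positivity)
          _ = _ := by ring

theorem norm_entry_le_one [Fintype J] [DecidableEq J] {q : Op J} (hq : qᴴ * q = 1) (b a : J) :
    ‖q b a‖ ≤ 1 := by
  have h := sum_norm_sq_mulVec hq (Pi.single a 1)
  have h1 : ∀ b, ∑ x, q b x * (Pi.single a 1 : J → ℂ) x = q b a := fun b => by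
    simp [Pi.single_apply]
  have h2 : ∑ x, ‖(Pi.single a 1 : J → ℂ) x‖ ^ 2 = 1 := by
    rw [Finset.sum_eq_single a]
    · simp
    · intro x _ hx; simp [hx]
    · intro h; exact absurd (Finset.mem_univ _) h
  simp only [h1, h2] at h
  have h3 : ‖q b a‖ ^ 2 ≤ 1 := by
    rw [← h]
    exact Finset.single_le_sum (f := fun b => ‖q b a‖ ^ 2) (fun b _ => sq_nonneg _)
      (Finset.mem_univ b)
  exact (sq_le_one_iff₀ (norm_nonneg _)).1 h3

theorem sum_comm_two_two [Fintype J] {M : Type*} [AddCommMonoid M] (F : R → R → J → J → M) :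
    ∑ E, ∑ E', ∑ a, ∑ b, F E E' a b = ∑ a, ∑ b, ∑ E, ∑ E', F E E' a b := by
  calc _ = ∑ E, ∑ a, ∑ b, ∑ E', F E E' a b := by
        refine Finset.sum_congr rfl fun E _ => ?_
        rw [Finset.sum_comm]
        exact Finset.sum_congr rfl fun a _ => Finset.sum_comm
    _ = _ := by
        rw [Finset.sum_comm]
        exact Finset.sum_congr rfl fun a _ => Finset.sum_comm

/-- Outcomes far from the true energy contribute little: off-diagonal terms are controlled by the
square root of the tail probability, through the Cauchy-Schwarz inequality. -/
theorem sum_far_le {B : J → R → ℂ} (hB : ∀ j, ∑ E, ‖B j E‖ ^ 2 = 1)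
    {near : J → R → Prop} [∀ j E, Decidable (near j E)] {δ : ℝ} (hδ0 : 0 ≤ δ) (hδ1 : δ ≤ 1)
    (htail : ∀ j, ∑ E, (if near j E then 0 else ‖B j E‖ ^ 2) ≤ δ ^ 2) (j a b : J) :
    ∑ E, ∑ E', (if near j E ∧ near a E' ∧ near b E' then 0 else
      ‖B j E‖ ^ 2 * (‖B a E'‖ * ‖B b E'‖)) ≤ 3 * δ := by
  have hsplit : ∀ E E', (if near j E ∧ near a E' ∧ near b E' then 0 else
      ‖B j E‖ ^ 2 * (‖B a E'‖ * ‖B b E'‖)) ≤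
      (if near j E then 0 else ‖B j E‖ ^ 2) * (‖B a E'‖ * ‖B b E'‖) +
      ‖B j E‖ ^ 2 * ((if near a E' then 0 else ‖B a E'‖) * ‖B b E'‖) +
      ‖B j E‖ ^ 2 * ((if near b E' then 0 else ‖B b E'‖) * ‖B a E'‖) := by
    intro E E'
    have hp : 0 ≤ ‖B j E‖ ^ 2 * (‖B a E'‖ * ‖B b E'‖) := by positivity
    have hp' : ‖B j E‖ ^ 2 * (‖B b E'‖ * ‖B a E'‖) = ‖B j E‖ ^ 2 * (‖B a E'‖ * ‖B b E'‖) := by ring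
    by_cases h1 : near j E <;> by_cases h2 : near a E' <;> by_cases h3 : near b E' <;>
      simp only [h1, h2, h3, if_true, if_false, and_true, and_false, zero_mul, mul_zero,
        hp'] <;> linarith
  have hroot : ∀ a b : J, ∑ E', (if near a E' then 0 else ‖B a E'‖) * ‖B b E'‖ ≤ δ := by
    intro a b
    refine sum_mul_le_of_sq hδ0 (le_of_eq_of_le ?_ (htail a)) (hB b).le
    refine Finset.sum_congr rfl fun E _ => ?_
    split_ifs <;> simp
  have hone : ∑ E', ‖B a E'‖ * ‖B b E'‖ ≤ 1 :=
    sum_mul_le_of_sq zero_le_one (by rw [hB a, one_pow]) (hB b).le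
  refine (Finset.sum_le_sum fun E _ => Finset.sum_le_sum fun E' _ => hsplit E E').trans ?_
  simp only [Finset.sum_add_distrib, ← Finset.mul_sum]
  simp only [← Finset.sum_mul, hB, one_mul]
  have h1 : (∑ E, if near j E then 0 else ‖B j E‖ ^ 2) * ∑ E', ‖B a E'‖ * ‖B b E'‖ ≤ δ := by
    calc _ ≤ δ ^ 2 * 1 := mul_le_mul (htail j) hone
            (Finset.sum_nonneg fun E _ => by positivity) (sq_nonneg _)
      _ ≤ δ := by nlinarith
  linarith [hroot a b, hroot b a]

/-- The dissipator applied to a Gibbs state, tested against a unitary `q` in the energy eigenbasis.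
Here `B j E` is the amplitude of the outcome `E` for the eigenvector `j`, `M E` is the energy read
off from `E`, `c` is the jump operator and `f` the acceptance rate. -/
theorem norm_gibbs_defect_le [Fintype J] [DecidableEq J] {B : J → R → ℂ}
    (hB : ∀ j, ∑ E, ‖B j E‖ ^ 2 = 1) {M : R → ℝ} {lam : J → ℝ} {β η δ Z : ℝ}
    (hβ : 0 ≤ β) (hη : 0 ≤ η) (hx : β * η ≤ 1 / 2)
    (hδ0 : 0 ≤ δ) (hδ1 : δ ≤ 1)
    (htail : ∀ j, ∑ E, (if η < |M E - lam j| then ‖B j E‖ ^ 2 else 0) ≤ δ ^ 2)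
    {p : J → ℝ} (hZ : 0 < Z) (hp : ∀ j, p j = Real.exp (-(β * lam j)) / Z) (hp1 : ∑ j, p j = 1)
    {c q : Op J} (hc : cᴴ * c = 1) (hq : qᴴ * q = 1) {f : R → R → ℝ} (hf0 : ∀ E E', 0 ≤ f E E')
    (hf1 : ∀ E E', f E E' ≤ 1)
    (hf : ∀ E E', f E E' * Real.exp (-(β * M E)) = f E' E * Real.exp (-(β * M E'))) :
    ‖∑ j, ∑ E, ∑ E', ∑ a, ∑ b, ((‖B j E‖ ^ 2 : ℝ) : ℂ) * (q b a * (B a E' * c a j) *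
      star (B b E' * c b j)) * ((2 * f E E' * p j - f E' E * (p a + p b) : ℝ) : ℂ)‖
      ≤ 12 * (Fintype.card J : ℝ) ^ 2 * δ + 16 * (β * η) := by
  classical
  set near : J → R → Prop := fun j E => |M E - lam j| ≤ η with hnear
  set T : J → R → R → J → J → ℂ := fun j E E' a b => ((‖B j E‖ ^ 2 : ℝ) : ℂ) *
    (q b a * (B a E' * c a j) * star (B b E' * c b j)) *
      ((2 * f E E' * p j - f E' E * (p a + p b) : ℝ) : ℂ) with hT
  have hp0 : ∀ j, 0 ≤ p j := fun j => by rw [hp]; positivity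
  have hcrow : ∀ a, ∑ j, ‖c a j‖ ^ 2 = 1 := by
    intro a
    have hcc : c * cᴴ = 1 := mul_eq_one_comm.1 hc
    have h := congrFun (congrFun hcc a) a
    rw [Matrix.mul_apply, Matrix.one_apply_eq] at h
    have h2 : ∀ j, c a j * cᴴ j a = ((‖c a j‖ ^ 2 : ℝ) : ℂ) := fun j => by
      rw [Complex.ofReal_pow, ← Complex.mul_conj', Matrix.conjTranspose_apply]
      rfl
    simp only [h2] at h
    exact_mod_cast h
  have hsplit : ∀ j E E' a b, T j E E' a b =
      (if near j E ∧ near a E' ∧ near b E' then T j E E' a b else 0) +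
      (if near j E ∧ near a E' ∧ near b E' then 0 else T j E E' a b) := by
    intro j E E' a b
    split_ifs <;> simp
  -- outcomes far from the true energies
  have hfar : ‖∑ j, ∑ E, ∑ E', ∑ a, ∑ b,
      (if near j E ∧ near a E' ∧ near b E' then 0 else T j E E' a b)‖
      ≤ 12 * (Fintype.card J : ℝ) ^ 2 * δ := by
    have hterm : ∀ j E E' a b, ‖(if near j E ∧ near a E' ∧ near b E' then 0 else T j E E' a b)‖ ≤
        (if near j E ∧ near a E' ∧ near b E' then 0 else
          ‖B j E‖ ^ 2 * (‖B a E'‖ * ‖B b E'‖)) * (2 * p j + p a + p b) := by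
      intro j E E' a b
      split_ifs with h
      · simp
      · have h1 : |2 * f E E' * p j - f E' E * (p a + p b)| ≤ 2 * p j + p a + p b := by
          have a1 := mul_le_of_le_one_left (hp0 j) (hf1 E E')
          have a2 := mul_nonneg (hf0 E E') (hp0 j)
          have a3 := mul_le_of_le_one_left (add_nonneg (hp0 a) (hp0 b)) (hf1 E' E)
          have a4 := mul_nonneg (hf0 E' E) (add_nonneg (hp0 a) (hp0 b))
          rw [abs_le]
          constructor <;> linarith [hp0 j, hp0 a, hp0 b]
        have h2 : ‖q b a * (B a E' * c a j) * star (B b E' * c b j)‖ ≤ ‖B a E'‖ * ‖B b E'‖ := by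
          rw [norm_mul, norm_mul, norm_star, norm_mul, norm_mul]
          have e1 := norm_entry_le_one hq b a
          have e2 := norm_entry_le_one hc a j
          have e3 := norm_entry_le_one hc b j
          calc _ ≤ 1 * (‖B a E'‖ * 1) * (‖B b E'‖ * 1) := by gcongr
            _ = _ := by ring
        rw [hT]
        simp only
        rw [norm_mul, norm_mul, Complex.norm_real, Complex.norm_real, Real.norm_eq_abs,
          Real.norm_eq_abs, abs_of_nonneg (sq_nonneg _)]
        gcongr
    calc _ ≤ ∑ j, ∑ E, ∑ E', ∑ a, ∑ b, (if near j E ∧ near a E' ∧ near b E' then 0 else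
          ‖B j E‖ ^ 2 * (‖B a E'‖ * ‖B b E'‖)) * (2 * p j + p a + p b) := by
          refine (norm_sum_le _ _).trans (Finset.sum_le_sum fun j _ => ?_)
          refine (norm_sum_le _ _).trans (Finset.sum_le_sum fun E _ => ?_)
          refine (norm_sum_le _ _).trans (Finset.sum_le_sum fun E' _ => ?_)
          refine (norm_sum_le _ _).trans (Finset.sum_le_sum fun a _ => ?_)
          exact (norm_sum_le _ _).trans (Finset.sum_le_sum fun b _ => hterm j E E' a b)
      _ = ∑ j, ∑ a, ∑ b, (∑ E, ∑ E', (if near j E ∧ near a E' ∧ near b E' then 0 else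
          ‖B j E‖ ^ 2 * (‖B a E'‖ * ‖B b E'‖))) * (2 * p j + p a + p b) := by
          refine Finset.sum_congr rfl fun j _ => ?_
          rw [sum_comm_two_two]
          simp only [Finset.sum_mul]
      _ ≤ ∑ j, ∑ a, ∑ b, 3 * δ * (2 * p j + p a + p b) := by
          refine Finset.sum_le_sum fun j _ => Finset.sum_le_sum fun a _ =>
            Finset.sum_le_sum fun b _ => ?_
          refine mul_le_mul_of_nonneg_right (sum_far_le hB hδ0 hδ1 (fun j => ?_) j a b)
            (by linarith [hp0 j, hp0 a, hp0 b])
          refine le_of_eq_of_le (Finset.sum_congr rfl fun E _ => ?_) (htail j)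
          by_cases h : near j E
          · rw [if_pos h, if_neg (not_lt.2 h)]
          · rw [if_neg h, if_pos (not_le.1 h)]
      _ = _ := by
          simp only [← Finset.mul_sum, Finset.sum_add_distrib, Finset.sum_const, Finset.card_univ,
            nsmul_eq_mul, hp1]
          ring
  -- outcomes close to the true energies
  have hclose : ‖∑ j, ∑ E, ∑ E', ∑ a, ∑ b,
      (if near j E ∧ near a E' ∧ near b E' then T j E E' a b else 0)‖ ≤ 16 * (β * η) := by
    have hexp : ∀ j E, near j E → |Real.exp (β * (M E - lam j)) - 1| ≤ 2 * (β * η) := by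
      intro j E h
      have h1 : |β * (M E - lam j)| ≤ β * η := by
        rw [abs_mul, abs_of_nonneg hβ]
        exact mul_le_mul_of_nonneg_left h hβ
      exact (Real.abs_exp_sub_one_le (by linarith)).trans (by linarith)
    have hblock : ∀ j E E', ‖∑ a, ∑ b,
        (if near j E ∧ near a E' ∧ near b E' then T j E E' a b else 0)‖ ≤
        16 * (β * η) * ∑ a, ‖B j E‖ ^ 2 * (‖B a E'‖ ^ 2 * (‖c a j‖ ^ 2 * p a)) := by
      intro j E E'
      have hRHS : 0 ≤ 16 * (β * η) * ∑ a, ‖B j E‖ ^ 2 * (‖B a E'‖ ^ 2 * (‖c a j‖ ^ 2 * p a)) :=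
        mul_nonneg (by positivity) (Finset.sum_nonneg fun a _ => by have := hp0 a; positivity)
      by_cases hj : near j E
      swap
      · simpa [hj] using hRHS
      set y : J → ℂ := fun a => if near a E' then B a E' * c a j else 0 with hy
      set v : J → ℂ := fun a => ((Real.exp (β * (M E' - lam a)) - 1 : ℝ) : ℂ) with hv
      set u : ℂ := ((Real.exp (β * (M E - lam j)) - 1 : ℝ) : ℂ) with hu
      set A : ℝ := ‖B j E‖ ^ 2 * (f E' E * Real.exp (-(β * M E')) / Z) with hA
      have hA0 : 0 ≤ A := by
        have := hf0 E' E
        positivity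
      have hvy : ∀ a, ‖v a * y a‖ ≤ 2 * (β * η) * ‖y a‖ := by
        intro a
        by_cases ha : near a E'
        · rw [norm_mul]
          refine mul_le_mul_of_nonneg_right ?_ (norm_nonneg _)
          rw [hv, Complex.norm_real, Real.norm_eq_abs]
          exact hexp a E' ha
        · simp [hy, ha]
      have hterm : ∀ a b, (if near j E ∧ near a E' ∧ near b E' then T j E E' a b else 0)
          = (A : ℂ) * (2 * u * (q b a * y a * star (y b)) - q b a * (v a * y a) * star (y b)
            - q b a * y a * star (v b * y b)) := by
        intro a b
        by_cases ha : near a E'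
        swap
        · simp [hy, ha]
        by_cases hb : near b E'
        swap
        · simp [hy, hb]
        rw [if_pos ⟨hj, ha, hb⟩]
        have hstar : star (v b) = v b := Complex.conj_ofReal _
        -- detailed balance takes out the Gibbs weight of the estimate, and leaves differences that
        -- vanish when estimates and energies agree
        have hcoef : 2 * f E E' * p j - f E' E * (p a + p b) = f E' E * Real.exp (-(β * M E')) / Z *
            (2 * (Real.exp (β * (M E - lam j)) - 1) - (Real.exp (β * (M E' - lam a)) - 1)
              - (Real.exp (β * (M E' - lam b)) - 1)) := by
          have g1 : ∀ (l : J) (F : R), Real.exp (-(β * lam l))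
              = Real.exp (-(β * M F)) * Real.exp (β * (M F - lam l)) := fun l F => by
            rw [← Real.exp_add]; congr 1; ring
          have g2 := hf E E'
          rw [hp j, hp a, hp b, g1 j E, g1 a E', g1 b E']
          calc _ = (2 * (f E E' * Real.exp (-(β * M E))) * Real.exp (β * (M E - lam j))
                - f E' E * Real.exp (-(β * M E')) * (Real.exp (β * (M E' - lam a))
                  + Real.exp (β * (M E' - lam b)))) / Z := by ring
            _ = _ := by rw [g2]; ring
        simp only [hT, hy, if_pos ha, if_pos hb, star_mul', hstar]
        rw [hcoef, hA, hu, hv]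
        push_cast
        ring
      have hform : ∑ a, ∑ b, (if near j E ∧ near a E' ∧ near b E' then T j E E' a b else 0)
          = (A : ℂ) * (2 * u * (∑ a, ∑ b, q b a * y a * star (y b))
            - (∑ a, ∑ b, q b a * (v a * y a) * star (y b))
            - ∑ a, ∑ b, q b a * y a * star (v b * y b)) := by
        simp only [hterm, Finset.mul_sum, ← Finset.sum_sub_distrib]
      have hy1 : ∀ a, ‖y a‖ ≤ 1 * ‖y a‖ := fun a => by rw [one_mul]
      have hx0 : 0 ≤ 2 * (β * η) := by positivity
      have b1 := norm_unitary_form_le hq zero_le_one zero_le_one hy1 hy1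
      have b2 := norm_unitary_form_le hq hx0 zero_le_one hvy hy1
      have b3 := norm_unitary_form_le hq zero_le_one hx0 hy1 hvy
      have hu' : ‖u‖ ≤ 2 * (β * η) := by
        rw [hu, Complex.norm_real, Real.norm_eq_abs]
        exact hexp j E hj
      set S : ℝ := ∑ a, ‖y a‖ ^ 2 with hS
      have hS0 : 0 ≤ S := Finset.sum_nonneg fun a _ => sq_nonneg _
      have h8 : ‖2 * u * (∑ a, ∑ b, q b a * y a * star (y b))
            - (∑ a, ∑ b, q b a * (v a * y a) * star (y b))
            - ∑ a, ∑ b, q b a * y a * star (v b * y b)‖ ≤ 8 * (β * η) * S := by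
        refine (norm_sub_le _ _).trans ?_
        have h9 := norm_sub_le (2 * u * (∑ a, ∑ b, q b a * y a * star (y b)))
          (∑ a, ∑ b, q b a * (v a * y a) * star (y b))
        have h10 : ‖2 * u * (∑ a, ∑ b, q b a * y a * star (y b))‖ ≤
            2 * (2 * (β * η)) * (1 * 1 * S) := by
          rw [norm_mul, norm_mul, Complex.norm_ofNat]
          gcongr
        linarith
      rw [hform, norm_mul, Complex.norm_real, Real.norm_eq_abs, abs_of_nonneg hA0]
      have hAS : A * S ≤ 2 * ∑ a, ‖B j E‖ ^ 2 * (‖B a E'‖ ^ 2 * (‖c a j‖ ^ 2 * p a)) := by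
        rw [hS, Finset.mul_sum, Finset.mul_sum]
        refine Finset.sum_le_sum fun a _ => ?_
        by_cases ha : near a E'
        swap
        · have := hp0 a
          simp only [hy, if_neg ha, norm_zero]
          norm_num
          positivity
        have g1 : f E' E * Real.exp (-(β * M E')) / Z ≤ 2 * p a := by
          have g2 : Real.exp (-(β * M E')) = Real.exp (-(β * lam a)) *
              Real.exp (β * (lam a - M E')) := by
            rw [← Real.exp_add]; congr 1; ring
          have g3 : Real.exp (β * (lam a - M E')) ≤ 2 := by
            have g4 : β * (lam a - M E') ≤ 1 / 2 := by
              have : lam a - M E' ≤ η := by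
                have := (abs_le.1 ha).1
                linarith
              exact (mul_le_mul_of_nonneg_left this hβ).trans hx
            have g5 := Real.exp_le_exp.2 g4
            have g6 := Real.abs_exp_sub_one_le (x := 1 / 2) (by norm_num [abs_of_pos])
            have g7 := (abs_le.1 g6).2
            rw [abs_of_pos (by norm_num : (0 : ℝ) < 1 / 2)] at g7
            linarith
          rw [hp a]
          calc f E' E * Real.exp (-(β * M E')) / Z ≤ 1 * Real.exp (-(β * M E')) / Z := by
                have := hf1 E' E
                gcongr
            _ ≤ 1 * (Real.exp (-(β * lam a)) * 2) / Z := by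
                rw [g2]
                gcongr
            _ = _ := by ring
        have g8 : ‖y a‖ ^ 2 = ‖B a E'‖ ^ 2 * ‖c a j‖ ^ 2 := by
          simp only [hy, if_pos ha, norm_mul, mul_pow]
        rw [hA, g8]
        calc _ ≤ ‖B j E‖ ^ 2 * (2 * p a) * (‖B a E'‖ ^ 2 * ‖c a j‖ ^ 2) := by gcongr
          _ = _ := by ring
      calc _ ≤ A * (8 * (β * η) * S) := by gcongr
        _ = 8 * (β * η) * (A * S) := by ring
        _ ≤ 8 * (β * η) * (2 * ∑ a, ‖B j E‖ ^ 2 * (‖B a E'‖ ^ 2 * (‖c a j‖ ^ 2 * p a))) := by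
            gcongr
        _ = _ := by ring
    calc _ ≤ ∑ j, ∑ E, ∑ E', 16 * (β * η) *
          ∑ a, ‖B j E‖ ^ 2 * (‖B a E'‖ ^ 2 * (‖c a j‖ ^ 2 * p a)) := by
          refine (norm_sum_le _ _).trans (Finset.sum_le_sum fun j _ => ?_)
          refine (norm_sum_le _ _).trans (Finset.sum_le_sum fun E _ => ?_)
          exact (norm_sum_le _ _).trans (Finset.sum_le_sum fun E' _ => hblock j E E')
      _ = 16 * (β * η) * ∑ j, ∑ a, ‖c a j‖ ^ 2 * p a := by
          simp only [← Finset.mul_sum]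
          congr 1
          refine Finset.sum_congr rfl fun j _ => ?_
          rw [← Finset.sum_mul, hB, one_mul, Finset.sum_comm]
          refine Finset.sum_congr rfl fun a _ => ?_
          rw [← Finset.sum_mul, hB, one_mul]
      _ = 16 * (β * η) := by
          rw [Finset.sum_comm]
          simp only [← Finset.sum_mul, hcrow, one_mul, hp1, mul_one]
  have hsum : ∑ j, ∑ E, ∑ E', ∑ a, ∑ b, T j E E' a b =
      (∑ j, ∑ E, ∑ E', ∑ a, ∑ b,
        (if near j E ∧ near a E' ∧ near b E' then T j E E' a b else 0)) +
      ∑ j, ∑ E, ∑ E', ∑ a, ∑ b,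
        (if near j E ∧ near a E' ∧ near b E' then 0 else T j E E' a b) := by
    simp only [← Finset.sum_add_distrib]
    refine Finset.sum_congr rfl fun j _ => Finset.sum_congr rfl fun E _ => Finset.sum_congr rfl
      fun E' _ => Finset.sum_congr rfl fun a _ => Finset.sum_congr rfl fun b _ => hsplit j E E' a b
  change ‖∑ j, ∑ E, ∑ E', ∑ a, ∑ b, T j E E' a b‖ ≤ _
  rw [hsum]
  exact (norm_add_le _ _).trans (by linarith)

end DetailedBalance

/-! ### The Gibbs state and the reversal of jumps -/

section GibbsState

variable {ι : Type} [Fintype ι] [DecidableEq ι]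

theorem nonneg_of_posSemidef_conjDiag {Φ : Op ι} (h1 : Φᴴ * Φ = 1) {lam : ι → ℝ}
    (h : (conjDiag Φ fun i => (lam i : ℂ)).PosSemidef) (i : ι) : 0 ≤ lam i := by
  have h2 : Φᴴ * (conjDiag Φ fun i => (lam i : ℂ)) * Φ = Matrix.diagonal fun i => (lam i : ℂ) := by
    calc _ = (Φᴴ * Φ) * (Matrix.diagonal fun i => (lam i : ℂ)) * (Φᴴ * Φ) := by
          simp only [conjDiag, Matrix.mul_assoc]
      _ = _ := by rw [h1, Matrix.one_mul, Matrix.mul_one]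
  have h3 := (h.conjTranspose_mul_mul_same Φ).diag_nonneg (i := i)
  rw [h2, Matrix.diagonal_apply_eq] at h3
  exact_mod_cast h3

theorem le_specNorm_conjDiag {Φ : Op ι} (h1 : Φᴴ * Φ = 1) {lam : ι → ℝ} (i : ι) :
    lam i ≤ specNorm (conjDiag Φ fun i => (lam i : ℂ)) := by
  set v : EuclideanSpace ℂ ι := WithLp.toLp 2 (Φ *ᵥ Pi.single i 1) with hv
  have hmul : Matrix.toEuclideanCLM (n := ι) (𝕜 := ℂ) (conjDiag Φ fun i => (lam i : ℂ)) v
      = (lam i : ℂ) • v := by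
    rw [hv, Matrix.toEuclideanCLM_toLp, ← WithLp.toLp_smul, Matrix.mulVec_mulVec, conjDiag,
      Matrix.mul_assoc, h1, Matrix.mul_one, ← Matrix.mulVec_mulVec, ← Matrix.mulVec_smul]
    congr 2
    ext j
    rw [Matrix.mulVec_diagonal]
    by_cases h : j = i
    · subst h; simp
    · simp [h]
  have hv0 : v ≠ 0 := by
    intro h0
    have h2 : Φ *ᵥ Pi.single i 1 = 0 := congrArg WithLp.ofLp h0
    have h3 : Φᴴ *ᵥ (Φ *ᵥ Pi.single i 1) = 0 := by rw [h2, Matrix.mulVec_zero]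
    rw [Matrix.mulVec_mulVec, h1, Matrix.one_mulVec] at h3
    simpa using congrFun h3 i
  have h := (Matrix.toEuclideanCLM (n := ι) (𝕜 := ℂ)
    (conjDiag Φ fun i => (lam i : ℂ))).le_opNorm v
  rw [hmul, norm_smul, Complex.norm_real] at h
  exact (le_abs_self _).trans (le_of_mul_le_mul_right h (norm_pos_iff.2 hv0))

theorem gibbsState_conjDiag [Nonempty ι] {Φ : Op ι} (h1 : Φᴴ * Φ = 1) (lam : ι → ℝ) (β : ℝ) :
    gibbsState (conjDiag Φ fun i => (lam i : ℂ)) β = conjDiag Φ fun i =>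
      ((Real.exp (-(β * lam i)) / ∑ j, Real.exp (-(β * lam j)) : ℝ) : ℂ) := by
  have h2 : NormedSpace.exp (-(β : ℂ) • conjDiag Φ fun i => (lam i : ℂ))
      = conjDiag Φ fun i => ((Real.exp (-(β * lam i)) : ℝ) : ℂ) := by
    rw [conjDiag_smul, exp_conjDiag h1]
    congr 1
    ext i
    simp [neg_mul]
  rw [gibbsState, h2, trace_conjDiag h1, conjDiag_smul]
  congr 1
  ext i
  rw [Pi.smul_apply, smul_eq_mul]
  push_cast
  rw [div_eq_inv_mul]

/-- The trace of `q` against a dissipator whose anticommutator part carries `k * kᴴ`, taken at a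
diagonal operator. -/
theorem trace_mul_dissipator (q k : Op ι) (p : ι → ℝ) (s t : ℝ) :
    (q * (((2 * s : ℝ) : ℂ) • (k * Matrix.diagonal (fun i => (p i : ℂ)) * kᴴ) - (t : ℂ) •
      (k * kᴴ * Matrix.diagonal (fun i => (p i : ℂ)) +
        Matrix.diagonal (fun i => (p i : ℂ)) * (k * kᴴ)))).trace =
    ∑ j, ∑ a, ∑ b, q b a * k a j * star (k b j) *
      ((2 * s * p j - t * (p a + p b) : ℝ) : ℂ) := by
  have hX : ∀ a b, (((2 * s : ℝ) : ℂ) • (k * Matrix.diagonal (fun i => (p i : ℂ)) * kᴴ) - (t : ℂ) •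
      (k * kᴴ * Matrix.diagonal (fun i => (p i : ℂ)) +
        Matrix.diagonal (fun i => (p i : ℂ)) * (k * kᴴ))) a b =
      ∑ j, k a j * star (k b j) * ((2 * s * p j - t * (p a + p b) : ℝ) : ℂ) := by
    intro a b
    rw [Matrix.sub_apply, Matrix.smul_apply, Matrix.smul_apply, Matrix.add_apply, Matrix.mul_apply,
      Matrix.mul_diagonal, Matrix.diagonal_mul, Matrix.mul_apply]
    simp only [Matrix.mul_diagonal, Matrix.conjTranspose_apply, smul_eq_mul, Finset.mul_sum,
      Finset.sum_mul, ← Finset.sum_add_distrib, ← Finset.sum_sub_distrib]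
    refine Finset.sum_congr rfl fun j _ => ?_
    push_cast
    ring
  have htr : ∀ X : Op ι, (q * X).trace = ∑ b, ∑ a, q b a * X a b := fun X =>
    Finset.sum_congr rfl fun b _ => Matrix.mul_apply
  rw [htr]
  simp only [hX, Finset.mul_sum]
  rw [Finset.sum_comm, Finset.sum_congr rfl fun a _ => Finset.sum_comm, Finset.sum_comm]
  simp only [mul_assoc]

end GibbsState

section Jumps

variable {n g r : ℕ} {κ : ℝ} {Φ : Op (Bits n)} {lam : Bits n → ℝ}

theorem jumpOp_conjDiag (h1 : Φᴴ * Φ = 1) (flip : Bool) (C : Op (Bits n)) (E E' : Reg g r) :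
    jumpOp (conjDiag Φ fun i => (lam i : ℂ)) κ g r flip C E E' =
      conjDiag Φ (fun i => regAmp κ flip (lam i) E') * C *
        conjDiag Φ fun i => regAmp κ flip (lam i) E := by
  rw [jumpOp, colBlock_boostedQPE h1, colBlock_boostedQPE h1]

/-- Flipping the phase estimation turns the adjoint of a jump into the reverse jump. -/
theorem jumpOp_conjTranspose (h1 : Φᴴ * Φ = 1) (flip : Bool) (C : Op (Bits n)) (E E' : Reg g r) :
    (jumpOp (conjDiag Φ fun i => (lam i : ℂ)) κ g r flip C E E')ᴴ =
      jumpOp (conjDiag Φ fun i => (lam i : ℂ)) κ g r (!flip) Cᴴ E' E := by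
  rw [jumpOp_conjDiag h1, jumpOp_conjDiag h1]
  simp only [Matrix.conjTranspose_mul, conjDiag_conjTranspose, regAmp_not, Matrix.mul_assoc]
  rfl

/-- For an eigenvector the amplitudes of all outcomes add up to one, so phase estimation drops out
of the sum. -/
theorem sum_jumpOp (h1 : Φᴴ * Φ = 1) (flip : Bool) (C : Op (Bits n)) :
    ∑ E : Reg g r, ∑ E' : Reg g r,
      jumpOp (conjDiag Φ fun i => (lam i : ℂ)) κ g r flip C E E' = C := by
  have h2 : ∑ E : Reg g r, conjDiag Φ (fun i => regAmp κ flip (lam i) E) = 1 := by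
    rw [conjDiag_sum, ← conjDiag_one h1]
    congr 1
    ext i
    rw [Finset.sum_apply, sum_regAmp, Pi.one_apply]
  simp only [jumpOp_conjDiag h1, ← Finset.sum_mul, ← Finset.mul_sum]
  rw [h2, Matrix.one_mul, Matrix.mul_one]

variable {𝒞 : Finset (Op (Bits n))} {μ : Op (Bits n) → ℝ} (β : ℝ)

theorem generator_apply (H M : Op (Bits n)) :
    generator H κ β g r 𝒞 μ M = ∑ C ∈ 𝒞, ∑ flip : Bool, ∑ E : Reg g r, ∑ E' : Reg g r,
      ((1 / 2 * μ C * acceptRate κ β E E' : ℝ) : ℂ) •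
        ((2 : ℂ) • (jumpOp H κ g r flip C E E' * M * (jumpOp H κ g r flip C E E')ᴴ)
          - (jumpOp H κ g r flip C E E')ᴴ * jumpOp H κ g r flip C E E' * M
          - M * ((jumpOp H κ g r flip C E E')ᴴ * jumpOp H κ g r flip C E E')) := by
  rw [generator_eq_lindblad, lindblad_apply, Fintype.sum_prod_type]
  simp only [Fintype.sum_prod_type]
  exact Finset.sum_coe_sort 𝒞 (fun C => ∑ flip : Bool, ∑ E : Reg g r, ∑ E' : Reg g r,
      ((1 / 2 * μ C * acceptRate κ β E E' : ℝ) : ℂ) •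
        ((2 : ℂ) • (jumpOp H κ g r flip C E E' * M * (jumpOp H κ g r flip C E E')ᴴ)
          - (jumpOp H κ g r flip C E E')ᴴ * jumpOp H κ g r flip C E E' * M
          - M * ((jumpOp H κ g r flip C E E')ᴴ * jumpOp H κ g r flip C E E')))

/-- The anticommutator part of the generator, rewritten by means of the involution that reverses
jumps. -/
theorem generator_apply_reversed (h1 : Φᴴ * Φ = 1) (h𝒞 : IsJumpDistribution 𝒞 μ)
    {H : Op (Bits n)} (hH : H = conjDiag Φ fun i => (lam i : ℂ)) (M : Op (Bits n)) :
    generator H κ β g r 𝒞 μ M = ∑ C ∈ 𝒞, ∑ flip : Bool, ((1 / 2 * μ C : ℝ) : ℂ) •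
      ∑ E : Reg g r, ∑ E' : Reg g r, (((2 * acceptRate κ β E E' : ℝ) : ℂ) •
        (jumpOp H κ g r flip C E E' * M * (jumpOp H κ g r flip C E E')ᴴ) -
        ((acceptRate κ β E' E : ℝ) : ℂ) •
          (jumpOp H κ g r flip C E E' * (jumpOp H κ g r flip C E E')ᴴ * M +
            M * (jumpOp H κ g r flip C E E' * (jumpOp H κ g r flip C E E')ᴴ))) := by
  have hrev : ∑ C ∈ 𝒞, ∑ flip : Bool, ∑ E : Reg g r, ∑ E' : Reg g r,
      ((1 / 2 * μ C * acceptRate κ β E E' : ℝ) : ℂ) •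
        ((jumpOp H κ g r flip C E E')ᴴ * jumpOp H κ g r flip C E E') =
      ∑ C ∈ 𝒞, ∑ flip : Bool, ∑ E : Reg g r, ∑ E' : Reg g r,
      ((1 / 2 * μ C * acceptRate κ β E' E : ℝ) : ℂ) •
        (jumpOp H κ g r flip C E E' * (jumpOp H κ g r flip C E E')ᴴ) := by
    refine Finset.sum_nbij' (fun C => Cᴴ) (fun C => Cᴴ) h𝒞.adjoint_mem h𝒞.adjoint_mem
      (fun C _ => Matrix.conjTranspose_conjTranspose C)
      (fun C _ => Matrix.conjTranspose_conjTranspose C) fun C hC => ?_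
    refine Fintype.sum_equiv Equiv.boolNot _ _ fun flip => ?_
    rw [Finset.sum_comm]
    refine Finset.sum_congr rfl fun E _ => Finset.sum_congr rfl fun E' _ => ?_
    have h2 : jumpOp H κ g r (!flip) Cᴴ E E' = (jumpOp H κ g r flip C E' E)ᴴ := by
      rw [hH, jumpOp_conjTranspose h1]
    change _ = _ • (jumpOp H κ g r (!flip) Cᴴ E E' * (jumpOp H κ g r (!flip) Cᴴ E E')ᴴ)
    rw [h2, Matrix.conjTranspose_conjTranspose, h𝒞.adjoint_prob C hC]
  have hfwd : generator H κ β g r 𝒞 μ M =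
      (∑ C ∈ 𝒞, ∑ flip : Bool, ∑ E : Reg g r, ∑ E' : Reg g r,
        ((2 * (1 / 2 * μ C * acceptRate κ β E E') : ℝ) : ℂ) •
          (jumpOp H κ g r flip C E E' * M * (jumpOp H κ g r flip C E E')ᴴ)) -
      ((∑ C ∈ 𝒞, ∑ flip : Bool, ∑ E : Reg g r, ∑ E' : Reg g r,
        ((1 / 2 * μ C * acceptRate κ β E E' : ℝ) : ℂ) •
          ((jumpOp H κ g r flip C E E')ᴴ * jumpOp H κ g r flip C E E')) * M +
      M * ∑ C ∈ 𝒞, ∑ flip : Bool, ∑ E : Reg g r, ∑ E' : Reg g r,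
        ((1 / 2 * μ C * acceptRate κ β E E' : ℝ) : ℂ) •
          ((jumpOp H κ g r flip C E E')ᴴ * jumpOp H κ g r flip C E E')) := by
    rw [generator_apply]
    simp only [Finset.sum_mul, Finset.mul_sum, ← Finset.sum_add_distrib, ← Finset.sum_sub_distrib]
    refine Finset.sum_congr rfl fun C _ => Finset.sum_congr rfl fun flip _ =>
      Finset.sum_congr rfl fun E _ => Finset.sum_congr rfl fun E' _ => ?_
    rw [Matrix.smul_mul, Matrix.mul_smul]
    push_cast
    module
  rw [hfwd, hrev]
  simp only [Finset.sum_mul, Finset.mul_sum, Finset.smul_sum, ← Finset.sum_add_distrib,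
    ← Finset.sum_sub_distrib]
  refine Finset.sum_congr rfl fun C _ => Finset.sum_congr rfl fun flip _ =>
    Finset.sum_congr rfl fun E _ => Finset.sum_congr rfl fun E' _ => ?_
  rw [Matrix.smul_mul, Matrix.mul_smul]
  push_cast
  module

theorem acceptRate_detailed_balance (E E' : Reg g r) :
    acceptRate κ β E E' * Real.exp (-(β * medianEnergy κ E)) =
      acceptRate κ β E' E * Real.exp (-(β * medianEnergy κ E')) := by
  rw [acceptRate, acceptRate, min_mul_of_nonneg _ _ (Real.exp_pos _).le,
    min_mul_of_nonneg _ _ (Real.exp_pos _).le, ← Real.exp_add, ← Real.exp_add, one_mul, one_mul,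
    min_comm]
  congr 2 <;> ring

end Jumps

/-! ### The defect of the Gibbs state, and the algebra of the Lindblad operators -/

section FixedPoint

variable {n g r : ℕ} {κ β : ℝ} {Φ : Op (Bits n)} {lam : Bits n → ℝ}

/-- A dissipator with reversed anticommutator part commutes with a change of orthonormal basis. -/
theorem conj_dissipator (h1 : Φᴴ * Φ = 1) (k P : Op (Bits n)) (s t : ℂ) :
    s • ((Φ * k * Φᴴ) * (Φ * P * Φᴴ) * (Φ * k * Φᴴ)ᴴ) - t •
      ((Φ * k * Φᴴ) * (Φ * k * Φᴴ)ᴴ * (Φ * P * Φᴴ) +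
        (Φ * P * Φᴴ) * ((Φ * k * Φᴴ) * (Φ * k * Φᴴ)ᴴ)) =
    Φ * (s • (k * P * kᴴ) - t • (k * kᴴ * P + P * (k * kᴴ))) * Φᴴ := by
  have hmul : ∀ x y : Op (Bits n), (Φ * x * Φᴴ) * (Φ * y * Φᴴ) = Φ * (x * y) * Φᴴ := by
    intro x y
    calc _ = Φ * x * (Φᴴ * Φ) * y * Φᴴ := by simp only [Matrix.mul_assoc]
      _ = _ := by rw [h1, Matrix.mul_one, Matrix.mul_assoc Φ]
  have hstar : (Φ * k * Φᴴ)ᴴ = Φ * kᴴ * Φᴴ := by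
    rw [Matrix.conjTranspose_mul, Matrix.conjTranspose_mul, Matrix.conjTranspose_conjTranspose,
      Matrix.mul_assoc]
  simp only [hstar, hmul, Matrix.mul_sub, Matrix.sub_mul, Matrix.mul_smul, Matrix.smul_mul,
    Matrix.mul_add, Matrix.add_mul]

/-- For one jump operator and one version of phase estimation, the trace of a unitary against the
dissipator of the Gibbs state is the sum bounded in `norm_gibbs_defect_le`. -/
theorem trace_mul_reversed_dissipator (h1 : Φᴴ * Φ = 1) (flip : Bool) (C Q : Op (Bits n))
    (p : Bits n → ℝ) {H : Op (Bits n)} (hH : H = conjDiag Φ fun i => (lam i : ℂ)) :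
    (Q * ∑ E : Reg g r, ∑ E' : Reg g r, (((2 * acceptRate κ β E E' : ℝ) : ℂ) •
        (jumpOp H κ g r flip C E E' * (conjDiag Φ fun i => (p i : ℂ)) *
          (jumpOp H κ g r flip C E E')ᴴ) -
        ((acceptRate κ β E' E : ℝ) : ℂ) •
          (jumpOp H κ g r flip C E E' * (jumpOp H κ g r flip C E E')ᴴ *
            (conjDiag Φ fun i => (p i : ℂ)) + (conjDiag Φ fun i => (p i : ℂ)) *
            (jumpOp H κ g r flip C E E' * (jumpOp H κ g r flip C E E')ᴴ)))).trace =
    ∑ j, ∑ E : Reg g r, ∑ E' : Reg g r, ∑ a, ∑ b,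
      ((‖regAmp κ flip (lam j) E‖ ^ 2 : ℝ) : ℂ) *
      ((Φᴴ * Q * Φ) b a * (regAmp κ flip (lam a) E' * (Φᴴ * C * Φ) a j) *
      star (regAmp κ flip (lam b) E' * (Φᴴ * C * Φ) b j)) *
      ((2 * acceptRate κ β E E' * p j - acceptRate κ β E' E * (p a + p b) : ℝ) : ℂ) := by
  set k : Reg g r → Reg g r → Op (Bits n) := fun E E' =>
    Matrix.diagonal (fun i => regAmp κ flip (lam i) E') * (Φᴴ * C * Φ) *
      Matrix.diagonal fun i => regAmp κ flip (lam i) E with hk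
  have hK : ∀ E E', jumpOp H κ g r flip C E E' = Φ * k E E' * Φᴴ := by
    intro E E'
    rw [hH, jumpOp_conjDiag h1, conjDiag, conjDiag, hk]
    simp only [Matrix.mul_assoc]
  have hkapp : ∀ E E' a j, k E E' a j =
      regAmp κ flip (lam a) E' * (Φᴴ * C * Φ) a j * regAmp κ flip (lam j) E := by
    intro E E' a j
    simp only [hk, Matrix.mul_diagonal, Matrix.diagonal_mul]
  clear_value k
  have htr : ∀ X : Op (Bits n), (Q * (Φ * X * Φᴴ)).trace = (Φᴴ * Q * Φ * X).trace := by
    intro X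
    rw [← Matrix.mul_assoc, Matrix.trace_mul_comm]
    simp only [Matrix.mul_assoc]
  simp only [hK, conjDiag, conj_dissipator h1, Matrix.mul_sum, Matrix.trace_sum, htr,
    trace_mul_dissipator, hkapp]
  rw [Finset.sum_congr rfl fun E _ => Finset.sum_comm, Finset.sum_comm]
  refine Finset.sum_congr rfl fun j _ => Finset.sum_congr rfl fun E _ =>
    Finset.sum_congr rfl fun E' _ => Finset.sum_congr rfl fun a _ =>
    Finset.sum_congr rfl fun b _ => ?_
  have hn : ((‖regAmp κ flip (lam j) E‖ ^ 2 : ℝ) : ℂ) =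
      regAmp κ flip (lam j) E * star (regAmp κ flip (lam j) E) := by
    rw [Complex.ofReal_pow, ← Complex.mul_conj']
    rfl
  rw [hn, star_mul' (regAmp κ flip (lam b) E' * _)]
  ring

variable {𝒞 : Finset (Op (Bits n))} {μ : Op (Bits n) → ℝ}

theorem hermitianPreserving_generator (H : Op (Bits n)) :
    HermitianPreserving (generator H κ β g r 𝒞 μ) := by
  intro M hM
  rw [generator_eq_lindblad, Matrix.IsHermitian, ← lindblad_conjTranspose, hM]

theorem mul_div_two_pow_le_half (hκ : 0 < κ) (hβ : 0 ≤ β)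
    (hr : 0 < β → 1 + Real.logb 2 κ + Real.logb 2 β ≤ r) : β * (κ / 2 ^ r) ≤ 1 / 2 := by
  rcases hβ.eq_or_lt with rfl | hβ
  · norm_num
  have h := hr hβ
  rw [add_assoc, ← Real.logb_mul hκ.ne' hβ.ne'] at h
  have h2 : Real.logb 2 (κ * β) ≤ (r : ℝ) - 1 := by linarith
  rw [Real.logb_le_iff_le_rpow one_lt_two (by positivity), Real.rpow_sub two_pos, Real.rpow_natCast,
    Real.rpow_one] at h2
  rw [mul_div_assoc', div_le_iff₀ (by positivity)]
  linarith

theorem traceNorm_generator_gibbsState_le {H : Op (Bits n)} (hH : H.PosSemidef) (hκ : 0 < κ)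
    (hβ : 0 ≤ β) (h𝒞 : IsJumpDistribution 𝒞 μ) (hx : β * (κ / 2 ^ r) ≤ 1 / 2)
    (hHr : specNorm H ≤ κ * (1 - 1 / 2 ^ r)) :
    traceNorm (generator H κ β g r 𝒞 μ (gibbsState H β)) ≤
      12 * (2 ^ n) ^ 2 * (2 : ℝ) ^ (-(g : ℝ) / 6) + 16 * (β * (κ / 2 ^ r)) := by
  obtain ⟨Φ, lam, h1, h2, hd⟩ := exists_unitary_diagonal hH.1
  change H = conjDiag Φ fun i => (lam i : ℂ) at hd
  have hlam0 : ∀ i, 0 ≤ lam i := nonneg_of_posSemidef_conjDiag h1 (hd ▸ hH)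
  have hlam1 : ∀ i, lam i ≤ κ * (1 - 1 / 2 ^ r) := fun i =>
    ((le_specNorm_conjDiag h1 i).trans_eq (by rw [hd])).trans hHr
  set Z : ℝ := ∑ j, Real.exp (-(β * lam j)) with hZ
  have hZ0 : 0 < Z := Finset.sum_pos (fun j _ => Real.exp_pos _) Finset.univ_nonempty
  set p : Bits n → ℝ := fun i => Real.exp (-(β * lam i)) / Z with hp
  have hp1 : ∑ j, p j = 1 := by
    rw [hp, ← Finset.sum_div, ← hZ, div_self hZ0.ne']
  have hρ : gibbsState H β = conjDiag Φ fun i => (p i : ℂ) := by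
    rw [hd, gibbsState_conjDiag h1]
  have hherm : (conjDiag Φ fun i => (p i : ℂ)).IsHermitian := by
    rw [Matrix.IsHermitian, conjDiag_conjTranspose]
    congr 1
    ext i
    exact Complex.conj_ofReal _
  obtain ⟨Q, hQ, hQt⟩ := exists_unitary_trace_eq_traceNorm
    (hermitianPreserving_generator (κ := κ) (β := β) (g := g) (r := r) (𝒞 := 𝒞) (μ := μ) H _ hherm)
  have hconj : ∀ {A : Op (Bits n)}, Aᴴ * A = 1 → (Φᴴ * A * Φ)ᴴ * (Φᴴ * A * Φ) = 1 := by
    intro A hA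
    calc _ = Φᴴ * (Aᴴ * ((Φ * Φᴴ) * A)) * Φ := by
          simp only [Matrix.conjTranspose_mul, Matrix.conjTranspose_conjTranspose,
            Matrix.mul_assoc]
      _ = 1 := by rw [h2, Matrix.one_mul, hA, Matrix.mul_one, h1]
  have hδ : ((2 : ℝ) ^ (-(g : ℝ) / 6)) ^ 2 = (2 : ℝ) ^ (-(g : ℝ) / 3) := by
    rw [← Real.rpow_natCast, ← Real.rpow_mul two_pos.le]
    congr 1
    push_cast
    ring
  have hδ1 : (2 : ℝ) ^ (-(g : ℝ) / 6) ≤ 1 :=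
    Real.rpow_le_one_of_one_le_of_nonpos one_le_two
      (by have : (0 : ℝ) ≤ g := g.cast_nonneg
          linarith)
  set bound : ℝ := 12 * (2 ^ n) ^ 2 * (2 : ℝ) ^ (-(g : ℝ) / 6) + 16 * (β * (κ / 2 ^ r)) with hb
  have hterm : ∀ C ∈ 𝒞, ∀ flip : Bool, ‖(Q * ∑ E : Reg g r, ∑ E' : Reg g r,
      (((2 * acceptRate κ β E E' : ℝ) : ℂ) •
        (jumpOp H κ g r flip C E E' * (conjDiag Φ fun i => (p i : ℂ)) *
          (jumpOp H κ g r flip C E E')ᴴ) -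
        ((acceptRate κ β E' E : ℝ) : ℂ) •
          (jumpOp H κ g r flip C E E' * (jumpOp H κ g r flip C E E')ᴴ *
            (conjDiag Φ fun i => (p i : ℂ)) + (conjDiag Φ fun i => (p i : ℂ)) *
            (jumpOp H κ g r flip C E E' * (jumpOp H κ g r flip C E E')ᴴ)))).trace‖ ≤ bound := by
    intro C hC flip
    rw [trace_mul_reversed_dissipator h1 flip C Q p hd]
    refine (norm_gibbs_defect_le (B := fun j E => regAmp κ flip (lam j) E)
      (fun j => sum_norm_regAmp_sq κ flip (lam j)) hβ (by positivity) hx (by positivity) hδ1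
      (fun j => ?_) hZ0 (fun j => rfl) hp1 (hconj (h𝒞.isometry hC)) (hconj hQ)
      (fun E E' => (acceptRate_pos κ β E E').le) (acceptRate_le_one κ β)
      (acceptRate_detailed_balance β)).trans_eq ?_
    · rw [hδ]
      exact sum_norm_regAmp_sq_far hκ flip (hlam0 j) (hlam1 j)
    · rw [hb]
      simp
  have hreal : traceNorm (generator H κ β g r 𝒞 μ (conjDiag Φ fun i => (p i : ℂ))) ≤
      ‖(Q * generator H κ β g r 𝒞 μ (conjDiag Φ fun i => (p i : ℂ))).trace‖ := by
    rw [hQt, Complex.norm_real]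
    exact le_abs_self _
  rw [hρ]
  refine hreal.trans ?_
  rw [generator_apply_reversed β h1 h𝒞 hd]
  simp only [Finset.mul_sum 𝒞, Finset.mul_sum (Finset.univ : Finset Bool), Matrix.mul_smul,
    Matrix.trace_sum (s := 𝒞), Matrix.trace_sum (s := (Finset.univ : Finset Bool)),
    Matrix.trace_smul]
  calc _ ≤ ∑ C ∈ 𝒞, ∑ _flip : Bool, (1 / 2 * μ C) * bound := by
        refine (norm_sum_le _ _).trans (Finset.sum_le_sum fun C hC => ?_)
        refine (norm_sum_le _ _).trans (Finset.sum_le_sum fun flip _ => ?_)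
        have hμ := h𝒞.nonneg C hC
        rw [smul_eq_mul, norm_mul, Complex.norm_real, Real.norm_eq_abs,
          abs_of_nonneg (by positivity)]
        exact mul_le_mul_of_nonneg_left (hterm C hC flip) (by positivity)
    _ = bound := by
        rw [Finset.sum_congr rfl fun C _ => (Finset.sum_mul _ _ _).symm, ← Finset.sum_mul,
          h𝒞.sum_weights, one_mul]

end FixedPoint

section Relaxation

variable {n g r : ℕ} {κ β : ℝ} {𝒞 : Finset (Op (Bits n))} {μ : Op (Bits n) → ℝ}

/-- If the jump operators generate all operators, so do the Lindblad operators, as every jump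
operator is the sum of its Lindblad operators. -/
theorem adjoin_jumpOp_eq_top {H : Op (Bits n)} (hH : H.IsHermitian)
    (hgen : Algebra.adjoin ℂ {C | C ∈ 𝒞 ∧ 0 < μ C} = ⊤) :
    Algebra.adjoin ℂ {A | ∃ u : 𝒞 × Bool × Reg g r × Reg g r,
      0 < 1 / 2 * μ u.1 * acceptRate κ β u.2.2.1 u.2.2.2 ∧
        jumpOp H κ g r u.2.1 u.1 u.2.2.1 u.2.2.2 = A} = ⊤ := by
  obtain ⟨Φ, lam, h1, -, hd⟩ := exists_unitary_diagonal hH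
  change H = conjDiag Φ fun i => (lam i : ℂ) at hd
  rw [eq_top_iff, ← hgen]
  refine Algebra.adjoin_le fun C hC => ?_
  rw [← sum_jumpOp (g := g) (r := r) (κ := κ) (lam := lam) h1 false C, ← hd]
  refine Subalgebra.sum_mem _ fun E _ => Subalgebra.sum_mem _ fun E' _ => ?_
  refine Algebra.subset_adjoin ⟨(⟨C, hC.1⟩, false, E, E'), ?_, rfl⟩
  exact mul_pos (mul_pos one_half_pos hC.2) (acceptRate_pos κ β E E')

end Relaxation

end QMetropolis

theorem theorem4p1 (n g r : ℕ)
    (H : QMetropolis.Op (QMetropolis.Bits n)) (hH : H.PosSemidef)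
    (κ : ℝ) (hκ : ∃ k : ℤ, κ = 2 ^ k) (hHκ : QMetropolis.specNorm H ≤ κ)
    (β : ℝ) (hβ : 0 ≤ β)
    (𝒞 : Finset (QMetropolis.Op (QMetropolis.Bits n)))
    (μ : QMetropolis.Op (QMetropolis.Bits n) → ℝ)
    (h𝒞 : QMetropolis.IsJumpDistribution 𝒞 μ) :
    -- expansion of one iteration, and the error term
    (QMetropolis.HermitianPreserving (QMetropolis.generator H κ β g r 𝒞 μ) ∧
      ∃ J : ℝ → (QMetropolis.Op (QMetropolis.Bits n) →ₗ[ℂ] QMetropolis.Op (QMetropolis.Bits n)),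
        ∀ τ : ℝ, 0 ≤ τ → τ ≤ 1 →
          QMetropolis.IsCPTP (QMetropolis.iteration H κ β g r 𝒞 μ τ) ∧
          QMetropolis.iteration H κ β g r 𝒞 μ τ =
            LinearMap.id + ((τ ^ 2 : ℝ) : ℂ) • QMetropolis.generator H κ β g r 𝒞 μ +
              ((τ ^ 4 : ℝ) : ℂ) • J τ ∧
          QMetropolis.HermitianPreserving (J τ) ∧
          QMetropolis.SuperNormLE (J τ) 4) ∧
    -- the Gibbs state is an approximate fixed point
    ((0 < β → 1 + Real.logb 2 κ + Real.logb 2 β ≤ r) →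
      QMetropolis.specNorm H ≤ κ * (1 - 1 / 2 ^ r) →
      QMetropolis.traceNorm
          (QMetropolis.generator H κ β g r 𝒞 μ (QMetropolis.gibbsState H β)) ≤
        (2 : ℝ) ^ (2 * (n : ℝ) + 4 - (g : ℝ) / 6) + 40 * β * κ / 2 ^ r) ∧
    -- uniqueness of the fixed state, and relaxation
    (Algebra.adjoin ℂ {C | C ∈ 𝒞 ∧ 0 < μ C} = ⊤ →
      ∃ ρL : QMetropolis.Op (QMetropolis.Bits n),
        QMetropolis.IsState ρL ∧ ρL.PosDef ∧
        QMetropolis.generator H κ β g r 𝒞 μ ρL = 0 ∧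
        (∀ M, QMetropolis.generator H κ β g r 𝒞 μ M = 0 → M = M.trace • ρL) ∧
        ∀ ρ, QMetropolis.IsState ρ →
          Filter.Tendsto
            (fun t : ℝ => QMetropolis.expSemigroup (QMetropolis.generator H κ β g r 𝒞 μ) t ρ)
            Filter.atTop (nhds ρL)) := by
  have hκ0 : 0 < κ := by
    obtain ⟨k, rfl⟩ := hκ
    positivity
  refine ⟨⟨QMetropolis.hermitianPreserving_generator H,
    fun _ => QMetropolis.quarticError H κ β g r 𝒞 μ, fun τ hτ0 hτ1 =>
      ⟨QMetropolis.isCPTP_iteration κ β hH.1 h𝒞 hτ0 hτ1,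
        QMetropolis.iteration_eq κ β hH.1 h𝒞 hτ0 hτ1,
        QMetropolis.hermitianPreserving_quarticError κ β, fun M hM hM1 =>
          (QMetropolis.superNormLE_quarticError κ β hH.1 h𝒞 M hM hM1).trans (by norm_num)⟩⟩,
    fun hr hHr => ?_, fun hgen => ?_⟩
  · refine (QMetropolis.traceNorm_generator_gibbsState_le hH hκ0 hβ h𝒞
      (QMetropolis.mul_div_two_pow_le_half hκ0 hβ hr) hHr).trans ?_
    have h1 : (2 : ℝ) ^ (2 * (n : ℝ) + 4 - (g : ℝ) / 6)
        = 16 * (2 ^ n) ^ 2 * (2 : ℝ) ^ (-(g : ℝ) / 6) := by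
      rw [show 2 * (n : ℝ) + 4 - (g : ℝ) / 6 = ((n * 2 + 4 : ℕ) : ℝ) + -(g : ℝ) / 6 by
        push_cast; ring, Real.rpow_add two_pos, Real.rpow_natCast, pow_add, pow_mul]
      ring
    have h2 : 40 * β * κ / 2 ^ r = 40 * (β * (κ / 2 ^ r)) := by ring
    have h3 : 0 ≤ β * (κ / 2 ^ r) := by positivity
    have h4 : (0 : ℝ) ≤ (2 ^ n) ^ 2 * (2 : ℝ) ^ (-(g : ℝ) / 6) := by positivity
    rw [h1, h2]
    linarith
  · have hw : ∀ u : 𝒞 × Bool × QMetropolis.Reg g r × QMetropolis.Reg g r,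
        0 ≤ 1 / 2 * μ u.1 * QMetropolis.acceptRate κ β u.2.2.1 u.2.2.2 := fun u =>
      mul_nonneg (mul_nonneg one_half_pos.le (h𝒞.nonneg u.1 u.1.2))
        (QMetropolis.acceptRate_pos κ β _ _).le
    have hK := QMetropolis.adjoin_jumpOp_eq_top (g := g) (r := r) (κ := κ) (β := β) hH.1 hgen
    rw [QMetropolis.generator_eq_lindblad]
    obtain ⟨σ, hσ, hσ1, hσ0, huniq⟩ := QMetropolis.exists_stationary_state hw hK
    exact ⟨σ, ⟨hσ.posSemidef, hσ1⟩, hσ, hσ0, huniq, fun ρ hρ =>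
      QMetropolis.tendsto_expSemigroup_lindblad hw hK hσ hσ1 hσ0 hρ.2⟩
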